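/- Let $0<\xi_1<\ell_0<\xi_2<\ell_1<\ell$ and let $\alpha_0,\alpha_1,\alpha_2,\gamma_1,\gamma_2,\gamma_3>0$. Put $\alpha(x)=\alpha_2$, $\kappa(x)=\alpha_0$ for $x\in(\ell_0,\ell_1)$ and $\alpha(x)=\alpha_1$, $\kappa(x)=0$ for $x\in(0,\ell_0)\cup(\ell_1,\ell)$, and let $I=(0,\xi_1)\cup(\xi_1,\ell_0)\cup(\ell_0,\xi_2)\cup(\xi_2,\ell_1)\cup(\ell_1,\ell)$. Write $[\![f]\!]_{x}=f(x^+)-f(x^-)$. On the complex space $\mathcal H=H_0^2(0,\ell)\times L^2(0,\ell)$ consider the norm $$\|(u,v)\|_{\mathcal H}^2=\int_0^\ell\bigl(|v|^2+\alpha|u_{xx}|^2\bigr)\,dx ,$$ and the operator $$\mathcal A(u,v)=\bigl(v,\,-M_{xx}\bigr),\qquad M=\alpha u_{xx}+\kappa v_{xx}$$ (with $M_{xx}$ taken on $I$), whose domain $\mathcal D(\mathcal A)$ consists of all $(u,v)\in\mathcal H$ such that $u,v\in H^2_0(0,\ell)$, $M\in H^2(I)$, and $$[\![M]\!]_{\ell_i}=[\![M_x]\!]_{\ell_i}=0\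 (i=0,1),\qquad [\![u_{xx}]\!]_{\xi_1}=0,\quad [\![M_x]\!]_{\xi_1}=-\gamma_1v(\xi_1),$$ $$[\![M_x]\!]_{\xi_2}=-\gamma_2v(\xi_2),\qquad [\![M]\!]_{\xi_2}=\gamma_3v_x(\xi_2).$$ (Near $\xi_1$ one has $M=\alpha u_{xx}$.) Then $\mathcal H$ is a Hilbert space, and $\mathcal A$ is the infinitesimal generator of a $C_0$-semigroup of contractions $(e^{\mathcal At})_{t\ge0}$ on $\mathcal H$. Moreover, let $0<T\le\infty$ (with $[0,T]$ read as $[0,\infty)$ if $T=\infty$) and consider the Cauchy problem $U_t=\mathcal AU$, $U(0)=U_0$ on $[0,T]$. For every $U_0\in\mathcal H$ it has exactly one mild solution, that is, exactly one $U\in C([0,T];\mathcal H)$ such that $\int_0^tU(s)\,ds\in\mathcal D(\mathcal A)$ and $U(t)=U_0+\mathcal A\int_0^tU(s)\,ds$ for all $t\in[0,T]$, namely $U(t)=e^{\mathcal At}U_0$. If $U_0\in\mathcal D(\mathcal A)$, then $U(t)=e^{\mathcal At}U_0$ is the unique solution of the Cauchy problem in $C^1([0,T];\mathcal H)\cap C([0,T];\mathcal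 D(\mathcal A))$, where $\mathcal D(\mathcal A)$ carries the graph norm. -/

import Mathlib

open MeasureTheory Set Filter Topology
open scoped ContDiff NNReal ComplexConjugate

noncomputable section

/-! ### Weak derivatives and one-sided traces on the line -/

/-- `g` is the weak derivative of `f` on the open set `Ω`, tested against smooth functions with
compact support in `Ω`. -/
def HasWeakDeriv (Ω : Set ℝ) (f g : ℝ → ℂ) : Prop :=
  ∀ φ : ℝ → ℝ, ContDiff ℝ ∞ φ → HasCompactSupport φ → tsupport φ ⊆ Ω →
    ∫ x in Ω, deriv φ x • f x = -∫ x in Ω, φ x • g x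

/-- `f(x⁺) = c` for a function given up to null sets: the essential limit of `f` from the right. -/
def HasRightTrace (f : ℝ → ℂ) (x : ℝ) (c : ℂ) : Prop :=
  Tendsto f (𝓝[>] x ⊓ ae volume) (𝓝 c)

/-- `f(x⁻) = c` for a function given up to null sets: the essential limit of `f` from the left. -/
def HasLeftTrace (f : ℝ → ℂ) (x : ℝ) (c : ℂ) : Prop :=
  Tendsto f (𝓝[<] x ⊓ ae volume) (𝓝 c)

/-- `f(x) = c` for a function given up to null sets, namely for its continuous representative. -/
def HasPointValue (f : ℝ → ℂ) (x : ℝ) (c : ℂ) : Prop :=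
  Tendsto f (𝓝 x ⊓ ae volume) (𝓝 c)

/-- The jump `f(x⁺) - f(x⁻)` exists and equals `d`. -/
def HasJump (f : ℝ → ℂ) (x : ℝ) (d : ℂ) : Prop :=
  ∃ l r : ℂ, HasLeftTrace f x l ∧ HasRightTrace f x r ∧ r - l = d

/-- The complex Lebesgue space `L²(0,ℓ)`. -/
abbrev LTwo (ℓ : ℝ) : Type := Lp ℂ 2 (volume.restrict (Ioo 0 ℓ))

/-! ### Elementary facts needed for the definitions below -/

namespace HasWeakDeriv

variable {Ω : Set ℝ} {f f' g g' : ℝ → ℂ}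

lemma congr (h : HasWeakDeriv Ω f g) (hf : f =ᵐ[volume.restrict Ω] f')
    (hg : g =ᵐ[volume.restrict Ω] g') : HasWeakDeriv Ω f' g' := by
  intro φ h1 h2 h3
  have e1 : ∫ x in Ω, deriv φ x • f' x = ∫ x in Ω, deriv φ x • f x :=
    integral_congr_ae (by filter_upwards [hf] with x hx; rw [hx])
  have e2 : ∫ x in Ω, φ x • g' x = ∫ x in Ω, φ x • g x :=
    integral_congr_ae (by filter_upwards [hg] with x hx; rw [hx])
  rw [e1, e2]
  exact h φ h1 h2 h3

lemma integrable_smul {φ : ℝ → ℝ} (hc : Continuous φ) (hs : HasCompactSupport φ)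
    (hf : IntegrableOn f Ω) : Integrable (fun x => φ x • f x) (volume.restrict Ω) := by
  obtain ⟨C, hC⟩ := hs.exists_bound_of_continuous hc
  exact hf.bdd_smul C hc.aestronglyMeasurable (Eventually.of_forall hC)

lemma add (h : HasWeakDeriv Ω f g) (h' : HasWeakDeriv Ω f' g') (hf : IntegrableOn f Ω)
    (hf' : IntegrableOn f' Ω) (hg : IntegrableOn g Ω) (hg' : IntegrableOn g' Ω) :
    HasWeakDeriv Ω (fun x => f x + f' x) (fun x => g x + g' x) := by
  intro φ h1 h2 h3
  have hd : Continuous (deriv φ) := h1.continuous_deriv (by simp)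
  simp only [smul_add]
  rw [integral_add (integrable_smul hd h2.deriv hf) (integrable_smul hd h2.deriv hf'),
    integral_add (integrable_smul h1.continuous h2 hg) (integrable_smul h1.continuous h2 hg'),
    h φ h1 h2 h3, h' φ h1 h2 h3]
  ring

lemma const_smul (c : ℂ) (h : HasWeakDeriv Ω f g) :
    HasWeakDeriv Ω (fun x => c * f x) (fun x => c * g x) := by
  intro φ h1 h2 h3
  have e : ∀ (r : ℝ) (z : ℂ), r • (c * z) = c * (r • z) := fun r z => by
    simp only [Complex.real_smul]
    ring
  simp only [e, integral_const_mul]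
  rw [h φ h1 h2 h3]
  ring

lemma zero : HasWeakDeriv Ω (fun _ => 0) (fun _ => 0) := by
  intro φ _ _ _
  simp

lemma setIntegral_eq {φ : ℝ → ℝ} (h : tsupport φ ⊆ Ω) (f : ℝ → ℂ) :
    ∫ x in Ω, φ x • f x = ∫ x, φ x • f x :=
  setIntegral_eq_integral_of_forall_compl_eq_zero fun x hx => by
    rw [image_eq_zero_of_notMem_tsupport (fun h' => hx (h h')), zero_smul]

/-- The weak derivative is unique. -/
lemma ae_zero (hΩ : IsOpen Ω) (h : HasWeakDeriv Ω f g) (hg : IntegrableOn g Ω)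
    (hf : f =ᵐ[volume.restrict Ω] 0) : g =ᵐ[volume.restrict Ω] 0 := by
  have key := hΩ.ae_eq_zero_of_integral_contDiff_smul_eq_zero (f := g) (μ := volume)
    hg.locallyIntegrableOn ?_
  · exact (ae_restrict_iff' hΩ.measurableSet).2 key
  · intro φ h1 h2 h3
    have h4 := h φ h1 h2 h3
    have h5 : ∫ x in Ω, deriv φ x • f x = 0 := by
      rw [integral_congr_ae (g := fun _ => (0 : ℂ)), integral_zero]
      filter_upwards [hf] with x hx
      simp [hx]
    rw [h5, setIntegral_eq h3] at h4
    simpa using h4.symm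

/-- A function with vanishing weak derivative on an interval is constant. -/
lemma ae_const {a b : ℝ} (hab : a < b) (h : HasWeakDeriv (Ioo a b) f g)
    (hf : IntegrableOn f (Ioo a b)) (hg : g =ᵐ[volume.restrict (Ioo a b)] 0) :
    ∃ c : ℂ, f =ᵐ[volume.restrict (Ioo a b)] fun _ => c := by
  let B : ContDiffBump ((a + b) / 2) := ⟨(b - a) / 8, (b - a) / 4, by linarith, by linarith⟩
  let χ : ℝ → ℝ := B.normed volume
  have hχ1 : ContDiff ℝ ∞ χ := B.contDiff_normed
  have hχ2 : HasCompactSupport χ := B.hasCompactSupport_normed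
  have hχ3 : tsupport χ ⊆ Ioo a b := by
    rw [B.tsupport_normed_eq, Real.closedBall_eq_Icc]
    intro x hx
    have h1 : B.rOut = (b - a) / 4 := rfl
    rw [h1] at hx
    constructor <;> linarith [hx.1, hx.2]
  have hχ4 : ∫ x, χ x = 1 := B.integral_normed
  refine ⟨∫ x in Ioo a b, χ x • f x, ?_⟩
  set C : ℂ := ∫ x in Ioo a b, χ x • f x
  have key := isOpen_Ioo.ae_eq_zero_of_integral_contDiff_smul_eq_zero
    (f := fun x => f x - C) (U := Ioo a b) (μ := volume)
    (IntegrableOn.locallyIntegrableOn (hf.sub (integrableOn_const (by simp) (by simp)))) ?_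
  · refine (ae_restrict_iff' measurableSet_Ioo).2 ?_
    filter_upwards [key] with x hx hxx using sub_eq_zero.1 (hx hxx)
  intro ψ hψ1 hψ2 hψ3
  set m : ℝ := ∫ x, ψ x
  let θ : ℝ → ℝ := fun x => ψ x - m * χ x
  have hθ1 : ContDiff ℝ ∞ θ := hψ1.sub (contDiff_const.mul hχ1)
  have hiψ : Integrable ψ := hψ1.continuous.integrable_of_hasCompactSupport hψ2
  have hiχ : Integrable χ := hχ1.continuous.integrable_of_hasCompactSupport hχ2
  have hθi : Integrable θ := hiψ.sub (hiχ.const_mul m)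
  have hθ0 : ∫ x, θ x = 0 := by
    rw [integral_sub hiψ (hiχ.const_mul m), integral_const_mul, hχ4]
    simp [m]
  let K := tsupport ψ ∪ tsupport χ
  have hK : IsCompact K := hψ2.isCompact.union hχ2.isCompact
  have hKs : K ⊆ Ioo a b := union_subset hψ3 hχ3
  have hθK : ∀ x, x ∉ K → θ x = 0 := fun x hx => by
    have h1 : ψ x = 0 := image_eq_zero_of_notMem_tsupport fun h' => hx (Or.inl h')
    have h2 : χ x = 0 := image_eq_zero_of_notMem_tsupport fun h' => hx (Or.inr h')
    simp [θ, h1, h2]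
  obtain ⟨c, d, hcd, hac, hdb, hKcd⟩ : ∃ c d, c ≤ d ∧ a < c ∧ d < b ∧ K ⊆ Icc c d := by
    have hne : K.Nonempty := by
      by_contra hne
      rw [not_nonempty_iff_eq_empty] at hne
      have : ∀ x, χ x = 0 := fun x => image_eq_zero_of_notMem_tsupport fun h' => by
        have : x ∈ K := Or.inr h'
        simp [hne] at this
      simp [this] at hχ4
    exact ⟨sInf K, sSup K, Real.sInf_le_sSup K hK.bddBelow hK.bddAbove,
      (hKs (hK.sInf_mem hne)).1, (hKs (hK.sSup_mem hne)).2,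
      fun x hx => ⟨csInf_le hK.bddBelow hx, le_csSup hK.bddAbove hx⟩⟩
  let φ : ℝ → ℝ := fun x => ∫ t in a..x, θ t
  have hφd : ∀ x, HasDerivAt φ (θ x) x := fun x =>
    hθ1.continuous.integral_hasStrictDerivAt a x |>.hasDerivAt
  have hφ' : deriv φ = θ := funext fun x => (hφd x).deriv
  have hφ1 : ContDiff ℝ ∞ φ :=
    contDiff_infty_iff_deriv.2 ⟨fun x => (hφd x).differentiableAt, hφ' ▸ hθ1⟩
  have hφs : Function.support φ ⊆ Icc c d := by
    intro x hx
    by_contra hx'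
    apply hx
    rcases lt_or_ge x c with hxc | hxc
    · change ∫ t in a..x, θ t = 0
      apply intervalIntegral.integral_zero_ae
      refine Eventually.of_forall fun t ht => hθK t fun hk => ?_
      have h1 := (hKcd hk).1
      have h2 := ht.2
      have h3 : max a x < c := max_lt hac hxc
      linarith
    · have hxd : d < x := by
        by_contra hxd
        exact hx' ⟨hxc, not_lt.1 hxd⟩
      change ∫ t in a..x, θ t = 0
      rw [intervalIntegral.integral_of_le (by linarith),
        setIntegral_eq_integral_of_forall_compl_eq_zero, hθ0]
      intro t ht
      refine hθK t fun hk => ht ?_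
      have h1 := hKcd hk
      exact ⟨by linarith [h1.1], by linarith [h1.2]⟩
  have hφ2 : HasCompactSupport φ := HasCompactSupport.of_support_subset_isCompact isCompact_Icc hφs
  have hφ3 : tsupport φ ⊆ Ioo a b :=
    (closure_minimal hφs isClosed_Icc).trans fun x hx => ⟨by linarith [hx.1], by linarith [hx.2]⟩
  have h4 := h φ hφ1 hφ2 hφ3
  have h5 : ∫ x in Ioo a b, φ x • g x = 0 := by
    rw [integral_congr_ae (g := fun _ => (0 : ℂ)), integral_zero]
    filter_upwards [hg] with x hx
    simp [hx]
  rw [h5, hφ', neg_zero] at h4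
  have h6 : ∫ x in Ioo a b, θ x • f x = (∫ x in Ioo a b, ψ x • f x) - m • C := by
    have : (fun x => θ x • f x) = fun x => ψ x • f x - m • (χ x • f x) := by
      funext x
      simp only [θ, sub_smul, mul_smul]
    have hi : Integrable (fun x => m • (χ x • f x)) (volume.restrict (Ioo a b)) :=
      (integrable_smul hχ1.continuous hχ2 hf).smul m
    rw [this, integral_sub (integrable_smul hψ1.continuous hψ2 hf) hi, integral_smul]
  rw [← setIntegral_eq hψ3]
  have h7 : IntegrableOn ψ (Ioo a b) := hiψ.integrableOn
  have h8 : ∫ x in Ioo a b, ψ x • C = m • C := by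
    rw [integral_smul_const]
    congr 1
    exact setIntegral_eq_integral_of_forall_compl_eq_zero fun x hx =>
      image_eq_zero_of_notMem_tsupport fun h' => hx (hψ3 h')
  simp only [smul_sub]
  rw [integral_sub (integrable_smul hψ1.continuous hψ2 hf) (h7.smul_const C), h8, ← h6, h4]

end HasWeakDeriv

section Traces

variable {Ω : Set ℝ} {f f' : ℝ → ℂ} {x : ℝ} {c c' : ℂ}

lemma eventuallyEq_of_ae_restrict {F : Filter ℝ} (hF : Ω ∈ F)
    (h : f =ᵐ[volume.restrict Ω] f') : f =ᶠ[F ⊓ ae volume] f' := by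
  have h1 : ∀ᶠ y in ae volume, y ∈ Ω → f y = f' y := ae_imp_of_ae_restrict h
  filter_upwards [h1.filter_mono inf_le_right, mem_inf_of_left hF] with y hy hy' using hy hy'

instance neBot_nhdsGT_inf_ae : (𝓝[>] x ⊓ ae (volume : Measure ℝ)).NeBot := by
  refine inf_neBot_iff.2 fun {s} hs {t} ht => ?_
  obtain ⟨u, hu, hus⟩ := mem_nhdsGT_iff_exists_Ioo_subset.1 hs
  by_contra hne
  rw [not_nonempty_iff_eq_empty] at hne
  have h1 : Ioo x u ⊆ tᶜ := fun y hy hyt => by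
    have : y ∈ s ∩ t := ⟨hus hy, hyt⟩
    simp [hne] at this
  have h2 : volume (Ioo x u) = 0 := measure_mono_null h1 ht
  rw [Real.volume_Ioo, ENNReal.ofReal_eq_zero] at h2
  have h3 : x < u := hu
  linarith

lemma HasJump.congr {d : ℂ} (hΩ : Ω ∈ 𝓝 x) (h : HasJump f x d)
    (he : f =ᵐ[volume.restrict Ω] f') : HasJump f' x d := by
  obtain ⟨l, r, hl, hr, hd⟩ := h
  exact ⟨l, r, Tendsto.congr' (eventuallyEq_of_ae_restrict (mem_nhdsWithin_of_mem_nhds hΩ) he) hl,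
    Tendsto.congr' (eventuallyEq_of_ae_restrict (mem_nhdsWithin_of_mem_nhds hΩ) he) hr, hd⟩

lemma HasJump.add {d d' : ℂ} (h : HasJump f x d) (h' : HasJump f' x d') :
    HasJump (fun y => f y + f' y) x (d + d') := by
  obtain ⟨l, r, hl, hr, hd⟩ := h
  obtain ⟨l', r', hl', hr', hd'⟩ := h'
  exact ⟨l + l', r + r', Tendsto.add hl hl', Tendsto.add hr hr', by rw [← hd, ← hd']; ring⟩

lemma HasJump.const_mul {d : ℂ} (k : ℂ) (h : HasJump f x d) :
    HasJump (fun y => k * f y) x (k * d) := by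
  obtain ⟨l, r, hl, hr, hd⟩ := h
  exact ⟨k * l, k * r, Tendsto.const_mul k hl, Tendsto.const_mul k hr, by rw [← hd]; ring⟩

lemma HasJump.zero : HasJump (fun _ => 0) x 0 :=
  ⟨0, 0, tendsto_const_nhds, tendsto_const_nhds, sub_zero 0⟩

end Traces

namespace LTwo

variable {ℓ : ℝ}

lemma integrableOn (f : LTwo ℓ) {Ω : Set ℝ} (hΩ : Ω ⊆ Ioo 0 ℓ) : IntegrableOn f Ω :=
  IntegrableOn.mono_set ((Lp.memLp f).integrable one_le_two) hΩ

lemma coe_add (f g : LTwo ℓ) : (f + g : LTwo ℓ) =ᵐ[volume.restrict (Ioo 0 ℓ)]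
    fun x => f x + g x := Lp.coeFn_add f g

lemma coe_smul (c : ℂ) (f : LTwo ℓ) : (c • f : LTwo ℓ) =ᵐ[volume.restrict (Ioo 0 ℓ)]
    fun x => c * f x := Lp.coeFn_smul c f

lemma coe_zero : (0 : LTwo ℓ) =ᵐ[volume.restrict (Ioo 0 ℓ)] fun _ => 0 :=
  Lp.coeFn_zero ℂ 2 _

lemma weakDeriv_add {Ω : Set ℝ} (hΩ : Ω ⊆ Ioo 0 ℓ) {f f' g g' : LTwo ℓ}
    (h : HasWeakDeriv Ω f g) (h' : HasWeakDeriv Ω f' g') :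
    HasWeakDeriv Ω (f + f' : LTwo ℓ) (g + g' : LTwo ℓ) :=
  (h.add h' (integrableOn f hΩ) (integrableOn f' hΩ) (integrableOn g hΩ)
    (integrableOn g' hΩ)).congr (ae_restrict_of_ae_restrict_of_subset hΩ (coe_add f f').symm)
    (ae_restrict_of_ae_restrict_of_subset hΩ (coe_add g g').symm)

lemma weakDeriv_smul {Ω : Set ℝ} (hΩ : Ω ⊆ Ioo 0 ℓ) (c : ℂ) {f g : LTwo ℓ}
    (h : HasWeakDeriv Ω f g) : HasWeakDeriv Ω (c • f : LTwo ℓ) (c • g : LTwo ℓ) :=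
  (h.const_smul c).congr (ae_restrict_of_ae_restrict_of_subset hΩ (coe_smul c f).symm)
    (ae_restrict_of_ae_restrict_of_subset hΩ (coe_smul c g).symm)

lemma weakDeriv_zero {Ω : Set ℝ} (hΩ : Ω ⊆ Ioo 0 ℓ) :
    HasWeakDeriv Ω (0 : LTwo ℓ) (0 : LTwo ℓ) :=
  HasWeakDeriv.zero.congr (ae_restrict_of_ae_restrict_of_subset hΩ coe_zero.symm)
    (ae_restrict_of_ae_restrict_of_subset hΩ coe_zero.symm)

lemma tendsto_add {F : Filter ℝ} (hF : Ioo 0 ℓ ∈ F) {f g : LTwo ℓ} {c d : ℂ}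
    (hf : Tendsto f (F ⊓ ae volume) (𝓝 c)) (hg : Tendsto g (F ⊓ ae volume) (𝓝 d)) :
    Tendsto (f + g : LTwo ℓ) (F ⊓ ae volume) (𝓝 (c + d)) :=
  (hf.add hg).congr' (eventuallyEq_of_ae_restrict hF (coe_add f g).symm)

lemma tendsto_smul {F : Filter ℝ} (hF : Ioo 0 ℓ ∈ F) {f : LTwo ℓ} {c : ℂ} (k : ℂ)
    (hf : Tendsto f (F ⊓ ae volume) (𝓝 c)) :
    Tendsto (k • f : LTwo ℓ) (F ⊓ ae volume) (𝓝 (k * c)) :=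
  (hf.const_mul k).congr' (eventuallyEq_of_ae_restrict hF (coe_smul k f).symm)

lemma tendsto_zero {F : Filter ℝ} (hF : Ioo 0 ℓ ∈ F) :
    Tendsto (0 : LTwo ℓ) (F ⊓ ae volume) (𝓝 0) :=
  tendsto_const_nhds.congr' (eventuallyEq_of_ae_restrict hF coe_zero.symm)

end LTwo

/-! ### The Sobolev space `H₀²(0,ℓ)` -/

/-- The clamped conditions `f(0) = f(ℓ) = 0`. -/
def VanishesAtEnds {ℓ : ℝ} (f : LTwo ℓ) : Prop :=
  HasRightTrace f 0 0 ∧ HasLeftTrace f ℓ 0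

lemma VanishesAtEnds.add {ℓ : ℝ} (hℓ : 0 < ℓ) {f g : LTwo ℓ} (hf : VanishesAtEnds f)
    (hg : VanishesAtEnds g) : VanishesAtEnds (f + g) := by
  have h1 := LTwo.tendsto_add (Ioo_mem_nhdsGT hℓ) hf.1 hg.1
  have h2 := LTwo.tendsto_add (Ioo_mem_nhdsLT hℓ) hf.2 hg.2
  rw [add_zero] at h1 h2
  exact ⟨h1, h2⟩

lemma VanishesAtEnds.smul {ℓ : ℝ} (hℓ : 0 < ℓ) (c : ℂ) {f : LTwo ℓ} (hf : VanishesAtEnds f) :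
    VanishesAtEnds (c • f) := by
  have h1 := LTwo.tendsto_smul (Ioo_mem_nhdsGT hℓ) c hf.1
  have h2 := LTwo.tendsto_smul (Ioo_mem_nhdsLT hℓ) c hf.2
  rw [mul_zero] at h1 h2
  exact ⟨h1, h2⟩

lemma VanishesAtEnds.zero {ℓ : ℝ} (hℓ : 0 < ℓ) : VanishesAtEnds (0 : LTwo ℓ) :=
  ⟨LTwo.tendsto_zero (Ioo_mem_nhdsGT hℓ), LTwo.tendsto_zero (Ioo_mem_nhdsLT hℓ)⟩

/-- The parameters of the beam: the points `0 < ξ₁ < ℓ₀ < ξ₂ < ℓ₁ < ℓ`, the stiffness `α₁` of the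
elastic parts `(0,ℓ₀)`, `(ℓ₁,ℓ)`, the stiffness `α₂` and the viscosity `α₀` of the viscoelastic part
`(ℓ₀,ℓ₁)`, and the coefficients `γ₁`, `γ₂`, `γ₃` of the pointwise terms. -/
structure Beam where
  (ξ₁ ℓ₀ ξ₂ ℓ₁ ℓ : ℝ)
  (α₀ α₁ α₂ γ₁ γ₂ γ₃ : ℝ)
  ξ₁_pos : 0 < ξ₁
  ξ₁_lt : ξ₁ < ℓ₀
  ℓ₀_lt : ℓ₀ < ξ₂
  ξ₂_lt : ξ₂ < ℓ₁
  ℓ₁_lt : ℓ₁ < ℓ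
  α₀_pos : 0 < α₀
  α₁_pos : 0 < α₁
  α₂_pos : 0 < α₂
  γ₁_pos : 0 < γ₁
  γ₂_pos : 0 < γ₂
  γ₃_pos : 0 < γ₃

namespace Beam

variable (P : Beam)

lemma ℓ_pos : 0 < P.ℓ :=
  P.ξ₁_pos.trans (P.ξ₁_lt.trans (P.ℓ₀_lt.trans (P.ξ₂_lt.trans P.ℓ₁_lt)))

/-- The stiffness `α(x)`. -/
def α (x : ℝ) : ℝ := if x ∈ Ioo P.ℓ₀ P.ℓ₁ then P.α₂ else P.α₁

/-- The viscosity `κ(x)`. -/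
def κ (x : ℝ) : ℝ := if x ∈ Ioo P.ℓ₀ P.ℓ₁ then P.α₀ else 0

/-- The open set `I = (0,ξ₁) ∪ (ξ₁,ℓ₀) ∪ (ℓ₀,ξ₂) ∪ (ξ₂,ℓ₁) ∪ (ℓ₁,ℓ)`. -/
def I : Set ℝ :=
  Ioo 0 P.ξ₁ ∪ Ioo P.ξ₁ P.ℓ₀ ∪ Ioo P.ℓ₀ P.ξ₂ ∪ Ioo P.ξ₂ P.ℓ₁ ∪ Ioo P.ℓ₁ P.ℓ

/-- The space `H₀²(0,ℓ)`: functions `u ∈ L²(0,ℓ)` with weak derivatives `u_x, u_xx ∈ L²(0,ℓ)` and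
`u(0) = u_x(0) = u(ℓ) = u_x(ℓ) = 0`. An element is recorded as the triple `(u, u_x, u_xx)`; it is
determined by `u`, see `H20.ext_fn`. -/
def h20Submodule : Submodule ℂ (LTwo P.ℓ × LTwo P.ℓ × LTwo P.ℓ) where
  carrier := {u | HasWeakDeriv (Ioo 0 P.ℓ) u.1 u.2.1 ∧ HasWeakDeriv (Ioo 0 P.ℓ) u.2.1 u.2.2 ∧
    VanishesAtEnds u.1 ∧ VanishesAtEnds u.2.1}
  add_mem' := fun hu hv =>
    ⟨LTwo.weakDeriv_add subset_rfl hu.1 hv.1, LTwo.weakDeriv_add subset_rfl hu.2.1 hv.2.1,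
      hu.2.2.1.add P.ℓ_pos hv.2.2.1, hu.2.2.2.add P.ℓ_pos hv.2.2.2⟩
  zero_mem' := ⟨LTwo.weakDeriv_zero subset_rfl, LTwo.weakDeriv_zero subset_rfl,
    VanishesAtEnds.zero P.ℓ_pos, VanishesAtEnds.zero P.ℓ_pos⟩
  smul_mem' := fun c _ hu =>
    ⟨LTwo.weakDeriv_smul subset_rfl c hu.1, LTwo.weakDeriv_smul subset_rfl c hu.2.1,
      hu.2.2.1.smul P.ℓ_pos c, hu.2.2.2.smul P.ℓ_pos c⟩

/-- The space `H₀²(0,ℓ)` as a type. -/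
abbrev H20 : Type := P.h20Submodule

variable {P}

namespace H20

/-- The function `u` itself. -/
def fn (u : P.H20) : LTwo P.ℓ := u.1.1

/-- The weak derivative `u_x`. -/
def dx (u : P.H20) : LTwo P.ℓ := u.1.2.1

/-- The second weak derivative `u_xx`. -/
def dxx (u : P.H20) : LTwo P.ℓ := u.1.2.2

lemma weakDeriv_eq_zero {f g : LTwo P.ℓ} (h : HasWeakDeriv (Ioo 0 P.ℓ) f g) (hf : f = 0) :
    g = 0 := by
  refine Lp.ext ?_
  have h1 : f =ᵐ[volume.restrict (Ioo 0 P.ℓ)] (0 : ℝ → ℂ) := by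
    rw [hf]
    exact Lp.coeFn_zero ℂ 2 _
  exact (h.ae_zero isOpen_Ioo (LTwo.integrableOn g subset_rfl) h1).trans
    (Lp.coeFn_zero ℂ 2 _).symm

lemma eq_zero_of_weakDeriv {f g : LTwo P.ℓ} (h : HasWeakDeriv (Ioo 0 P.ℓ) f g) (hg : g = 0)
    (hf : VanishesAtEnds f) : f = 0 := by
  have h1 : g =ᵐ[volume.restrict (Ioo 0 P.ℓ)] (0 : ℝ → ℂ) := by
    rw [hg]
    exact Lp.coeFn_zero ℂ 2 _
  obtain ⟨c, hc⟩ := h.ae_const P.ℓ_pos (LTwo.integrableOn f subset_rfl) h1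
  have h2 : Tendsto (fun _ : ℝ => c) (𝓝[>] (0 : ℝ) ⊓ ae volume) (𝓝 0) :=
    Tendsto.congr' (eventuallyEq_of_ae_restrict (Ioo_mem_nhdsGT P.ℓ_pos) hc) hf.1
  have h3 : c = 0 := tendsto_nhds_unique tendsto_const_nhds h2
  subst h3
  exact Lp.ext (hc.trans (Lp.coeFn_zero ℂ 2 _).symm)

lemma eq_zero_of_fn {u : P.H20} (h : u.fn = 0) : u = 0 := by
  have h1 : u.dx = 0 := weakDeriv_eq_zero u.2.1 h
  have h2 : u.dxx = 0 := weakDeriv_eq_zero u.2.2.1 h1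
  exact Subtype.ext (Prod.ext h (Prod.ext h1 h2))

lemma ext_fn {u v : P.H20} (h : u.fn = v.fn) : u = v :=
  sub_eq_zero.1 (eq_zero_of_fn (u := u - v) (sub_eq_zero.2 h))

lemma eq_zero_of_dxx {u : P.H20} (h : u.dxx = 0) : u = 0 :=
  eq_zero_of_fn (eq_zero_of_weakDeriv u.2.1 (eq_zero_of_weakDeriv u.2.2.1 h u.2.2.2.2) u.2.2.2.1)

end H20

/-! ### The phase space -/

variable (P) in
/-- The phase space `H₀²(0,ℓ) × L²(0,ℓ)`; its elements are pairs `(u, v)`. -/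
def Phase : Type := P.H20 × LTwo P.ℓ

namespace Phase

instance : AddCommGroup P.Phase := inferInstanceAs (AddCommGroup (P.H20 × LTwo P.ℓ))

instance : Module ℂ P.Phase := inferInstanceAs (Module ℂ (P.H20 × LTwo P.ℓ))

/-- The displacement `u`. -/
def disp (U : P.Phase) : P.H20 := Prod.fst U

/-- The velocity `v`. -/
def vel (U : P.Phase) : LTwo P.ℓ := Prod.snd U

lemma disp_add (U V : P.Phase) : (U + V).disp = U.disp + V.disp := rfl

lemma vel_add (U V : P.Phase) : (U + V).vel = U.vel + V.vel := rfl

lemma disp_smul (c : ℂ) (U : P.Phase) : (c • U).disp = c • U.disp := rfl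

lemma vel_smul (c : ℂ) (U : P.Phase) : (c • U).vel = c • U.vel := rfl

lemma ext' {U V : P.Phase} (h : U.disp = V.disp) (h' : U.vel = V.vel) : U = V := Prod.ext h h'

end Phase

lemma measurable_α : Measurable P.α :=
  Measurable.ite measurableSet_Ioo measurable_const measurable_const

lemma α_pos (x : ℝ) : 0 < P.α x := by
  unfold α
  split_ifs
  exacts [P.α₂_pos, P.α₁_pos]

lemma α_le (x : ℝ) : P.α x ≤ P.α₁ + P.α₂ := by
  unfold α
  split_ifs <;> linarith [P.α₁_pos, P.α₂_pos]

lemma integrable_conj_mul (f g : LTwo P.ℓ) :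
    Integrable (fun x => conj (f x) * g x) (volume.restrict (Ioo 0 P.ℓ)) := by
  have := L2.integrable_inner (𝕜 := ℂ) f g
  refine this.congr (Eventually.of_forall fun x => ?_)
  simp [mul_comm]

lemma integrable_α_conj_mul (f g : LTwo P.ℓ) :
    Integrable (fun x => (P.α x : ℂ) * (conj (f x) * g x)) (volume.restrict (Ioo 0 P.ℓ)) := by
  refine (integrable_conj_mul f g).bdd_mul (c := P.α₁ + P.α₂)
    (Complex.measurable_ofReal.comp measurable_α).aestronglyMeasurable
    (Eventually.of_forall fun x => ?_)
  rw [Complex.norm_real, Real.norm_of_nonneg (α_pos x).le]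
  exact α_le x

/-- The inner product of the phase space, with
`‖(u, v)‖² = ∫₀^ℓ (|v|² + α |u_xx|²) dx`. -/
@[reducible] def innerCore : InnerProductSpace.Core ℂ P.Phase where
  inner U V := ∫ x in Ioo 0 P.ℓ, (conj (U.vel x) * V.vel x +
    (P.α x : ℂ) * (conj (U.disp.dxx x) * V.disp.dxx x))
  conj_inner_symm U V := by
    rw [← integral_conj]
    congr 1
    funext x
    simp only [map_add, map_mul, Complex.conj_conj, Complex.conj_ofReal]
    ring
  re_inner_nonneg U := by
    have e : ∀ x, conj (U.vel x) * U.vel x + (P.α x : ℂ) * (conj (U.disp.dxx x) * U.disp.dxx x)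
        = ((‖U.vel x‖ ^ 2 + P.α x * ‖U.disp.dxx x‖ ^ 2 : ℝ) : ℂ) := fun x => by
      rw [Complex.conj_mul', Complex.conj_mul']
      push_cast
      ring
    simp only [e]
    rw [integral_complex_ofReal]
    exact integral_nonneg fun x =>
      add_nonneg (sq_nonneg _) (mul_nonneg (α_pos x).le (sq_nonneg _))
  add_left U V W := by
    have hi : ∀ Z : P.Phase, Integrable (fun x => conj (Z.vel x) * W.vel x +
        (P.α x : ℂ) * (conj (Z.disp.dxx x) * W.disp.dxx x)) (volume.restrict (Ioo 0 P.ℓ)) :=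
      fun Z => (integrable_conj_mul _ _).add (integrable_α_conj_mul _ _)
    rw [← integral_add (hi U) (hi V)]
    refine integral_congr_ae ?_
    filter_upwards [LTwo.coe_add U.vel V.vel, LTwo.coe_add U.disp.dxx V.disp.dxx] with x h1 h2
    have h1' : (U + V).vel x = U.vel x + V.vel x := h1
    have h2' : (U + V).disp.dxx x = U.disp.dxx x + V.disp.dxx x := h2
    simp only [h1', h2', map_add]
    ring
  smul_left U V r := by
    rw [← integral_const_mul]
    refine integral_congr_ae ?_
    filter_upwards [LTwo.coe_smul r U.vel, LTwo.coe_smul r U.disp.dxx] with x h1 h2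
    have h1' : (r • U).vel x = r * U.vel x := h1
    have h2' : (r • U).disp.dxx x = r * U.disp.dxx x := h2
    simp only [h1', h2', map_mul]
    ring
  definite U h := by
    have e : ∀ x, conj (U.vel x) * U.vel x + (P.α x : ℂ) * (conj (U.disp.dxx x) * U.disp.dxx x)
        = ((‖U.vel x‖ ^ 2 + P.α x * ‖U.disp.dxx x‖ ^ 2 : ℝ) : ℂ) := fun x => by
      rw [Complex.conj_mul', Complex.conj_mul']
      push_cast
      ring
    have hint : Integrable (fun x => ‖U.vel x‖ ^ 2 + P.α x * ‖U.disp.dxx x‖ ^ 2)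
        (volume.restrict (Ioo 0 P.ℓ)) := by
      have := ((integrable_conj_mul U.vel U.vel).add
        (integrable_α_conj_mul U.disp.dxx U.disp.dxx)).re
      refine this.congr (Eventually.of_forall fun x => ?_)
      simp only [Pi.add_apply, e]
      exact Complex.ofReal_re _
    simp only [e] at h
    rw [integral_complex_ofReal] at h
    have h0 := (integral_eq_zero_iff_of_nonneg (fun x =>
      add_nonneg (sq_nonneg _) (mul_nonneg (α_pos x).le (sq_nonneg _))) hint).1
      (Complex.ofReal_eq_zero.1 h)
    have hv : U.vel = 0 := by
      refine Lp.ext (EventuallyEq.trans ?_ (Lp.coeFn_zero ℂ 2 _).symm)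
      filter_upwards [h0] with x hx
      have h2 := mul_nonneg (P.α_pos x).le (sq_nonneg ‖U.disp.dxx x‖)
      have h3 : ‖U.vel x‖ ^ 2 + P.α x * ‖U.disp.dxx x‖ ^ 2 = 0 := hx
      have h4 : ‖U.vel x‖ ^ 2 = 0 := by linarith [sq_nonneg ‖U.vel x‖]
      simpa using h4
    have hw : U.disp.dxx = 0 := by
      refine Lp.ext (EventuallyEq.trans ?_ (Lp.coeFn_zero ℂ 2 _).symm)
      filter_upwards [h0] with x hx
      have h2 := mul_nonneg (P.α_pos x).le (sq_nonneg ‖U.disp.dxx x‖)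
      have h3 : ‖U.vel x‖ ^ 2 + P.α x * ‖U.disp.dxx x‖ ^ 2 = 0 := hx
      have h4 : P.α x * ‖U.disp.dxx x‖ ^ 2 = 0 := by linarith [sq_nonneg ‖U.vel x‖]
      have h5 := (mul_eq_zero.1 h4).resolve_left (P.α_pos x).ne'
      simpa using h5
    exact Phase.ext' (H20.eq_zero_of_dxx hw) hv

instance : NormedAddCommGroup P.Phase := innerCore.toNormedAddCommGroup

instance : InnerProductSpace ℂ P.Phase := InnerProductSpace.ofCore innerCore.toCore

/-! ### The operator -/

/-- The bending moment `M = α u_xx + κ v_xx`. -/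
def moment (u v : P.H20) (x : ℝ) : ℂ := (P.α x : ℂ) * u.dxx x + (P.κ x : ℂ) * v.dxx x

/-- For `U = (u, v)` and the moment `M = α u_xx + κ v_xx`: the pair `U` lies in the domain of the
operator, with `v ∈ H₀²(0,ℓ)`, `M ∈ H²(I)`, `M_x = N` and `M_xx = L` on `I`. -/
structure InDomain (U : P.Phase) (v : P.H20) (N L : LTwo P.ℓ) : Prop where
  vel_eq : v.fn = U.vel
  weakDeriv_moment : HasWeakDeriv P.I (moment U.disp v) N
  weakDeriv_shear : HasWeakDeriv P.I N L
  /-- `M(ℓ₀⁻) = M(ℓ₀⁺)` -/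
  moment_ℓ₀ : HasJump (moment U.disp v) P.ℓ₀ 0
  /-- `M_x(ℓ₀⁻) = M_x(ℓ₀⁺)` -/
  shear_ℓ₀ : HasJump N P.ℓ₀ 0
  /-- `M(ℓ₁⁻) = M(ℓ₁⁺)` -/
  moment_ℓ₁ : HasJump (moment U.disp v) P.ℓ₁ 0
  /-- `M_x(ℓ₁⁻) = M_x(ℓ₁⁺)` -/
  shear_ℓ₁ : HasJump N P.ℓ₁ 0
  /-- `⟦u_xx⟧ = 0` at `ξ₁` -/
  curvature_ξ₁ : HasJump U.disp.dxx P.ξ₁ 0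
  /-- `⟦α u_xxx⟧ = ⟦M_x⟧ = -γ₁ v(ξ₁)` at `ξ₁`, where `κ = 0` -/
  shear_ξ₁ : ∃ c, HasPointValue v.fn P.ξ₁ c ∧ HasJump N P.ξ₁ (-P.γ₁ * c)
  /-- `⟦M_x⟧ = -γ₂ v(ξ₂)` at `ξ₂` -/
  shear_ξ₂ : ∃ c, HasPointValue v.fn P.ξ₂ c ∧ HasJump N P.ξ₂ (-P.γ₂ * c)
  /-- `⟦M⟧ = γ₃ v_x(ξ₂)` at `ξ₂` -/
  moment_ξ₂ : ∃ c, HasPointValue v.dx P.ξ₂ c ∧ HasJump (moment U.disp v) P.ξ₂ (P.γ₃ * c)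

lemma I_subset : P.I ⊆ Ioo 0 P.ℓ := by
  intro x hx
  have := P.ξ₁_pos
  have := P.ξ₁_lt
  have := P.ℓ₀_lt
  have := P.ξ₂_lt
  have := P.ℓ₁_lt
  rcases hx with (((h | h) | h) | h) | h <;> constructor <;> linarith [h.1, h.2]

lemma isOpen_I : IsOpen P.I :=
  (((isOpen_Ioo.union isOpen_Ioo).union isOpen_Ioo).union isOpen_Ioo).union isOpen_Ioo

lemma nhds_of_lt {x : ℝ} (h : 0 < x) (h' : x < P.ℓ) : Ioo 0 P.ℓ ∈ 𝓝 x := Ioo_mem_nhds h h'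

lemma nhds_ξ₁ : Ioo 0 P.ℓ ∈ 𝓝 P.ξ₁ :=
  nhds_of_lt P.ξ₁_pos (P.ξ₁_lt.trans (P.ℓ₀_lt.trans (P.ξ₂_lt.trans P.ℓ₁_lt)))

lemma nhds_ℓ₀ : Ioo 0 P.ℓ ∈ 𝓝 P.ℓ₀ :=
  nhds_of_lt (P.ξ₁_pos.trans P.ξ₁_lt) (P.ℓ₀_lt.trans (P.ξ₂_lt.trans P.ℓ₁_lt))

lemma nhds_ξ₂ : Ioo 0 P.ℓ ∈ 𝓝 P.ξ₂ :=
  nhds_of_lt (P.ξ₁_pos.trans (P.ξ₁_lt.trans P.ℓ₀_lt)) (P.ξ₂_lt.trans P.ℓ₁_lt)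

lemma nhds_ℓ₁ : Ioo 0 P.ℓ ∈ 𝓝 P.ℓ₁ :=
  nhds_of_lt (P.ξ₁_pos.trans (P.ξ₁_lt.trans (P.ℓ₀_lt.trans P.ξ₂_lt))) P.ℓ₁_lt

lemma moment_add (u v u' v' : P.H20) : (fun x => moment u v x + moment u' v' x)
    =ᵐ[volume.restrict (Ioo 0 P.ℓ)] moment (u + u') (v + v') := by
  filter_upwards [LTwo.coe_add u.dxx u'.dxx, LTwo.coe_add v.dxx v'.dxx] with x h1 h2
  have h1' : (u + u').dxx x = u.dxx x + u'.dxx x := h1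
  have h2' : (v + v').dxx x = v.dxx x + v'.dxx x := h2
  simp only [moment, h1', h2']
  ring

lemma moment_smul (c : ℂ) (u v : P.H20) : (fun x => c * moment u v x)
    =ᵐ[volume.restrict (Ioo 0 P.ℓ)] moment (c • u) (c • v) := by
  filter_upwards [LTwo.coe_smul c u.dxx, LTwo.coe_smul c v.dxx] with x h1 h2
  have h1' : (c • u).dxx x = c * u.dxx x := h1
  have h2' : (c • v).dxx x = c * v.dxx x := h2
  simp only [moment, h1', h2']
  ring

lemma moment_zero : (fun _ => (0 : ℂ)) =ᵐ[volume.restrict (Ioo 0 P.ℓ)]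
    moment (0 : P.H20) 0 := by
  filter_upwards [LTwo.coe_zero (ℓ := P.ℓ)] with x h1
  have h1' : (0 : P.H20).dxx x = 0 := h1
  simp [moment, h1']

lemma integrableOn_moment (u v : P.H20) : IntegrableOn (moment u v) P.I := by
  have h1 : Integrable (fun x => (P.α x : ℂ) * u.dxx x) (volume.restrict P.I) := by
    refine (LTwo.integrableOn u.dxx I_subset).bdd_mul (c := P.α₁ + P.α₂)
      (Complex.measurable_ofReal.comp measurable_α).aestronglyMeasurable
      (Eventually.of_forall fun x => ?_)
    rw [Complex.norm_real, Real.norm_of_nonneg (α_pos x).le]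
    exact α_le x
  have h2 : Integrable (fun x => (P.κ x : ℂ) * v.dxx x) (volume.restrict P.I) := by
    refine (LTwo.integrableOn v.dxx I_subset).bdd_mul (c := P.α₀)
      (Complex.measurable_ofReal.comp
        (Measurable.ite measurableSet_Ioo measurable_const measurable_const)).aestronglyMeasurable
      (Eventually.of_forall fun x => ?_)
    rw [Complex.norm_real]
    unfold κ
    split_ifs
    · exact (Real.norm_of_nonneg P.α₀_pos.le).le
    · simpa using P.α₀_pos.le
  exact h1.add h2

lemma InDomain.add {U U' : P.Phase} {v v' : P.H20} {N N' L L' : LTwo P.ℓ}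
    (h : InDomain U v N L) (h' : InDomain U' v' N' L') :
    InDomain (U + U') (v + v') (N + N') (L + L') where
  vel_eq := congrArg₂ (· + ·) h.vel_eq h'.vel_eq
  weakDeriv_moment := (h.weakDeriv_moment.add h'.weakDeriv_moment (integrableOn_moment _ _)
    (integrableOn_moment _ _) (N.integrableOn I_subset) (N'.integrableOn I_subset)).congr
    (ae_restrict_of_ae_restrict_of_subset I_subset (moment_add _ _ _ _))
    (ae_restrict_of_ae_restrict_of_subset I_subset (LTwo.coe_add N N').symm)
  weakDeriv_shear := LTwo.weakDeriv_add I_subset h.weakDeriv_shear h'.weakDeriv_shear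
  moment_ℓ₀ := by
    have := (h.moment_ℓ₀.add h'.moment_ℓ₀).congr nhds_ℓ₀ (moment_add _ _ _ _)
    rwa [add_zero] at this
  shear_ℓ₀ := by
    simpa using (h.shear_ℓ₀.add h'.shear_ℓ₀).congr nhds_ℓ₀ (LTwo.coe_add N N').symm
  moment_ℓ₁ := by
    have := (h.moment_ℓ₁.add h'.moment_ℓ₁).congr nhds_ℓ₁ (moment_add _ _ _ _)
    rwa [add_zero] at this
  shear_ℓ₁ := by
    simpa using (h.shear_ℓ₁.add h'.shear_ℓ₁).congr nhds_ℓ₁ (LTwo.coe_add N N').symm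
  curvature_ξ₁ := by
    have := (h.curvature_ξ₁.add h'.curvature_ξ₁).congr nhds_ξ₁
      (LTwo.coe_add U.disp.dxx U'.disp.dxx).symm
    rwa [add_zero] at this
  shear_ξ₁ := by
    obtain ⟨c, hc, hj⟩ := h.shear_ξ₁
    obtain ⟨c', hc', hj'⟩ := h'.shear_ξ₁
    refine ⟨c + c', LTwo.tendsto_add nhds_ξ₁ hc hc', ?_⟩
    rw [mul_add]
    exact (hj.add hj').congr nhds_ξ₁ (LTwo.coe_add N N').symm
  shear_ξ₂ := by
    obtain ⟨c, hc, hj⟩ := h.shear_ξ₂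
    obtain ⟨c', hc', hj'⟩ := h'.shear_ξ₂
    refine ⟨c + c', LTwo.tendsto_add nhds_ξ₂ hc hc', ?_⟩
    rw [mul_add]
    exact (hj.add hj').congr nhds_ξ₂ (LTwo.coe_add N N').symm
  moment_ξ₂ := by
    obtain ⟨c, hc, hj⟩ := h.moment_ξ₂
    obtain ⟨c', hc', hj'⟩ := h'.moment_ξ₂
    refine ⟨c + c', LTwo.tendsto_add nhds_ξ₂ hc hc', ?_⟩
    rw [mul_add]
    exact (hj.add hj').congr nhds_ξ₂ (moment_add _ _ _ _)

lemma InDomain.smul (k : ℂ) {U : P.Phase} {v : P.H20} {N L : LTwo P.ℓ}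
    (h : InDomain U v N L) : InDomain (k • U) (k • v) (k • N) (k • L) where
  vel_eq := congrArg (k • ·) h.vel_eq
  weakDeriv_moment := (h.weakDeriv_moment.const_smul k).congr
    (ae_restrict_of_ae_restrict_of_subset I_subset (moment_smul k _ _))
    (ae_restrict_of_ae_restrict_of_subset I_subset (LTwo.coe_smul k N).symm)
  weakDeriv_shear := LTwo.weakDeriv_smul I_subset k h.weakDeriv_shear
  moment_ℓ₀ := by
    have := (h.moment_ℓ₀.const_mul k).congr nhds_ℓ₀ (moment_smul k _ _)
    rwa [mul_zero] at this
  shear_ℓ₀ := by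
    simpa using (h.shear_ℓ₀.const_mul k).congr nhds_ℓ₀ (LTwo.coe_smul k N).symm
  moment_ℓ₁ := by
    have := (h.moment_ℓ₁.const_mul k).congr nhds_ℓ₁ (moment_smul k _ _)
    rwa [mul_zero] at this
  shear_ℓ₁ := by
    simpa using (h.shear_ℓ₁.const_mul k).congr nhds_ℓ₁ (LTwo.coe_smul k N).symm
  curvature_ξ₁ := by
    have := (h.curvature_ξ₁.const_mul k).congr nhds_ξ₁ (LTwo.coe_smul k U.disp.dxx).symm
    rwa [mul_zero] at this
  shear_ξ₁ := by
    obtain ⟨c, hc, hj⟩ := h.shear_ξ₁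
    refine ⟨k * c, LTwo.tendsto_smul nhds_ξ₁ k hc, ?_⟩
    rw [mul_left_comm]
    exact (hj.const_mul k).congr nhds_ξ₁ (LTwo.coe_smul k N).symm
  shear_ξ₂ := by
    obtain ⟨c, hc, hj⟩ := h.shear_ξ₂
    refine ⟨k * c, LTwo.tendsto_smul nhds_ξ₂ k hc, ?_⟩
    rw [mul_left_comm]
    exact (hj.const_mul k).congr nhds_ξ₂ (LTwo.coe_smul k N).symm
  moment_ξ₂ := by
    obtain ⟨c, hc, hj⟩ := h.moment_ξ₂
    refine ⟨k * c, LTwo.tendsto_smul nhds_ξ₂ k hc, ?_⟩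
    rw [mul_left_comm]
    exact (hj.const_mul k).congr nhds_ξ₂ (moment_smul k _ _)

lemma InDomain.zero : InDomain (0 : P.Phase) 0 0 0 where
  vel_eq := rfl
  weakDeriv_moment := HasWeakDeriv.zero.congr
    (ae_restrict_of_ae_restrict_of_subset I_subset moment_zero)
    (ae_restrict_of_ae_restrict_of_subset I_subset LTwo.coe_zero.symm)
  weakDeriv_shear := LTwo.weakDeriv_zero I_subset
  moment_ℓ₀ := HasJump.zero.congr nhds_ℓ₀ moment_zero
  shear_ℓ₀ := HasJump.zero.congr nhds_ℓ₀ LTwo.coe_zero.symm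
  moment_ℓ₁ := HasJump.zero.congr nhds_ℓ₁ moment_zero
  shear_ℓ₁ := HasJump.zero.congr nhds_ℓ₁ LTwo.coe_zero.symm
  curvature_ξ₁ := HasJump.zero.congr nhds_ξ₁ LTwo.coe_zero.symm
  shear_ξ₁ := ⟨0, LTwo.tendsto_zero nhds_ξ₁, by
    rw [mul_zero]; exact HasJump.zero.congr nhds_ξ₁ LTwo.coe_zero.symm⟩
  shear_ξ₂ := ⟨0, LTwo.tendsto_zero nhds_ξ₂, by
    rw [mul_zero]; exact HasJump.zero.congr nhds_ξ₂ LTwo.coe_zero.symm⟩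
  moment_ξ₂ := ⟨0, LTwo.tendsto_zero nhds_ξ₂, by
    rw [mul_zero]; exact HasJump.zero.congr nhds_ξ₂ moment_zero⟩

variable (P) in
/-- The graph of the operator: the pairs `(U, F)` with `U = (u, v)` in the domain and
`F = (v, -(α u_xx + κ v_xx)_xx)`. -/
def operatorGraph : Submodule ℂ (P.Phase × P.Phase) where
  carrier := {Z | ∃ N L : LTwo P.ℓ, InDomain Z.1 Z.2.disp N L ∧ Z.2.vel = -L}
  add_mem' := by
    rintro Z Z' ⟨N, L, h, e⟩ ⟨N', L', h', e'⟩
    refine ⟨N + N', L + L', h.add h', ?_⟩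
    rw [neg_add, ← e, ← e']
    rfl
  zero_mem' := ⟨0, 0, InDomain.zero, (neg_zero (G := LTwo P.ℓ)).symm⟩
  smul_mem' := by
    rintro c Z ⟨N, L, h, e⟩
    refine ⟨c • N, c • L, h.smul c, ?_⟩
    rw [← smul_neg, ← e]
    rfl

/-- The graph is single-valued. -/
lemma operatorGraph_single (Z : P.Phase × P.Phase) (hZ : Z ∈ P.operatorGraph) (h0 : Z.1 = 0) :
    Z.2 = 0 := by
  obtain ⟨U, F⟩ := Z
  obtain ⟨N, L, h, e⟩ := hZ
  simp only at h0 h e ⊢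
  subst h0
  have hv : F.disp = 0 := H20.eq_zero_of_fn h.vel_eq
  rw [hv] at h
  have hI : volume.restrict (Ioo 0 P.ℓ) = volume.restrict P.I := by
    refine Measure.restrict_congr_set (EventuallyLE.antisymm ?_ I_subset.eventuallyLE)
    have : ∀ᵐ x : ℝ, x ∉ ({P.ξ₁, P.ℓ₀, P.ξ₂, P.ℓ₁} : Set ℝ) :=
      measure_eq_zero_iff_ae_notMem.1
        (Set.Finite.measure_zero (Set.toFinite {P.ξ₁, P.ℓ₀, P.ξ₂, P.ℓ₁}) volume)
    filter_upwards [this] with x hx hx'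
    simp only [mem_insert_iff, mem_singleton_iff, not_or] at hx
    obtain ⟨h1, h2, h3, h4⟩ := hx
    change x ∈ P.I
    have hx' : x ∈ Ioo 0 P.ℓ := hx'
    simp only [I, mem_union, mem_Ioo] at hx' ⊢
    grind
  have hM : moment (0 : P.Phase).disp 0 =ᵐ[volume.restrict P.I] (0 : ℝ → ℂ) :=
    EventuallyEq.symm (ae_restrict_of_ae_restrict_of_subset I_subset moment_zero)
  have hN := h.weakDeriv_moment.ae_zero isOpen_I (N.integrableOn I_subset) hM
  have hL := h.weakDeriv_shear.ae_zero isOpen_I (L.integrableOn I_subset) hN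
  rw [← hI] at hL
  have hL0 : L = 0 := Lp.ext (hL.trans (Lp.coeFn_zero ℂ 2 _).symm)
  refine Phase.ext' hv ?_
  rw [e, hL0]
  exact neg_zero (G := LTwo P.ℓ)

variable (P) in
/-- The operator `𝒜(u, v) = (v, -(α u_xx + κ v_xx)_xx)` with its domain. -/
def operator : P.Phase →ₗ.[ℂ] P.Phase := P.operatorGraph.toLinearPMap

lemma operator_graph : P.operator.graph = P.operatorGraph :=
  Submodule.toLinearPMap_graph_eq _ operatorGraph_single

lemma mem_operator_domain {U : P.Phase} :
    U ∈ P.operator.domain ↔ ∃ (v : P.H20) (N L : LTwo P.ℓ), InDomain U v N L := by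
  rw [LinearPMap.mem_domain_iff, operator_graph]
  constructor
  · rintro ⟨F, N, L, h, -⟩
    exact ⟨_, N, L, h⟩
  · rintro ⟨v, N, L, h⟩
    exact ⟨((v, -L) : P.H20 × LTwo P.ℓ), N, L, h, rfl⟩

end Beam

/-! ### Semigroups and the abstract Cauchy problem -/

section Semigroups

variable {X : Type*} [NormedAddCommGroup X] [NormedSpace ℂ X]

/-- A `C₀`-semigroup of contractions on `X`. -/
structure ContractionSemigroup (X : Type*) [NormedAddCommGroup X] [NormedSpace ℂ X] where
  /-- The operators `S(t)`, `t ≥ 0`. -/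
  S : ℝ≥0 → X →L[ℂ] X
  map_zero : S 0 = ContinuousLinearMap.id ℂ X
  map_add : ∀ s t, S (s + t) = (S s).comp (S t)
  continuous_at_zero : ∀ x, Tendsto (fun t => S t x) (𝓝[>] 0) (𝓝 x)
  contraction : ∀ t, ‖S t‖ ≤ 1

/-- `A` is the infinitesimal generator of the semigroup: `x ∈ D(A)` and `A x = y` if and only if
`(S(t) x - x) / t → y` as `t → 0⁺`. -/
def ContractionSemigroup.IsGenerator (S : ContractionSemigroup X) (A : X →ₗ.[ℂ] X) : Prop :=
  ∀ x y : X, (x, y) ∈ A.graph ↔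
    Tendsto (fun t : ℝ≥0 => ((t : ℝ) : ℂ)⁻¹ • (S.S t x - x)) (𝓝[>] 0) (𝓝 y)

/-- The time interval `[0,T]`, which is `[0,∞)` for `T = ∞`. -/
def timeInterval (T : EReal) : Set ℝ := {t | 0 ≤ t ∧ (t : EReal) ≤ T}

/-- A mild solution of `U_t = A U`, `U(0) = U₀` on `[0,T]`: `U ∈ C([0,T];X)` satisfies the time-
integrated equation. -/
structure IsMildSolution (A : X →ₗ.[ℂ] X) (T : EReal) (U₀ : X) (U : ℝ → X) : Prop where
  continuousOn : ContinuousOn U (timeInterval T)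
  integral_mem : ∀ t ∈ timeInterval T, (∫ s in (0 : ℝ)..t, U s) ∈ A.domain
  integral_eq : ∀ (t : ℝ) (ht : t ∈ timeInterval T),
    U t = U₀ + A ⟨∫ s in (0 : ℝ)..t, U s, integral_mem t ht⟩

/-- A classical solution of `U_t = A U`, `U(0) = U₀` on `[0,T]`, in the class
`C¹([0,T];X) ∩ C([0,T];D(A))`, where `D(A)` carries the graph norm. -/
structure IsClassicalSolution (A : X →ₗ.[ℂ] X) (T : EReal) (U₀ : X) (U : ℝ → X) : Prop where
  initial : U 0 = U₀
  contDiffOn : ContDiffOn ℝ 1 U (timeInterval T)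
  mem_domain : ∀ t ∈ timeInterval T, U t ∈ A.domain
  continuous_apply : Continuous fun t : timeInterval T => A ⟨U t, mem_domain t t.2⟩
  hasDeriv : ∀ (t : ℝ) (ht : t ∈ timeInterval T),
    HasDerivWithinAt U (A ⟨U t, mem_domain t ht⟩) (timeInterval T) t

end Semigroups

end

noncomputable section

/-! ### Contraction semigroups generated by maximal dissipative operators -/

section MaximalDissipative

variable {X : Type*} [NormedAddCommGroup X] [InnerProductSpace ℂ X]

/-! The generation statement is a Lumer–Phillips argument: `𝒜` is maximal dissipative on a Hilbert
space (`Beam.operator_maxDissipative`), and `MaxDissipative.cauchyProblem` gives the semigroup and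
both kinds of solutions for every such operator.

Abstract side. Dissipativity bounds the resolvent `R` at `lam` by `lam⁻¹`, so the Yosida
approximations `lam (lam R - 1)` are bounded, dissipative and commute with each other. Their
exponentials are contractions, and on the domain two of them differ by at most `t` times the
difference of the approximations. They therefore converge strongly, first on the domain and then,
since a maximal dissipative operator on a Hilbert space is densely defined, everywhere
(`MaxDissipative.exists_semigroup`). The limit commutes with the resolvent and satisfies `S(t)x = x
+ ∫₀ᵗ S(s)Ax ds` on the domain. Applying this identity to `R U₀` gives mild solutions for all data.
Uniqueness holds because `‖W‖` decreases whenever `W' = AW`.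

Concrete side. The map `u ↦ u_xx` identifies `H₀²(0,ℓ)` with the orthogonal complement of the affine
functions in `L²(0,ℓ)`: the left end conditions make `u` the double primitive of `u_xx`, and the
right ones are two orthogonality relations (`H20.exists_dxx_eq`). The latter survive `L²` limits,
whence completeness. Point values and slopes are inner products of `u_xx` with ramps and steps.

Dissipativity is Green's formula (`Beam.InDomain.green`): summing integrations by parts over the
five intervals, the jump conditions give `Re ⟨𝒜U, U⟩ = -∫ κ|v_xx|² - γ₁|v(ξ₁)|² - γ₂|v(ξ₂)|² -
γ₃|v_x(ξ₂)|²`. For the range condition, eliminating `u` leaves a coercive variational problem for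
`v_xx` alone (`Beam.operator_range`). Its residual is an affine function, which supplies the two
free constants of a twice integrated moment; the ramps and steps at `ξ₁`, `ξ₂` in the form produce
exactly the prescribed jumps. -/

/-- A curve whose velocity is dissipatively aligned with its position has decreasing norm. -/
lemma norm_le_of_hasDerivWithinAt_dissipative {W W' : ℝ → X} {t : ℝ} (ht : 0 ≤ t)
    (hW : ∀ s ∈ Icc 0 t, HasDerivWithinAt W (W' s) (Icc 0 t) s)
    (hd : ∀ s ∈ Icc 0 t, (inner ℂ (W' s) (W s)).re ≤ 0) : ‖W t‖ ≤ ‖W 0‖ := by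
  have h1 : ∀ s ∈ Icc 0 t, HasDerivWithinAt (fun s => ‖W s‖ ^ 2)
      (2 * (inner ℂ (W' s) (W s)).re) (Icc 0 t) s := by
    intro s hs
    have h2 := (hW s hs).inner ℂ (hW s hs)
    have h3 := Complex.reCLM.hasFDerivAt.comp_hasDerivWithinAt s h2
    refine (h3.congr_deriv ?_).congr_of_eventuallyEq ?_ ?_
    · simp only [Complex.reCLM_apply, Complex.add_re]
      have : (inner ℂ (W s) (W' s)).re = (inner ℂ (W' s) (W s)).re := inner_re_symm (𝕜 := ℂ) _ _
      rw [this]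
      ring
    · refine Eventually.of_forall fun s => ?_
      exact (inner_self_eq_norm_sq (𝕜 := ℂ) (W s)).symm
    · exact (inner_self_eq_norm_sq (𝕜 := ℂ) (W s)).symm
  have h4 : AntitoneOn (fun s => ‖W s‖ ^ 2) (Icc 0 t) := by
    refine antitoneOn_of_deriv_nonpos (convex_Icc 0 t) (fun s hs => (h1 s hs).continuousWithinAt)
      ?_ ?_
    · intro s hs
      exact ((h1 s (interior_subset hs)).mono interior_subset).differentiableWithinAt
    · intro s hs
      have := (h1 s (interior_subset hs)).hasDerivAt (mem_interior_iff_mem_nhds.1 hs)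
      rw [this.deriv]
      linarith [hd s (interior_subset hs)]
  exact le_of_sq_le_sq (h4 (left_mem_Icc.2 ht) (right_mem_Icc.2 ht) ht) (norm_nonneg _)
where
  le_of_sq_le_sq {a b : ℝ} (h : a ^ 2 ≤ b ^ 2) (hb : 0 ≤ b) : a ≤ b :=
    abs_le_of_sq_le_sq' h hb |>.2

/-- A maximal dissipative operator: `Re ⟨A x, x⟩ ≤ 0` and `lam - A` is onto for `lam > 0`. -/
structure MaxDissipative (A : X →ₗ.[ℂ] X) : Prop where
  re_inner_nonpos : ∀ x y : X, (x, y) ∈ A.graph → (inner ℂ y x).re ≤ 0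
  range_eq : ∀ lam : ℝ, 0 < lam → ∀ y : X, ∃ x z : X, (x, z) ∈ A.graph ∧ (lam : ℂ) • x - z = y

/-- `R` is the resolvent of `A` at `lam`. -/
structure IsResolvent (A : X →ₗ.[ℂ] X) (lam : ℝ) (R : X →L[ℂ] X) : Prop where
  graph : ∀ y, (R y, (lam : ℂ) • R y - y) ∈ A.graph
  apply_sub : ∀ x z, (x, z) ∈ A.graph → R ((lam : ℂ) • x - z) = x
  norm_le : ∀ y, lam * ‖R y‖ ≤ ‖y‖

namespace MaxDissipative

variable {A : X →ₗ.[ℂ] X}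

/-- Dissipativity gives `Re ⟨lam x - z, x⟩ ≥ lam ‖x‖²`; Cauchy–Schwarz then cancels one factor
`‖x‖`. This yields both the injectivity of `lam - A` and the bound of the resolvent. -/
lemma mul_norm_le (hA : MaxDissipative A) {lam : ℝ} {x z : X} (h : (x, z) ∈ A.graph) :
    lam * ‖x‖ ≤ ‖(lam : ℂ) • x - z‖ := by
  rcases eq_or_ne x 0 with rfl | hx
  · simp
  have h0 := hA.re_inner_nonpos x z h
  have h1 : (inner ℂ ((lam : ℂ) • x - z) x).re = lam * ‖x‖ ^ 2 - (inner ℂ z x).re := by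
    rw [inner_sub_left, inner_smul_left, inner_self_eq_norm_sq_to_K]
    simp [← Complex.ofReal_pow]
  have h2 : (inner ℂ ((lam : ℂ) • x - z) x).re ≤ ‖(lam : ℂ) • x - z‖ * ‖x‖ :=
    re_inner_le_norm (𝕜 := ℂ) _ _
  have hx' : 0 < ‖x‖ := norm_pos_iff.2 hx
  refine le_of_mul_le_mul_right ?_ hx'
  nlinarith

lemma exists_resolvent (hA : MaxDissipative A) {lam : ℝ} (hl : 0 < lam) :
    ∃ R : X →L[ℂ] X, IsResolvent A lam R := by
  choose r z hg he using hA.range_eq lam hl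
  -- Injectivity of `lam - A`; it also makes the chosen preimage `r y` linear in `y`.
  have uniq : ∀ {x z x' z' : X}, (x, z) ∈ A.graph → (x', z') ∈ A.graph →
      (lam : ℂ) • x - z = (lam : ℂ) • x' - z' → x = x' := by
    intro x z x' z' h h' e
    have h1 := hA.mul_norm_le (lam := lam) (A.graph.sub_mem h h')
    have h2 : (lam : ℂ) • (x - x') - (z - z') = 0 := by
      rw [smul_sub, sub_sub_sub_comm, e, sub_self]
    rw [h2, norm_zero] at h1
    have h3 : ‖x - x'‖ ≤ 0 := by
      by_contra h
      push Not at h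
      exact absurd h1 (not_le.2 (mul_pos hl h))
    exact sub_eq_zero.1 (norm_le_zero_iff.1 h3)
  let R₀ : X →ₗ[ℂ] X :=
    { toFun := r
      map_add' := fun y y' => by
        refine uniq (hg _) (A.graph.add_mem (hg y) (hg y')) ?_
        rw [he, smul_add, add_sub_add_comm, he, he]
      map_smul' := fun c y => by
        refine uniq (hg _) (A.graph.smul_mem c (hg y)) ?_
        rw [he, RingHom.id_apply, smul_comm, ← smul_sub, he] }
  have hz : ∀ y, z y = (lam : ℂ) • r y - y := fun y => by
    rw [eq_sub_iff_add_eq, ← eq_sub_iff_add_eq', he]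
  have hn : ∀ y, lam * ‖r y‖ ≤ ‖y‖ := fun y => by
    have := hA.mul_norm_le (lam := lam) (hg y)
    rwa [he] at this
  refine ⟨R₀.mkContinuous lam⁻¹ fun y => ?_, ⟨fun y => ?_, fun x w h => ?_, fun y => ?_⟩⟩
  · rw [inv_mul_eq_div, le_div_iff₀' hl]
    exact hn y
  · have := hg y
    rwa [hz] at this
  · exact uniq (hg _) h (he _)
  · exact hn y

end MaxDissipative

namespace IsResolvent

variable {A : X →ₗ.[ℂ] X} {lam mu : ℝ} {R Q : X →L[ℂ] X}

/-- The resolvent identity: `Q` inverts `mu - A`, and `(mu - A) R y = (mu - lam) R y + y`. -/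
lemma sub_eq (hR : IsResolvent A lam R) (hQ : IsResolvent A mu Q) (y : X) :
    ((mu : ℂ) - lam) • Q (R y) + Q y = R y := by
  have h := hQ.apply_sub _ _ (hR.graph y)
  rw [map_sub, map_sub, map_smul, map_smul] at h
  rw [sub_smul, sub_add, h]

/-- By the resolvent identity `lam - A` maps `Q R y` to `Q y`; now apply `R`. -/
lemma commute (hR : IsResolvent A lam R) (hQ : IsResolvent A mu Q) : Commute R Q := by
  ext y
  change R (Q y) = Q (R y)
  have h1 := hQ.graph (R y)
  have h2 := hR.apply_sub _ _ h1
  have h3 : Q y = (lam : ℂ) • Q (R y) - ((mu : ℂ) • Q (R y) - R y) := by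
    nth_rw 3 [← hR.sub_eq hQ y]
    rw [sub_smul]
    abel
  rw [h3, h2]

/-- On the range of the resolvent the operator acts by `A R y = lam R y - y`. -/
lemma mem_graph_iff (hR : IsResolvent A lam R) {x z : X} :
    (x, z) ∈ A.graph ↔ R ((lam : ℂ) • x - z) = x := by
  refine ⟨hR.apply_sub x z, fun h => ?_⟩
  have := hR.graph ((lam : ℂ) • x - z)
  rw [h] at this
  simpa using this

/-- The Yosida approximation `lam² R - lam = lam A R`. -/
def yosida (lam : ℝ) (R : X →L[ℂ] X) : X →L[ℂ] X :=
  (lam : ℂ) • ((lam : ℂ) • R - 1)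

lemma yosida_apply (y : X) : yosida lam R y = (lam : ℂ) • ((lam : ℂ) • R y - y) := rfl

/-- On the domain the approximation is `lam R A`. Hence it is bounded there by `‖A x‖` uniformly in
`lam`, and it tends to `A x` once `lam R → 1` strongly. -/
lemma yosida_graph (hR : IsResolvent A lam R) {x z : X} (h : (x, z) ∈ A.graph) :
    yosida lam R x = (lam : ℂ) • R z := by
  have := hR.apply_sub x z h
  rw [map_sub, map_smul, sub_eq_iff_eq_add] at this
  rw [yosida_apply, this, add_sub_cancel_left]

lemma yosida_commute (hR : IsResolvent A lam R) (hQ : IsResolvent A mu Q) :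
    Commute (yosida lam R) (yosida mu Q) := by
  have h1 : Commute (yosida lam R) Q :=
    (((hR.commute hQ).smul_left (lam : ℂ)).sub_left (Commute.one_left Q)).smul_left (lam : ℂ)
  exact ((h1.smul_right (mu : ℂ)).sub_right (Commute.one_right _)).smul_right (mu : ℂ)

/-- The real part equals `lam (lam Re ⟨R x, x⟩ - ‖x‖²)`, and `lam R` is a contraction. -/
lemma yosida_re_inner_nonpos (hR : IsResolvent A lam R) (hl : 0 < lam) (x : X) :
    (inner ℂ (yosida lam R x) x).re ≤ 0 := by
  rw [yosida_apply, inner_smul_left, inner_sub_left, inner_smul_left, inner_self_eq_norm_sq_to_K]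
  have h1 : (inner ℂ (R x) x).re ≤ ‖R x‖ * ‖x‖ := re_inner_le_norm (𝕜 := ℂ) _ _
  have h2 := hR.norm_le x
  have e : ((starRingEnd ℂ) (lam : ℂ) * ((starRingEnd ℂ) (lam : ℂ) * inner ℂ (R x) x
      - ((‖x‖ : ℝ) : ℂ) ^ 2)).re = lam * (lam * (inner ℂ (R x) x).re - ‖x‖ ^ 2) := by
    simp [← Complex.ofReal_pow]
  refine le_of_eq_of_le e ?_
  refine mul_nonpos_of_nonneg_of_nonpos hl.le ?_
  have h3 := mul_le_mul_of_nonneg_right h2 (norm_nonneg x)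
  nlinarith

end IsResolvent

end MaximalDissipative

/-! ### Strong limits of Yosida exponentials -/

section Generation

/-- Strong convergence to zero of a bounded family of operators may be checked on a dense set. -/
lemma tendsto_zero_of_dense {X : Type*} [NormedAddCommGroup X] {ι : Type*} {l : Filter ι}
    {K : ι → X → X} {C : ℝ}
    (hadd : ∀ i x y, K i (x - y) = K i x - K i y)
    (hC : ∀ i x, ‖K i x‖ ≤ C * ‖x‖) {D : Set X} (hD : Dense D)
    (h : ∀ x ∈ D, Tendsto (fun i => K i x) l (𝓝 0)) (x : X) :
    Tendsto (fun i => K i x) l (𝓝 0) := by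
  rw [Metric.tendsto_nhds]
  intro ε hε
  -- The sign of `C` is not known, so `|C| + 1` serves as a positive bound.
  have hC' : 0 < |C| + 1 := by positivity
  obtain ⟨y, hy, hyD⟩ := Metric.dense_iff.1 hD x (ε / 2 / (|C| + 1)) (by positivity)
  have h1 := Metric.tendsto_nhds.1 (h y hyD) (ε / 2) (by positivity)
  filter_upwards [h1] with i hi
  rw [dist_zero_right] at hi ⊢
  have h2 : K i x = K i (x - y) + K i y := by rw [hadd]; abel
  have h3 : ‖x - y‖ < ε / 2 / (|C| + 1) := by
    rw [← dist_eq_norm, dist_comm]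
    exact hy
  have h4 : ‖K i (x - y)‖ ≤ ε / 2 := by
    refine (hC i _).trans ?_
    rw [lt_div_iff₀ hC'] at h3
    nlinarith [norm_nonneg (x - y), le_abs_self C]
  rw [h2]
  linarith [norm_add_le (K i (x - y)) (K i y)]

variable {X : Type*} [NormedAddCommGroup X] [InnerProductSpace ℂ X]

/-! ### Exponentials of bounded dissipative operators -/

section BoundedGenerator

variable [CompleteSpace X]

lemma hasDerivAt_exp_apply (B : X →L[ℂ] X) (x : X) (t : ℝ) :
    HasDerivAt (fun t : ℝ => NormedSpace.exp (t • B) x) (NormedSpace.exp (t • B) (B x)) t := by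
  have h := hasDerivAt_exp_smul_const (𝕂 := ℝ) B t
  exact ((ContinuousLinearMap.apply ℂ X x).restrictScalars ℝ).hasFDerivAt.comp_hasDerivAt t h

lemma exp_smul_comm_apply (B : X →L[ℂ] X) {C : X →L[ℂ] X} (h : Commute B C) (x : X) (t : ℝ) :
    NormedSpace.exp (t • B) (C x) = C (NormedSpace.exp (t • B) x) := by
  have h1 : Commute (NormedSpace.exp (t • B)) C := by
    let _ : NormedAlgebra ℚ (X →L[ℂ] X) := .restrictScalars ℚ ℂ _
    exact Commute.exp_left (h.smul_left t)
  exact DFunLike.congr_fun h1.eq x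

lemma norm_exp_smul_apply_le {B : X →L[ℂ] X} (hB : ∀ x, (inner ℂ (B x) x).re ≤ 0) {t : ℝ}
    (ht : 0 ≤ t) (x : X) : ‖NormedSpace.exp (t • B) x‖ ≤ ‖x‖ := by
  have := norm_le_of_hasDerivWithinAt_dissipative
    (W := fun t : ℝ => NormedSpace.exp (t • B) x) ht
    (fun s _ => (hasDerivAt_exp_apply B x s).hasDerivWithinAt)
    (fun s _ => by
      rw [exp_smul_comm_apply B (Commute.refl B)]
      exact hB _)
  simpa using this

/-- The curve `s ↦ e^{sB} e^{(t-s)C} x` joins `e^{tC} x` to `e^{tB} x`. As `B` and `C` commute, its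
velocity is `e^{sB} e^{(t-s)C} (B - C) x`, of norm at most `‖(B - C) x‖` because both exponentials
are contractions. -/
lemma norm_exp_sub_exp_le {B C : X →L[ℂ] X} (hB : ∀ x, (inner ℂ (B x) x).re ≤ 0)
    (hC : ∀ x, (inner ℂ (C x) x).re ≤ 0) (hBC : Commute B C) {t : ℝ} (ht : 0 ≤ t) (x : X) :
    ‖NormedSpace.exp (t • B) x - NormedSpace.exp (t • C) x‖ ≤ ‖B x - C x‖ * t := by
  have hd : ∀ s : ℝ, HasDerivAt
      (fun s : ℝ => (NormedSpace.exp (s • B) * NormedSpace.exp ((t - s) • C)) x)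
      (NormedSpace.exp (s • B) (NormedSpace.exp ((t - s) • C) (B x - C x))) s := by
    intro s
    have h1 := hasDerivAt_exp_smul_const (𝕂 := ℝ) B s
    have h2 := (hasDerivAt_exp_smul_const (𝕂 := ℝ) C (t - s)).scomp s
      ((hasDerivAt_id s).const_sub t)
    have h3 := ((ContinuousLinearMap.apply ℂ X x).restrictScalars ℝ).hasFDerivAt.comp_hasDerivAt s
      (h1.mul h2)
    refine h3.congr_deriv ?_
    have e := exp_smul_comm_apply C hBC.symm x (t - s)
    rw [sub_eq_add_neg] at e
    simp [e, sub_eq_add_neg]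
  have h := norm_image_sub_le_of_norm_deriv_le_segment' (a := 0) (b := t) (C := ‖B x - C x‖)
    (fun s _ => (hd s).hasDerivWithinAt) (fun s hs => ?_) t (right_mem_Icc.2 ht)
  · simpa using h
  · exact (norm_exp_smul_apply_le hB hs.1 _).trans
      (norm_exp_smul_apply_le hC (by linarith [hs.2]) _)

end BoundedGenerator

variable [CompleteSpace X] {A : X →ₗ.[ℂ] X}

namespace MaxDissipative

/-- The domain of a maximal dissipative operator on a Hilbert space is dense. -/
lemma dense_domain (hA : MaxDissipative A) : Dense {x : X | ∃ z, (x, z) ∈ A.graph} := by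
  have h0 : {x : X | ∃ z, (x, z) ∈ A.graph} = (A.domain : Set X) := by
    ext x
    exact LinearPMap.mem_domain_iff.symm
  rw [h0, Submodule.dense_iff_topologicalClosure_eq_top, Submodule.topologicalClosure_eq_top_iff,
    Submodule.eq_bot_iff]
  intro y hy
  -- A vector `y` orthogonal to the domain is written `y = x - A x`. Then `0 = Re ⟨y, x⟩ = ‖x‖² - Re
  -- ⟨A x, x⟩ ≥ ‖x‖²` forces `x = 0`, hence `y = 0`.
  obtain ⟨x, z, hg, he⟩ := hA.range_eq 1 one_pos y
  have hx : x ∈ A.domain := LinearPMap.mem_domain_iff.2 ⟨z, hg⟩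
  have h1 : inner ℂ y x = 0 := (Submodule.mem_orthogonal' _ _).1 hy x hx
  have h2 := hA.re_inner_nonpos x z hg
  have h3 : (inner ℂ y x).re = ‖x‖ ^ 2 - (inner ℂ z x).re := by
    rw [← he, inner_sub_left, inner_smul_left, inner_self_eq_norm_sq_to_K]
    simp [← Complex.ofReal_pow]
  rw [h1, Complex.zero_re] at h3
  have h4 : x = 0 := by
    have : ‖x‖ ^ 2 ≤ 0 := by linarith
    exact norm_eq_zero.1 (pow_eq_zero_iff two_ne_zero |>.1 (le_antisymm this (sq_nonneg _)))
  have h5 : z = 0 := A.graph_fst_eq_zero_snd hg h4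
  rw [← he, h4, h5]
  simp

/-- On the domain `lam R x - x = R A x` has norm at most `‖A x‖ / lam`; the operators `lam R - 1`
are bounded by `2` and the domain is dense. -/
lemma tendsto_smul_resolvent (hA : MaxDissipative A) {R : ℕ → X →L[ℂ] X}
    (hR : ∀ n : ℕ, IsResolvent A ((n : ℝ) + 1) (R n)) (x : X) :
    Tendsto (fun n : ℕ => (((n : ℝ) + 1 : ℝ) : ℂ) • R n x) atTop (𝓝 x) := by
  rw [tendsto_iff_norm_sub_tendsto_zero]
  have key := tendsto_zero_of_dense (l := atTop) (C := 2)
    (K := fun (n : ℕ) x => (((n : ℝ) + 1 : ℝ) : ℂ) • R n x - x)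
    (fun n x y => by rw [map_sub, smul_sub]; abel) (fun n x => ?_) hA.dense_domain ?_ x
  · exact tendsto_zero_iff_norm_tendsto_zero.1 key
  · have h1 : (0 : ℝ) < (n : ℝ) + 1 := by positivity
    have h2 := (hR n).norm_le x
    refine (norm_sub_le _ _).trans ?_
    rw [norm_smul, Complex.norm_real, Real.norm_of_nonneg h1.le]
    linarith
  · rintro x ⟨z, hz⟩
    have h1 : ∀ n : ℕ, (((n : ℝ) + 1 : ℝ) : ℂ) • R n x - x = R n z := fun n => by
      have := (hR n).apply_sub x z hz
      rw [map_sub, map_smul, sub_eq_iff_eq_add] at this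
      rw [this, add_sub_cancel_left]
    simp only [h1]
    refine squeeze_zero_norm (a := fun n : ℕ => ‖z‖ * (1 / ((n : ℝ) + 1))) (fun n => ?_) ?_
    · have h3 : (0 : ℝ) < (n : ℝ) + 1 := by positivity
      rw [mul_one_div, le_div_iff₀' h3]
      exact (hR n).norm_le z
    · simpa using (tendsto_one_div_add_atTop_nhds_zero_nat (𝕜 := ℝ)).const_mul ‖z‖

/-- A maximal dissipative operator on a Hilbert space yields a contraction semigroup which commutes
with its resolvents and integrates the orbits starting in the domain. -/
theorem exists_semigroup (hA : MaxDissipative A) :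
    ∃ S : ContractionSemigroup X,
      (∀ x, Continuous fun t => S.S t x) ∧
      (∀ x z, (x, z) ∈ A.graph → ∀ t : ℝ, 0 ≤ t →
        S.S t.toNNReal x = x + ∫ s in (0 : ℝ)..t, S.S s.toNNReal z) ∧
      ∀ lam R, IsResolvent A lam R → ∀ t x, S.S t (R x) = R (S.S t x) := by
  -- The resolvent parameters are `n + 1`, positive also for `n = 0`.
  have hpos : ∀ n : ℕ, (0 : ℝ) < (n : ℝ) + 1 := fun n => by positivity
  choose R hR using fun n : ℕ => hA.exists_resolvent (hpos n)
  set Y : ℕ → X →L[ℂ] X := fun n => IsResolvent.yosida ((n : ℝ) + 1) (R n) with hY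
  have hYd : ∀ n x, (inner ℂ (Y n x) x).re ≤ 0 := fun n x =>
    (hR n).yosida_re_inner_nonpos (hpos n) x
  have hYg : ∀ x z, (x, z) ∈ A.graph → Tendsto (fun n => Y n x) atTop (𝓝 z) := fun x z h => by
    simp only [hY, (hR _).yosida_graph h]
    exact hA.tendsto_smul_resolvent hR z
  have hYn : ∀ x z, (x, z) ∈ A.graph → ∀ n, ‖Y n x‖ ≤ ‖z‖ := fun x z h n => by
    simp only [hY, (hR _).yosida_graph h]
    rw [norm_smul, Complex.norm_real, Real.norm_of_nonneg (hpos n).le]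
    exact (hR n).norm_le z
  let E : ℕ → ℝ≥0 → X →L[ℂ] X := fun n t => NormedSpace.exp ((t : ℝ) • Y n)
  have hEn : ∀ n t x, ‖E n t x‖ ≤ ‖x‖ := fun n t x => norm_exp_smul_apply_le (hYd n) t.2 x
  -- For `x` in the domain, `‖E m t x - E n t x‖ ≤ t ‖Y m x - Y n x‖` and `Y n x` converges; the
  -- general case follows by density.
  have hEc : ∀ t x, CauchySeq fun n => E n t x := by
    intro t x
    rw [cauchySeq_iff_tendsto_dist_atTop_0]
    have key := tendsto_zero_of_dense (l := (atTop : Filter (ℕ × ℕ))) (C := 2)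
      (K := fun (p : ℕ × ℕ) x => E p.1 t x - E p.2 t x)
      (fun n x y => by simp only [map_sub]; abel) (fun p x => ?_) hA.dense_domain ?_ x
    · simpa only [dist_eq_norm] using tendsto_zero_iff_norm_tendsto_zero.1 key
    · linarith [norm_sub_le (E p.1 t x) (E p.2 t x), hEn p.1 t x, hEn p.2 t x]
    · rintro x ⟨z, hz⟩
      have h1 := cauchySeq_iff_tendsto_dist_atTop_0.1 (hYg x z hz).cauchySeq
      refine squeeze_zero_norm (fun p => norm_exp_sub_exp_le (hYd p.1) (hYd p.2)
        ((hR _).yosida_commute (hR _)) t.2 x) ?_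
      simpa [dist_eq_norm] using h1.mul_const (t : ℝ)
  choose L hL using fun t x => cauchySeq_tendsto_of_complete (hEc t x)
  have hLn : ∀ t x, ‖L t x‖ ≤ ‖x‖ := fun t x =>
    le_of_tendsto (hL t x).norm (Eventually.of_forall fun n => hEn n t x)
  let S : ℝ≥0 → X →L[ℂ] X := fun t =>
    (linearMapOfTendsto (L t) (fun n => (E n t : X →ₗ[ℂ] X))
      (tendsto_pi_nhds.2 (hL t))).mkContinuous 1 (fun x => by rw [one_mul]; exact hLn t x)
  have hS : ∀ t x, Tendsto (fun n => E n t x) atTop (𝓝 (S t x)) := hL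
  have hSn : ∀ t x, ‖S t x‖ ≤ ‖x‖ := hLn
  have hderiv : ∀ n x (t : ℝ), HasDerivAt (fun t : ℝ => NormedSpace.exp (t • Y n) x)
      (NormedSpace.exp (t • Y n) (Y n x)) t := fun n x t => hasDerivAt_exp_apply (Y n) x t
  -- Orbits starting in the domain are Lipschitz with constant `‖A x‖`, which gives strong
  -- continuity there and, by density, everywhere.
  have hlip : ∀ x z, (x, z) ∈ A.graph → ∀ s t : ℝ≥0, ‖S s x - S t x‖ ≤ ‖z‖ * ‖(s : ℝ) - t‖ := by
    intro x z hz s t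
    refine le_of_tendsto ((hS s x).sub (hS t x)).norm (Eventually.of_forall fun n => ?_)
    refine (convex_Ici (0 : ℝ)).norm_image_sub_le_of_norm_hasDerivWithin_le
      (fun r _ => (hderiv n x r).hasDerivWithinAt) (fun r hr => ?_) t.2 s.2
    exact (norm_exp_smul_apply_le (hYd n) hr _).trans (hYn x z hz n)
  have hcont : ∀ x, Continuous fun t => S t x := by
    intro x
    rw [continuous_iff_continuousAt]
    intro t
    have key := tendsto_zero_of_dense (l := 𝓝 t) (C := 2) (K := fun s x => S s x - S t x)
      (fun n x y => by simp only [map_sub]; abel) (fun s x => ?_) hA.dense_domain ?_ x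
    · exact tendsto_sub_nhds_zero_iff.1 key
    · linarith [norm_sub_le (S s x) (S t x), hSn s x, hSn t x]
    · rintro x ⟨z, hz⟩
      refine squeeze_zero_norm (fun s => hlip x z hz s t) ?_
      have : Continuous fun s : ℝ≥0 => ‖z‖ * ‖(s : ℝ) - t‖ := by fun_prop
      simpa using this.tendsto t
  have hcont' : ∀ x, Continuous fun s : ℝ => S s.toNNReal x := fun x =>
    (hcont x).comp continuous_real_toNNReal
  have h0 : ∀ x, S 0 x = x := fun x =>
    tendsto_nhds_unique (hS 0 x) (by simp [E])
  refine ⟨⟨S, ?_, ?_, ?_, ?_⟩, hcont, ?_, ?_⟩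
  · ext x
    exact h0 x
  · intro s t
    ext x
    refine tendsto_nhds_unique (hS (s + t) x) ?_
    have h1 : ∀ n, E n (s + t) x = E n s (E n t x) := fun n => by
      let _ : NormedAlgebra ℚ (X →L[ℂ] X) := .restrictScalars ℚ ℂ _
      have : E n (s + t) = E n s * E n t := by
        simp only [E, NNReal.coe_add, add_smul]
        exact NormedSpace.exp_add_of_commute
          (((Commute.refl (Y n)).smul_left (s : ℝ)).smul_right (t : ℝ))
      rw [this]
      rfl
    simp only [h1]
    -- Both factors of the product vary with `n`; since `E n s` is a contraction, the inner factor
    -- may be replaced by its limit.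
    have h2 : Tendsto (fun n => E n s (E n t x) - E n s (S t x)) atTop (𝓝 0) := by
      refine squeeze_zero_norm (a := fun n => ‖E n t x - S t x‖) (fun n => ?_) ?_
      · rw [← map_sub]
        exact hEn n s _
      · exact tendsto_iff_norm_sub_tendsto_zero.1 (hS t x)
    simpa using h2.add (hS s (S t x))
  · intro x
    have := (hcont x).tendsto 0
    simp only [h0] at this
    exact this.mono_left nhdsWithin_le_nhds
  · intro t
    refine ContinuousLinearMap.opNorm_le_bound _ zero_le_one fun x => ?_
    rw [one_mul]
    exact hSn t x
  · intro x z hz t ht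
    change S t.toNNReal x = x + ∫ s in (0 : ℝ)..t, S s.toNNReal z
    have hE' : ∀ n, Continuous fun s : ℝ => NormedSpace.exp (s • Y n) (Y n x) := fun n =>
      continuous_iff_continuousAt.2 fun s => (hderiv n (Y n x) s).continuousAt
    -- The fundamental theorem of calculus for the approximating orbits; the limit passes under the
    -- integral because the integrands are bounded by `‖z‖`.
    have h1 : ∀ n, E n t.toNNReal x =
        x + ∫ s in (0 : ℝ)..t, NormedSpace.exp (s • Y n) (Y n x) := fun n => by
      rw [intervalIntegral.integral_eq_sub_of_hasDerivAt (fun s _ => hderiv n x s)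
        ((hE' n).intervalIntegrable _ _)]
      simp [E, Real.coe_toNNReal t ht]
    refine tendsto_nhds_unique (hS _ x) ?_
    simp only [h1]
    refine tendsto_const_nhds.add ?_
    refine intervalIntegral.tendsto_integral_filter_of_dominated_convergence (fun _ => ‖z‖)
      (Eventually.of_forall fun n => (hE' n).aestronglyMeasurable) ?_ (by simp) ?_
    · refine Eventually.of_forall fun n => Eventually.of_forall fun s hs => ?_
      rw [uIoc_of_le ht] at hs
      exact (norm_exp_smul_apply_le (hYd n) hs.1.le _).trans (hYn x z hz n)
    · refine Eventually.of_forall fun s hs => ?_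
      rw [uIoc_of_le ht] at hs
      have h2 : Tendsto (fun n => NormedSpace.exp (s • Y n) (Y n x) - NormedSpace.exp (s • Y n) z)
          atTop (𝓝 0) := by
        refine squeeze_zero_norm (a := fun n => ‖Y n x - z‖) (fun n => ?_) ?_
        · rw [← map_sub]
          exact norm_exp_smul_apply_le (hYd n) hs.1.le _
        · exact tendsto_iff_norm_sub_tendsto_zero.1 (hYg x z hz)
      have h3 := hS s.toNNReal z
      simp only [E, Real.coe_toNNReal s hs.1.le] at h3
      simpa using h2.add h3
  · intro lam Q hQ t x
    refine tendsto_nhds_unique (hS t (Q x)) ?_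
    -- A resolvent commutes with the resolvents `R n`, hence with the Yosida approximations and
    -- their exponentials.
    have h1 : ∀ n, E n t (Q x) = Q (E n t x) := fun n => by
      refine exp_smul_comm_apply (Y n) ?_ x t
      exact ((((hR n).commute hQ).smul_left _).sub_left (Commute.one_left Q)).smul_left _
    simp only [h1]
    exact (Q.continuous.tendsto _).comp (hS t x)

end MaxDissipative

end Generation

/-! ### Existence and uniqueness for the Cauchy problem -/

section CauchyProblem

variable {T : EReal}

lemma Icc_subset_timeInterval {t : ℝ} (ht : t ∈ timeInterval T) : Icc 0 t ⊆ timeInterval T :=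
  fun _ hs => ⟨hs.1, (EReal.coe_le_coe_iff.2 hs.2).trans ht.2⟩

variable {X : Type*} [NormedAddCommGroup X] [InnerProductSpace ℂ X] {A : X →ₗ.[ℂ] X}

/-- The only solution of `W' = A W`, `W(0) = 0` for a dissipative operator is zero. -/
lemma MaxDissipative.eq_zero_of_hasDerivWithinAt (hA : MaxDissipative A) {W W' : ℝ → X} {t : ℝ}
    (ht : 0 ≤ t) (hW : ∀ s ∈ Icc 0 t, HasDerivWithinAt W (W' s) (Icc 0 t) s)
    (hg : ∀ s ∈ Icc 0 t, (W s, W' s) ∈ A.graph) (h0 : W 0 = 0) : W t = 0 := by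
  have := norm_le_of_hasDerivWithinAt_dissipative ht hW
    fun s hs => hA.re_inner_nonpos _ _ (hg s hs)
  rw [h0, norm_zero] at this
  exact norm_le_zero_iff.1 this

lemma IsMildSolution.graph {U₀ : X} {U : ℝ → X} (h : IsMildSolution A T U₀ U) {t : ℝ}
    (ht : t ∈ timeInterval T) : (∫ s in (0 : ℝ)..t, U s, U t - U₀) ∈ A.graph := by
  rw [LinearPMap.mem_graph_iff]
  refine ⟨⟨_, h.integral_mem t ht⟩, rfl, ?_⟩
  rw [h.integral_eq t ht, add_sub_cancel_left]

lemma IsClassicalSolution.graph {U₀ : X} {U : ℝ → X} (h : IsClassicalSolution A T U₀ U) {t : ℝ}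
    (ht : t ∈ timeInterval T) : (U t, A ⟨U t, h.mem_domain t ht⟩) ∈ A.graph :=
  A.mem_graph ⟨U t, h.mem_domain t ht⟩

/-- The difference solves the homogeneous problem with zero initial value, and its norm cannot
increase. -/
lemma IsClassicalSolution.unique (hA : MaxDissipative A) {U₀ : X} {U V : ℝ → X}
    (hU : IsClassicalSolution A T U₀ U) (hV : IsClassicalSolution A T U₀ V) {t : ℝ}
    (ht : t ∈ timeInterval T) : U t = V t := by
  classical
  have hsub := Icc_subset_timeInterval ht
  let d : ∀ W : ℝ → X, IsClassicalSolution A T U₀ W → ℝ → X := fun W hW s =>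
    if hs : s ∈ timeInterval T then A ⟨W s, hW.mem_domain s hs⟩ else 0
  have hd : ∀ W hW s, s ∈ Icc 0 t → HasDerivWithinAt W (d W hW s) (Icc 0 t) s := by
    intro W hW s hs
    simp only [d, dif_pos (hsub hs)]
    exact (hW.hasDeriv s (hsub hs)).mono hsub
  have hg : ∀ W hW s, s ∈ Icc 0 t → (W s, d W hW s) ∈ A.graph := by
    intro W hW s hs
    simp only [d, dif_pos (hsub hs)]
    exact hW.graph (hsub hs)
  refine sub_eq_zero.1 (hA.eq_zero_of_hasDerivWithinAt (W := fun s => U s - V s)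
    (W' := fun s => d U hU s - d V hV s) ht.1
    (fun s hs => (hd U hU s hs).sub (hd V hV s hs))
    (fun s hs => A.graph.sub_mem (hg U hU s hs) (hg V hV s hs)) ?_)
  rw [hU.initial, hV.initial, sub_self]

variable [CompleteSpace X]

/-- As `U` is continuous only on `[0, t]`, it is extended by its end values to a continuous function
on the line; on `[0, t]` the two primitives agree. -/
lemma hasDerivWithinAt_integral_of_continuousOn {U : ℝ → X} {t : ℝ} (ht : 0 ≤ t)
    (hU : ContinuousOn U (Icc 0 t)) {s : ℝ} (hs : s ∈ Icc 0 t) :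
    HasDerivWithinAt (fun s => ∫ r in (0 : ℝ)..s, U r) (U s) (Icc 0 t) s := by
  let V : ℝ → X := IccExtend ht ((Icc 0 t).domRestrict U)
  have hV : Continuous V := hU.domRestrict.Icc_extend'
  have hVU : ∀ r ∈ Icc 0 t, V r = U r := fun r hr => by
    simp only [V, IccExtend_of_mem ht _ hr]
    rfl
  have h1 := (hV.integral_hasStrictDerivAt 0 s).hasDerivAt.hasDerivWithinAt (s := Icc 0 t)
  rw [hVU s hs] at h1
  have h2 : ∀ r ∈ Icc 0 t, ∫ q in (0 : ℝ)..r, U q = ∫ q in (0 : ℝ)..r, V q := fun r hr => by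
    refine intervalIntegral.integral_congr fun q hq => (hVU q ?_).symm
    rw [uIcc_of_le hr.1] at hq
    exact ⟨hq.1, hq.2.trans hr.2⟩
  exact h1.congr h2 (h2 s hs)

/-- The function `W = ∫₀ (U - V)` satisfies `W' = U - V = A W` and `W(0) = 0`, so it vanishes, and
then so does `U - V = A W`. -/
lemma IsMildSolution.unique (hA : MaxDissipative A) {U₀ : X} {U V : ℝ → X}
    (hU : IsMildSolution A T U₀ U) (hV : IsMildSolution A T U₀ V) {t : ℝ}
    (ht : t ∈ timeInterval T) : U t = V t := by
  have hsub := Icc_subset_timeInterval ht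
  have hg : ∀ s ∈ Icc 0 t, ((∫ r in (0 : ℝ)..s, U r) - ∫ r in (0 : ℝ)..s, V r, U s - V s)
      ∈ A.graph := fun s hs => by
    have := A.graph.sub_mem (hU.graph (hsub hs)) (hV.graph (hsub hs))
    simpa using this
  have h0 := hA.eq_zero_of_hasDerivWithinAt ht.1
    (fun s hs => (hasDerivWithinAt_integral_of_continuousOn ht.1
      (hU.continuousOn.mono hsub) hs).sub
      (hasDerivWithinAt_integral_of_continuousOn ht.1 (hV.continuousOn.mono hsub) hs))
    hg (by simp)
  exact sub_eq_zero.1 (A.graph_fst_eq_zero_snd (hg t (right_mem_Icc.2 ht.1)) h0)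

lemma tendsto_coe_nnreal_nhdsGT : Tendsto (fun t : ℝ≥0 => (t : ℝ)) (𝓝[>] 0) (𝓝[≠] 0) := by
  refine tendsto_nhdsWithin_iff.2 ⟨?_, ?_⟩
  · exact (NNReal.continuous_coe.tendsto 0).mono_left nhdsWithin_le_nhds
  · filter_upwards [self_mem_nhdsWithin] with t ht
    exact NNReal.coe_ne_zero.2 (ne_of_gt ht)

/-- A maximal dissipative operator on a Hilbert space generates a contraction semigroup, whose
orbits are the unique mild, respectively classical, solutions of the Cauchy problem. -/
theorem MaxDissipative.cauchyProblem (hA : MaxDissipative A) :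
    ∃ S : ContractionSemigroup X,
      S.IsGenerator A ∧
      ∀ T : EReal, 0 < T →
        (∀ U₀ : X,
          IsMildSolution A T U₀ (fun t => S.S t.toNNReal U₀) ∧
          ∀ U : ℝ → X, IsMildSolution A T U₀ U →
            ∀ t ∈ timeInterval T, U t = S.S t.toNNReal U₀) ∧
        (∀ U₀ ∈ A.domain,
          IsClassicalSolution A T U₀ (fun t => S.S t.toNNReal U₀) ∧
          ∀ U : ℝ → X, IsClassicalSolution A T U₀ U →
            ∀ t ∈ timeInterval T, U t = S.S t.toNNReal U₀) := by
  obtain ⟨S, hc, hi, hcomm⟩ := hA.exists_semigroup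
  obtain ⟨R, hR⟩ := hA.exists_resolvent one_pos
  have hc' : ∀ x, Continuous fun t : ℝ => S.S t.toNNReal x := fun x =>
    (hc x).comp continuous_real_toNNReal
  have hS0 : ∀ x, S.S 0 x = x := fun x => by rw [S.map_zero]; rfl
  have hgen : ∀ x z, (x, z) ∈ A.graph →
      Tendsto (fun t : ℝ≥0 => ((t : ℝ) : ℂ)⁻¹ • (S.S t x - x)) (𝓝[>] 0) (𝓝 z) := by
    intro x z hz
    have h1 := ((hc' z).integral_hasStrictDerivAt 0 0).hasDerivAt
    rw [hasDerivAt_iff_tendsto_slope_zero, Real.toNNReal_zero, hS0] at h1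
    refine (h1.comp tendsto_coe_nnreal_nhdsGT).congr fun t => ?_
    have h2 := hi x z hz t t.2
    rw [Real.toNNReal_coe] at h2
    simp [h2, ← Complex.ofReal_inv]
  -- Membership in the graph is the equation `R (x - z) = x`, which is preserved by operators
  -- commuting with `R`.
  have hstep : ∀ x z, (x, z) ∈ A.graph → ∀ t, (S.S t x, S.S t z) ∈ A.graph := by
    intro x z hz t
    have h1 := hR.apply_sub x z hz
    rw [hR.mem_graph_iff, ← map_smul, ← map_sub, ← hcomm 1 R hR, h1]
  refine ⟨S, fun x z => ⟨hgen x z, fun h => ?_⟩, fun T hT => ⟨fun U₀ => ?_, fun U₀ hU₀ => ?_⟩⟩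
  -- The generator extends `A` and is dissipative, and `1 - A` is already onto, so it cannot be
  -- larger. With `x' - A x' = x - z`, the vector `w = x - x'` is mapped to `z - z' = w` by the
  -- generator, and dissipativity yields `‖w‖² ≤ 0`.
  · obtain ⟨x', z', hg, he⟩ := hA.range_eq 1 one_pos (x - z)
    have h1 := h.sub (hgen x' z' hg)
    have h2 : z - z' = x - x' := by
      rw [Complex.ofReal_one, one_smul] at he
      rw [← sub_eq_zero] at he ⊢
      rw [← he]
      abel
    have h3 : (inner ℂ (z - z') (x - x')).re ≤ 0 := by
      have h4 : Tendsto (fun t : ℝ≥0 => (inner ℂ (((t : ℝ) : ℂ)⁻¹ • (S.S t (x - x') - (x - x')))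
          (x - x')).re) (𝓝[>] 0) (𝓝 (inner ℂ (z - z') (x - x')).re) := by
        refine (Complex.continuous_re.tendsto _).comp (Tendsto.inner ?_ tendsto_const_nhds)
        refine h1.congr fun t => ?_
        rw [← smul_sub, map_sub]
        congr 1
        abel
      refine le_of_tendsto h4 (Eventually.of_forall fun t => ?_)
      rw [inner_smul_left, inner_sub_left, inner_self_eq_norm_sq_to_K, ← Complex.ofReal_inv,
        Complex.conj_ofReal, Complex.re_ofReal_mul]
      have h5 : (inner ℂ (S.S t (x - x')) (x - x')).re ≤ ‖S.S t (x - x')‖ * ‖x - x'‖ :=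
        re_inner_le_norm (𝕜 := ℂ) _ _
      have h6 : ‖S.S t (x - x')‖ ≤ ‖x - x'‖ := by
        simpa using (S.S t).le_of_opNorm_le (S.contraction t) (x - x')
      have h7 : (((‖x - x'‖ : ℝ) : ℂ) ^ 2).re = ‖x - x'‖ ^ 2 := by
        rw [← Complex.ofReal_pow, Complex.ofReal_re]
      refine mul_nonpos_of_nonneg_of_nonpos (inv_nonneg.2 t.2) ?_
      rw [Complex.sub_re]
      have h8 := mul_le_mul_of_nonneg_right h6 (norm_nonneg (x - x'))
      refine (sub_le_sub_right (h5.trans h8) _).trans ?_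
      refine le_of_eq ?_
      rw [← pow_two, sub_eq_zero]
      exact h7.symm
    rw [h2, inner_self_eq_norm_sq_to_K] at h3
    have h9 : x - x' = 0 := by
      have : ‖x - x'‖ ^ 2 ≤ 0 := by
        rw [← Complex.ofReal_re (‖x - x'‖ ^ 2), Complex.ofReal_pow]
        exact h3
      exact norm_eq_zero.1 (pow_eq_zero_iff two_ne_zero |>.1 (le_antisymm this (sq_nonneg _)))
    rw [h9, sub_eq_zero] at h2
    rw [h2, sub_eq_zero.1 h9]
    exact hg
  · have hg : ∀ t ∈ timeInterval T, (∫ s in (0 : ℝ)..t, S.S s.toNNReal U₀,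
        S.S t.toNNReal U₀ - U₀) ∈ A.graph := by
      intro t ht
      -- For arbitrary `U₀`, the vector `R U₀` lies in the domain and `A R U₀ = R U₀ - U₀`. Pulling
      -- `R` out of the orbit identity turns it into the resolvent criterion for the pair `(∫ S U₀,
      -- S(t) U₀ - U₀)`.
      have h1 := hi _ _ (hR.graph U₀) t ht.1
      simp only [Complex.ofReal_one, one_smul, map_sub, hcomm 1 R hR] at h1
      have hRc : Continuous fun s : ℝ => R (S.S s.toNNReal U₀) := R.continuous.comp (hc' U₀)
      rw [intervalIntegral.integral_sub (hRc.intervalIntegrable _ _)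
        ((hc' U₀).intervalIntegrable _ _)] at h1
      have h2 : ∫ s in (0 : ℝ)..t, R (S.S s.toNNReal U₀) = R (∫ s in (0 : ℝ)..t, S.S s.toNNReal U₀) :=
        ContinuousLinearMap.intervalIntegral_comp_comm R ((hc' U₀).intervalIntegrable _ _)
      rw [h2] at h1
      rw [hR.mem_graph_iff, Complex.ofReal_one, one_smul, map_sub, map_sub, h1]
      abel
    have hm : IsMildSolution A T U₀ (fun t => S.S t.toNNReal U₀) :=
      { continuousOn := (hc' U₀).continuousOn
        integral_mem := fun t ht => LinearPMap.mem_domain_iff.2 ⟨_, hg t ht⟩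
        integral_eq := fun t ht => by
          have h1 := A.mem_graph ⟨_, LinearPMap.mem_domain_iff.2 ⟨_, hg t ht⟩⟩
          rw [A.mem_graph_snd_inj h1 (hg t ht) rfl]
          abel }
    exact ⟨hm, fun U hU t ht => hU.unique hA hm ht⟩
  · obtain ⟨F, hF⟩ := LinearPMap.mem_domain_iff.1 hU₀
    have hdom : ∀ t, S.S t U₀ ∈ A.domain := fun t =>
      LinearPMap.mem_domain_iff.2 ⟨_, hstep U₀ F hF t⟩
    have hval : ∀ t, A ⟨S.S t U₀, hdom t⟩ = S.S t F := fun t =>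
      A.mem_graph_snd_inj (A.mem_graph ⟨_, hdom t⟩) (hstep U₀ F hF t) rfl
    -- The orbit is frozen for negative times by `toNNReal` and may have a corner at `0`. This
    -- function is `C¹` on the whole line and agrees with the orbit on the time interval.
    have hd : ∀ t, HasDerivAt (fun t => U₀ + ∫ s in (0 : ℝ)..t, S.S s.toNNReal F)
        (S.S t.toNNReal F) t := fun t =>
      ((hc' F).integral_hasStrictDerivAt 0 t).hasDerivAt.const_add U₀
    have heq : ∀ t ∈ timeInterval T, S.S t.toNNReal U₀ =
        U₀ + ∫ s in (0 : ℝ)..t, S.S s.toNNReal F := fun t ht => hi U₀ F hF t ht.1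
    have hm : IsClassicalSolution A T U₀ (fun t => S.S t.toNNReal U₀) :=
      { initial := by rw [Real.toNNReal_zero, hS0]
        contDiffOn := by
          have : ContDiff ℝ 1 (fun t => U₀ + ∫ s in (0 : ℝ)..t, S.S s.toNNReal F) := by
            rw [contDiff_one_iff_deriv]
            refine ⟨fun t => (hd t).differentiableAt, ?_⟩
            rw [funext fun t => (hd t).deriv]
            exact hc' F
          exact this.contDiffOn.congr heq
        mem_domain := fun t _ => hdom _
        continuous_apply := by
          simp only [hval]
          exact (hc' F).comp continuous_subtype_val
        hasDeriv := fun t ht => by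
          rw [hval]
          exact (hd t).hasDerivWithinAt.congr heq (heq t ht) }
    exact ⟨hm, fun U hU t ht => hU.unique hA hm ht⟩

end CauchyProblem

/-! ### Primitives of integrable functions -/

/-- The primitive of an integrable function is absolutely continuous. -/
lemma absolutelyContinuousOnInterval_primitive {f : ℝ → ℂ} {a b : ℝ}
    (hf : IntervalIntegrable f volume a b) :
    AbsolutelyContinuousOnInterval (fun x => ∫ t in a..x, f t) a b := by
  -- The increments of the primitive of `f` are dominated by those of the real primitive of `‖f‖`.
  have h := hf.norm.absolutelyContinuousOnInterval_intervalIntegral (c := a) left_mem_uIcc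
  refine squeeze_zero' (Eventually.of_forall fun E => Finset.sum_nonneg fun _ _ => dist_nonneg)
    ?_ h
  filter_upwards [mem_inf_of_right (mem_principal_self _)] with E hE
  refine Finset.sum_le_sum fun i hi => ?_
  obtain ⟨h1, h2⟩ := hE.1 i hi
  have hi1 := hf.mono_set (uIcc_subset_uIcc_left h1)
  have hi2 := hf.mono_set (uIcc_subset_uIcc_left h2)
  rw [dist_eq_norm, Real.dist_eq, intervalIntegral.integral_interval_sub_left hi1 hi2,
    intervalIntegral.integral_interval_sub_left hi1.norm hi2.norm]
  exact intervalIntegral.norm_integral_le_abs_integral_norm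

/-- `F` is a primitive of the integrable function `f` on `[a, b]`. -/
structure IsPrimitive (F f : ℝ → ℂ) (a b : ℝ) : Prop where
  intervalIntegrable : IntervalIntegrable f volume a b
  eq_add_integral : ∀ x ∈ Icc a b, F x = F a + ∫ t in a..x, f t

namespace IsPrimitive

variable {F G f g : ℝ → ℂ} {a b : ℝ}

lemma integral (hf : IntervalIntegrable f volume a b) :
    IsPrimitive (fun x => ∫ t in a..x, f t) f a b :=
  ⟨hf, fun x _ => by simp⟩

lemma mono (h : IsPrimitive F f a b) {c d : ℝ} (hac : a ≤ c) (hcd : c ≤ d) (hdb : d ≤ b) :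
    IsPrimitive F f c d := by
  have hs : ∀ {x y}, x ∈ Icc a b → y ∈ Icc a b → IntervalIntegrable f volume x y := by
    intro x y hx hy
    have hab := hx.1.trans hx.2
    refine h.intervalIntegrable.mono_set (uIcc_subset_uIcc ?_ ?_)
    · rwa [uIcc_of_le hab]
    · rwa [uIcc_of_le hab]
  have hc : c ∈ Icc a b := ⟨hac, hcd.trans hdb⟩
  have hd : d ∈ Icc a b := ⟨hac.trans hcd, hdb⟩
  have ha : a ∈ Icc a b := ⟨le_rfl, hc.1.trans hc.2⟩
  refine ⟨hs hc hd, fun x hx => ?_⟩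
  have hx' : x ∈ Icc a b := ⟨hac.trans hx.1, hx.2.trans hdb⟩
  rw [h.eq_add_integral x hx', h.eq_add_integral c hc, add_assoc,
    intervalIntegral.integral_add_adjacent_intervals (hs ha hc) (hs hc hx')]

lemma continuousOn (h : IsPrimitive F f a b) (hab : a ≤ b) : ContinuousOn F (Icc a b) := by
  have h1 := intervalIntegral.continuousOn_primitive_interval' h.intervalIntegrable left_mem_uIcc
  rw [uIcc_of_le hab] at h1
  exact (continuousOn_const.add h1).congr h.eq_add_integral

lemma add (hF : IsPrimitive F f a b) (hG : IsPrimitive G g a b) :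
    IsPrimitive (fun x => F x + G x) (fun x => f x + g x) a b := by
  refine ⟨hF.intervalIntegrable.add hG.intervalIntegrable, fun x hx => ?_⟩
  have h1 := (hF.mono le_rfl hx.1 hx.2).intervalIntegrable
  have h2 := (hG.mono le_rfl hx.1 hx.2).intervalIntegrable
  rw [intervalIntegral.integral_add h1 h2, hF.eq_add_integral x hx, hG.eq_add_integral x hx]
  ring

lemma star (hF : IsPrimitive F f a b) :
    IsPrimitive (fun x => conj (F x)) (fun x => conj (f x)) a b := by
  refine ⟨?_, fun x hx => ?_⟩
  · rw [intervalIntegrable_iff]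
    exact Complex.conjLIE.toContinuousLinearEquiv.toContinuousLinearMap.integrable_comp
      (intervalIntegrable_iff.1 hF.intervalIntegrable)
  · have h1 := (hF.mono le_rfl hx.1 hx.2).intervalIntegrable
    have h3 : ∫ t in a..x, (starRingEnd ℂ) (f t) = (starRingEnd ℂ) (∫ t in a..x, f t) :=
      Complex.conjLIE.toContinuousLinearEquiv.toContinuousLinearMap.intervalIntegral_comp_comm h1
    rw [h3, ← map_add, hF.eq_add_integral x hx]

lemma absolutelyContinuous (h : IsPrimitive F f a b) :
    AbsolutelyContinuousOnInterval (fun x => F a + ∫ t in a..x, f t) a b := by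
  have := absolutelyContinuousOnInterval_primitive h.intervalIntegrable
  simpa only [AbsolutelyContinuousOnInterval, dist_add_left] using this

/-- The product rule for primitives. -/
lemma mul (hF : IsPrimitive F f a b) (hG : IsPrimitive G g a b) (hab : a ≤ b) :
    IsPrimitive (fun x => F x * G x) (fun x => f x * G x + F x * g x) a b := by
  have hFc := hF.continuousOn hab
  have hGc := hG.continuousOn hab
  rw [← uIcc_of_le hab] at hFc hGc
  have hint : IntervalIntegrable (fun x => f x * G x + F x * g x) volume a b :=
    (hF.intervalIntegrable.mul_continuousOn hGc).add
      (hG.intervalIntegrable.continuousOn_mul hFc)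
  refine ⟨hint, ?_⟩
  let F₀ : ℝ → ℂ := fun x => F a + ∫ t in a..x, f t
  let G₀ : ℝ → ℂ := fun x => G a + ∫ t in a..x, g t
  let I : ℝ → ℂ := fun x => ∫ t in a..x, (f t * G t + F t * g t)
  -- The product minus the candidate integral is absolutely continuous with derivative zero almost
  -- everywhere, hence constant.
  have hac : AbsolutelyContinuousOnInterval (fun x => F₀ x * G₀ x - I x) a b :=
    (hF.absolutelyContinuous.smul hG.absolutelyContinuous).sub
      (absolutelyContinuousOnInterval_primitive hint)
  obtain ⟨C, hC⟩ := hac.const_of_ae_hasDerivAt_zero (by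
    filter_upwards [hF.intervalIntegrable.ae_hasDerivAt_integral,
      hG.intervalIntegrable.ae_hasDerivAt_integral, hint.ae_hasDerivAt_integral]
      with x h1 h2 h3 hx
    have e1 : HasDerivAt F₀ (f x) x := (h1 hx a left_mem_uIcc).const_add _
    have e2 : HasDerivAt G₀ (g x) x := (h2 hx a left_mem_uIcc).const_add _
    rw [uIcc_of_le hab] at hx
    have e3 : HasDerivAt I (f x * G₀ x + F₀ x * g x) x := by
      have := h3 (by rwa [uIcc_of_le hab]) a left_mem_uIcc
      rwa [hG.eq_add_integral x hx, hF.eq_add_integral x hx] at this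
    have := (e1.mul e2).sub e3
    rw [sub_self] at this
    exact this)
  intro x hx
  have h1 := hC x (by rwa [uIcc_of_le hab])
  have h2 := hC a left_mem_uIcc
  rw [hF.eq_add_integral x hx, hG.eq_add_integral x hx]
  simp only [F₀, G₀, I, intervalIntegral.integral_same, add_zero, sub_zero] at h1 h2
  rw [h2, ← h1]
  ring

/-- Integration by parts. -/
lemma integral_mul_add (hF : IsPrimitive F f a b) (hG : IsPrimitive G g a b) (hab : a ≤ b) :
    (∫ x in a..b, f x * G x) + ∫ x in a..b, F x * g x = F b * G b - F a * G a := by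
  have hFc := hF.continuousOn hab
  have hGc := hG.continuousOn hab
  rw [← uIcc_of_le hab] at hFc hGc
  rw [← intervalIntegral.integral_add (hF.intervalIntegrable.mul_continuousOn hGc)
    (hG.intervalIntegrable.continuousOn_mul hFc),
    (hF.mul hG hab).eq_add_integral b (right_mem_Icc.2 hab)]
  ring

lemma of_contDiff {φ : ℝ → ℝ} (hφ : ContDiff ℝ ∞ φ) (a b : ℝ) :
    IsPrimitive (fun x => (φ x : ℂ)) (fun x => ((deriv φ x : ℝ) : ℂ)) a b := by
  have hc : Continuous fun x => ((deriv φ x : ℝ) : ℂ) :=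
    Complex.continuous_ofReal.comp (hφ.continuous_deriv (by simp))
  refine ⟨hc.intervalIntegrable _ _, fun x _ => ?_⟩
  rw [intervalIntegral.integral_eq_sub_of_hasDerivAt (f := fun x => (φ x : ℂ))
    (fun t _ => ((hφ.differentiable (by simp)) t).hasDerivAt.ofReal_comp)
    (hc.intervalIntegrable _ _)]
  ring

lemma hasWeakDeriv (hF : IsPrimitive F f a b) (hab : a ≤ b) : HasWeakDeriv (Ioo a b) F f := by
  intro φ h1 h2 h3
  have hφ := of_contDiff h1 a b
  have ha : φ a = 0 := image_eq_zero_of_notMem_tsupport fun h => by simpa using h3 h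
  have hb : φ b = 0 := image_eq_zero_of_notMem_tsupport fun h => by simpa using h3 h
  have h4 := hφ.integral_mul_add hF hab
  rw [ha, hb] at h4
  simp only [Complex.real_smul]
  rw [← integral_Ioc_eq_integral_Ioo, ← integral_Ioc_eq_integral_Ioo,
    ← intervalIntegral.integral_of_le hab, ← intervalIntegral.integral_of_le hab]
  rw [eq_neg_iff_add_eq_zero, h4]
  simp

lemma hasRightTrace (hF : IsPrimitive F f a b) (hab : a < b)
    (hg : g =ᵐ[volume.restrict (Ioo a b)] F) {x : ℝ} (hx : x ∈ Ico a b) :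
    HasRightTrace g x (F x) := by
  have hn : Ioo x b ⊆ Ioo a b := Ioo_subset_Ioo_left hx.1
  have hg' := ae_restrict_of_ae_restrict_of_subset hn hg
  have h1 : Tendsto F (𝓝[>] x) (𝓝 (F x)) := by
    have h2 := hF.continuousOn hab.le x ⟨hx.1, hx.2.le⟩
    exact h2.mono_left (nhdsWithin_le_of_mem (mem_of_superset (Ioo_mem_nhdsGT hx.2)
      (hn.trans Ioo_subset_Icc_self)))
  exact (h1.mono_left inf_le_left).congr'
    (eventuallyEq_of_ae_restrict (Ioo_mem_nhdsGT hx.2) hg').symm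

lemma hasLeftTrace (hF : IsPrimitive F f a b) (hab : a < b)
    (hg : g =ᵐ[volume.restrict (Ioo a b)] F) {x : ℝ} (hx : x ∈ Ioc a b) :
    HasLeftTrace g x (F x) := by
  have hn : Ioo a x ⊆ Ioo a b := Ioo_subset_Ioo_right hx.2
  have hg' := ae_restrict_of_ae_restrict_of_subset hn hg
  have h1 : Tendsto F (𝓝[<] x) (𝓝 (F x)) := by
    have h2 := hF.continuousOn hab.le x ⟨hx.1.le, hx.2⟩
    exact h2.mono_left (nhdsWithin_le_of_mem (mem_of_superset (Ioo_mem_nhdsLT hx.1)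
      (hn.trans Ioo_subset_Icc_self)))
  exact (h1.mono_left inf_le_left).congr'
    (eventuallyEq_of_ae_restrict (Ioo_mem_nhdsLT hx.1) hg').symm

lemma hasPointValue (hF : IsPrimitive F f a b) (hab : a < b)
    (hg : g =ᵐ[volume.restrict (Ioo a b)] F) {x : ℝ} (hx : x ∈ Ioo a b) :
    HasPointValue g x (F x) := by
  have hn : Ioo a b ∈ 𝓝 x := Ioo_mem_nhds hx.1 hx.2
  have h1 : Tendsto F (𝓝 x) (𝓝 (F x)) :=
    (hF.continuousOn hab.le).continuousAt (mem_of_superset hn Ioo_subset_Icc_self)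
  exact (h1.mono_left inf_le_left).congr' (eventuallyEq_of_ae_restrict hn hg).symm

end IsPrimitive

/-- A function with an integrable weak derivative on an interval has an absolutely continuous
representative. -/
lemma HasWeakDeriv.exists_isPrimitive {a b : ℝ} (hab : a < b) {f g : ℝ → ℂ}
    (h : HasWeakDeriv (Ioo a b) f g) (hf : IntegrableOn f (Ioo a b))
    (hg : IntegrableOn g (Ioo a b)) :
    ∃ F, IsPrimitive F g a b ∧ f =ᵐ[volume.restrict (Ioo a b)] F := by
  have hgi : IntervalIntegrable g volume a b := by
    rwa [intervalIntegrable_iff_integrableOn_Ioo_of_le hab.le]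
  have hG := IsPrimitive.integral hgi
  have hGi : IntegrableOn (fun x => ∫ t in a..x, g t) (Ioo a b) :=
    ((hG.continuousOn hab.le).integrableOn_compact isCompact_Icc).mono_set Ioo_subset_Icc_self
  -- The difference of `f` and the primitive of `g` has weak derivative zero, so it is a constant
  -- almost everywhere.
  have h1 := h.add ((hG.hasWeakDeriv hab.le).const_smul (-1)) hf (hGi.const_mul (-1)) hg
    (hg.const_mul (-1))
  obtain ⟨c, hc⟩ := h1.ae_const hab (hf.add (hGi.const_mul (-1)))
    (Eventually.of_forall fun x => by simp)
  refine ⟨fun x => c + ∫ t in a..x, g t, ⟨hgi, fun x _ => by simp⟩, ?_⟩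
  filter_upwards [hc] with x hx
  rw [← hx]
  ring

instance neBot_nhdsLT_inf_ae {x : ℝ} : (𝓝[<] x ⊓ ae (volume : Measure ℝ)).NeBot := by
  refine inf_neBot_iff.2 fun {s} hs {t} ht => ?_
  obtain ⟨u, hu, hus⟩ := mem_nhdsLT_iff_exists_Ioo_subset.1 hs
  by_contra hne
  rw [not_nonempty_iff_eq_empty] at hne
  have h1 : Ioo u x ⊆ tᶜ := fun y hy hyt => by
    have : y ∈ s ∩ t := ⟨hus hy, hyt⟩
    simp [hne] at this
  have h2 : volume (Ioo u x) = 0 := measure_mono_null h1 ht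
  rw [Real.volume_Ioo, ENNReal.ofReal_eq_zero] at h2
  have h3 : u < x := hu
  linarith

/-- Weak derivatives restrict to smaller sets. -/
lemma HasWeakDeriv.mono {Ω Ω' : Set ℝ} {f g : ℝ → ℂ} (h : HasWeakDeriv Ω f g) (hs : Ω' ⊆ Ω) :
    HasWeakDeriv Ω' f g := by
  intro φ h1 h2 h3
  have h4 := h φ h1 h2 (h3.trans hs)
  have hd : tsupport (deriv φ) ⊆ Ω' := (tsupport_deriv_subset (𝕜 := ℝ) (f := φ)).trans h3
  rw [HasWeakDeriv.setIntegral_eq (hd.trans hs), HasWeakDeriv.setIntegral_eq (h3.trans hs)] at h4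
  rw [HasWeakDeriv.setIntegral_eq hd, HasWeakDeriv.setIntegral_eq h3, h4]

/-! ### Operators on `L²(0,ℓ)` -/

lemma IsPrimitive.congr_ae {F f g : ℝ → ℂ} {a b : ℝ} (h : IsPrimitive F f a b) (hab : a ≤ b)
    (hfg : f =ᵐ[volume.restrict (Ioo a b)] g) : IsPrimitive F g a b := by
  have h0 : f =ᵐ[volume.restrict (Ioc a b)] g := by
    rwa [← restrict_Ioo_eq_restrict_Ioc]
  refine ⟨h.intervalIntegrable.congr_ae (by rwa [uIoc_of_le hab]), fun x hx => ?_⟩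
  rw [h.eq_add_integral x hx]
  congr 1
  refine intervalIntegral.integral_congr_ae_restrict ?_
  rw [uIoc_of_le hx.1]
  exact ae_restrict_of_ae_restrict_of_subset (Ioc_subset_Ioc_right hx.2) h0

namespace LTwo

variable {ℓ : ℝ}

lemma intervalIntegrable (hℓ : 0 ≤ ℓ) (f : LTwo ℓ) : IntervalIntegrable f volume 0 ℓ := by
  rw [intervalIntegrable_iff_integrableOn_Ioo_of_le hℓ]
  exact integrableOn f subset_rfl

lemma isPrimitive (hℓ : 0 ≤ ℓ) (f : LTwo ℓ) : IsPrimitive (fun x => ∫ t in (0 : ℝ)..x, f t) f 0 ℓ :=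
  .integral (intervalIntegrable hℓ f)

lemma memLp_of_continuousOn {F : ℝ → ℂ} (hF : ContinuousOn F (Icc 0 ℓ)) :
    MemLp F 2 (volume.restrict (Ioo 0 ℓ)) := by
  obtain ⟨C, hC⟩ := isCompact_Icc.exists_bound_of_continuousOn hF
  refine MemLp.of_bound ((hF.mono Ioo_subset_Icc_self).aestronglyMeasurable measurableSet_Ioo) C ?_
  exact (ae_restrict_iff' measurableSet_Ioo).2
    (Eventually.of_forall fun x hx => hC x (Ioo_subset_Icc_self hx))

/-- Cauchy–Schwarz against the constant `1`, read as the comparison of `L¹` and `L²` norms on a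
finite measure space. -/
lemma integral_norm_le (f : LTwo ℓ) :
    ∫ x in Ioo 0 ℓ, ‖f x‖ ≤ Real.sqrt (volume.real (Ioo 0 ℓ)) * ‖f‖ := by
  have hm : AEStronglyMeasurable f (volume.restrict (Ioo 0 ℓ)) := (Lp.memLp f).1
  have h1 := eLpNorm_le_eLpNorm_mul_rpow_measure_univ (p := 1) (q := 2) one_le_two hm
  rw [integral_norm_eq_lintegral_enorm hm, ← eLpNorm_one_eq_lintegral_enorm, Lp.norm_def]
  refine (ENNReal.toReal_mono ?_ h1).trans ?_
  · refine ENNReal.mul_ne_top (Lp.memLp f).2.ne (ENNReal.rpow_ne_top_of_nonneg (by norm_num) ?_)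
    simp
  · rw [ENNReal.toReal_mul, ← ENNReal.toReal_rpow, mul_comm, Real.sqrt_eq_rpow]
    refine le_of_eq ?_
    congr 2
    · simp [measureReal_def]
    · norm_num

/-- Integration from the left end point, `f ↦ ∫₀ˣ f`. -/
def volterra (hℓ : 0 ≤ ℓ) : LTwo ℓ →L[ℂ] LTwo ℓ :=
  LinearMap.mkContinuous
    { toFun := fun f => (memLp_of_continuousOn ((isPrimitive hℓ f).continuousOn hℓ)).toLp
        (fun x => ∫ t in (0 : ℝ)..x, f t)
      map_add' := fun f g => by
        refine Lp.ext ?_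
        have h1 := (isPrimitive hℓ (f + g)).congr_ae hℓ (coe_add f g)
        have h2 := (isPrimitive hℓ f).add (isPrimitive hℓ g)
        filter_upwards [MemLp.coeFn_toLp
            (memLp_of_continuousOn ((isPrimitive hℓ (f + g)).continuousOn hℓ)),
          MemLp.coeFn_toLp (memLp_of_continuousOn ((isPrimitive hℓ f).continuousOn hℓ)),
          MemLp.coeFn_toLp (memLp_of_continuousOn ((isPrimitive hℓ g).continuousOn hℓ)),
          Lp.coeFn_add ((memLp_of_continuousOn ((isPrimitive hℓ f).continuousOn hℓ)).toLp _)
            ((memLp_of_continuousOn ((isPrimitive hℓ g).continuousOn hℓ)).toLp _),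
          ae_restrict_mem measurableSet_Ioo] with x e1 e2 e3 e4 hx
        have hx' := Ioo_subset_Icc_self hx
        rw [e4, Pi.add_apply, e1, e2, e3, h1.eq_add_integral x hx']
        have := h2.eq_add_integral x hx'
        simp only [intervalIntegral.integral_same, zero_add, add_zero] at this ⊢
        rw [← this]
      map_smul' := fun c f => by
        refine Lp.ext ?_
        have h1 := (isPrimitive hℓ (c • f)).congr_ae hℓ (coe_smul c f)
        filter_upwards [MemLp.coeFn_toLp
            (memLp_of_continuousOn ((isPrimitive hℓ (c • f)).continuousOn hℓ)),
          MemLp.coeFn_toLp (memLp_of_continuousOn ((isPrimitive hℓ f).continuousOn hℓ)),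
          Lp.coeFn_smul c ((memLp_of_continuousOn ((isPrimitive hℓ f).continuousOn hℓ)).toLp _),
          ae_restrict_mem measurableSet_Ioo] with x e1 e2 e4 hx
        have hx' := Ioo_subset_Icc_self hx
        rw [RingHom.id_apply, e4, Pi.smul_apply, e1, e2, h1.eq_add_integral x hx']
        simp }
    -- The bound `ℓ` is `√ℓ · √ℓ`: one factor bounds the primitive uniformly by `√ℓ ‖f‖`, the other
    -- passes from the uniform bound to the `L²` norm.
    (volume.real (Ioo 0 ℓ)) (fun f => by
      have hb : ∀ᵐ x ∂volume.restrict (Ioo 0 ℓ),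
          ‖(memLp_of_continuousOn ((isPrimitive hℓ f).continuousOn hℓ)).toLp
            (fun x => ∫ t in (0 : ℝ)..x, f t) x‖ ≤
            Real.sqrt (volume.real (Ioo 0 ℓ)) * ‖f‖ := by
        filter_upwards [MemLp.coeFn_toLp
          (memLp_of_continuousOn ((isPrimitive hℓ f).continuousOn hℓ)),
          ae_restrict_mem measurableSet_Ioo] with x e1 hx
        rw [e1]
        refine le_trans ?_ (integral_norm_le f)
        refine (intervalIntegral.norm_integral_le_integral_norm hx.1.le).trans ?_
        rw [intervalIntegral.integral_of_le hx.1.le]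
        refine setIntegral_mono_set (integrableOn f subset_rfl).norm
          (Eventually.of_forall fun _ => norm_nonneg _) (LE.le.eventuallyLE ?_)
        exact fun y hy => ⟨hy.1, hy.2.trans_lt hx.2⟩
      refine (Lp.norm_le_of_ae_bound (by positivity) hb).trans ?_
      rw [← mul_assoc]
      refine mul_le_mul_of_nonneg_right (le_of_eq ?_) (norm_nonneg _)
      have h1 : (measureUnivNNReal (volume.restrict (Ioo 0 ℓ)) : ℝ) ^ (2 : ENNReal).toReal⁻¹
          = Real.sqrt (volume.real (Ioo 0 ℓ)) := by
        rw [Real.sqrt_eq_rpow]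
        congr 1
        · rw [measureUnivNNReal, Measure.restrict_apply_univ]
          rfl
        · norm_num
      rw [h1]
      exact Real.mul_self_sqrt measureReal_nonneg)

lemma coe_volterra (hℓ : 0 ≤ ℓ) (f : LTwo ℓ) :
    volterra hℓ f =ᵐ[volume.restrict (Ioo 0 ℓ)] fun x => ∫ t in (0 : ℝ)..x, f t :=
  MemLp.coeFn_toLp (memLp_of_continuousOn ((isPrimitive hℓ f).continuousOn hℓ))

lemma memLp_mul {m : ℝ → ℝ} {C : ℝ} (hm : Measurable m) (hC : ∀ x, |m x| ≤ C) (f : LTwo ℓ) :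
    MemLp (fun x => (m x : ℂ) * f x) 2 (volume.restrict (Ioo 0 ℓ)) :=
  (Lp.memLp f).of_le_mul (c := C)
    ((Complex.measurable_ofReal.comp hm).aestronglyMeasurable.mul (Lp.memLp f).1)
    (Eventually.of_forall fun x => by
      rw [norm_mul, Complex.norm_real]
      exact mul_le_mul_of_nonneg_right (hC x) (norm_nonneg _))

/-- Multiplication by a bounded real function. -/
def mulBdd (m : ℝ → ℝ) (C : ℝ) (hm : Measurable m) (hC : ∀ x, |m x| ≤ C) : LTwo ℓ →L[ℂ] LTwo ℓ :=
  have hmem := memLp_mul (ℓ := ℓ) hm hC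
  LinearMap.mkContinuous
    { toFun := fun f => (hmem f).toLp
      map_add' := fun f g => by
        refine Lp.ext ?_
        filter_upwards [(hmem (f + g)).coeFn_toLp, (hmem f).coeFn_toLp, (hmem g).coeFn_toLp,
          Lp.coeFn_add (hmem f).toLp (hmem g).toLp, coe_add f g] with x e1 e2 e3 e4 e5
        rw [e4, Pi.add_apply, e1, e2, e3, e5, mul_add]
      map_smul' := fun c f => by
        refine Lp.ext ?_
        filter_upwards [(hmem (c • f)).coeFn_toLp, (hmem f).coeFn_toLp,
          Lp.coeFn_smul c (hmem f).toLp, coe_smul c f] with x e1 e2 e4 e5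
        rw [RingHom.id_apply, e4, Pi.smul_apply, e1, e2, e5, smul_eq_mul]
        ring }
    C (fun f => by
      refine Lp.norm_le_mul_norm_of_ae_le_mul ?_
      filter_upwards [(hmem f).coeFn_toLp] with x hx
      rw [LinearMap.coe_mk, AddHom.coe_mk, hx, norm_mul, Complex.norm_real]
      exact mul_le_mul_of_nonneg_right (hC x) (norm_nonneg _))

lemma coe_mulBdd (m : ℝ → ℝ) (C : ℝ) (hm : Measurable m) (hC : ∀ x, |m x| ≤ C) (f : LTwo ℓ) :
    mulBdd m C hm hC f =ᵐ[volume.restrict (Ioo 0 ℓ)] fun x => (m x : ℂ) * f x :=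
  MemLp.coeFn_toLp (memLp_mul hm hC f)

lemma inner_eq (f g : LTwo ℓ) : inner ℂ f g = ∫ x in Ioo 0 ℓ, conj (f x) * g x := by
  rw [L2.inner_def]
  simp [mul_comm]

lemma inner_eq_of_ae (hℓ : 0 ≤ ℓ) {f g : LTwo ℓ} {F G : ℝ → ℂ}
    (hf : f =ᵐ[volume.restrict (Ioo 0 ℓ)] F) (hg : g =ᵐ[volume.restrict (Ioo 0 ℓ)] G) :
    inner ℂ f g = ∫ x in (0 : ℝ)..ℓ, conj (F x) * G x := by
  rw [inner_eq, intervalIntegral.integral_of_le hℓ, integral_Ioc_eq_integral_Ioo]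
  refine integral_congr_ae ?_
  filter_upwards [hf, hg] with x h1 h2
  rw [h1, h2]

end LTwo

/-! ### Ramps and steps: the kernels of the point evaluations -/

/-- The function `y ↦ (ξ - y)₊`. -/
def rampFn (ξ y : ℝ) : ℂ := ((max (ξ - y) 0 : ℝ) : ℂ)

/-- The indicator function of `(-∞, ξ)`. -/
def stepFn (ξ y : ℝ) : ℂ := if y < ξ then 1 else 0

lemma continuous_rampFn (ξ : ℝ) : Continuous (rampFn ξ) := by
  unfold rampFn
  fun_prop

lemma measurable_stepFn (ξ : ℝ) : Measurable (stepFn ξ) :=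
  Measurable.ite measurableSet_Iio measurable_const measurable_const

lemma norm_stepFn_le (ξ y : ℝ) : ‖stepFn ξ y‖ ≤ 1 := by
  unfold stepFn
  split_ifs <;> simp

lemma conj_rampFn (ξ y : ℝ) : conj (rampFn ξ y) = rampFn ξ y := Complex.conj_ofReal _

lemma conj_stepFn (ξ y : ℝ) : conj (stepFn ξ y) = stepFn ξ y := by
  unfold stepFn
  split_ifs <;> simp

lemma intervalIntegrable_stepFn (ξ a b : ℝ) : IntervalIntegrable (stepFn ξ) volume a b := by
  refine IntervalIntegrable.mono_fun (g := stepFn ξ) (f := fun _ => (1 : ℂ))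
    intervalIntegrable_const (measurable_stepFn ξ).aestronglyMeasurable
    (Eventually.of_forall fun x => ?_)
  simpa using norm_stepFn_le ξ x

/-- The ramp is continuous and differentiable except at `ξ`, and the fundamental theorem of calculus
tolerates a countable exceptional set. -/
lemma isPrimitive_rampFn (ξ a b : ℝ) :
    IsPrimitive (rampFn ξ) (fun y => -1 * stepFn ξ y) a b := by
  have hi : ∀ a b, IntervalIntegrable (fun y => -1 * stepFn ξ y) volume a b := fun a b =>
    (intervalIntegrable_stepFn ξ a b).const_mul (-1)
  refine ⟨hi a b, fun x _ => ?_⟩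
  rw [integral_eq_of_hasDerivAt_off_countable (rampFn ξ) _ (countable_singleton ξ)
    (continuous_rampFn ξ).continuousOn (fun y hy => ?_) (hi a x)]
  · ring
  · rcases lt_or_gt_of_ne (show y ≠ ξ from hy.2) with h | h
    · have h1 : HasDerivAt (fun y : ℝ => ((ξ - y : ℝ) : ℂ)) ((-1 : ℝ) : ℂ) y :=
        ((hasDerivAt_id y).const_sub ξ).ofReal_comp
      have h2 : -1 * stepFn ξ y = ((-1 : ℝ) : ℂ) := by simp [stepFn, h]
      rw [h2]
      refine h1.congr_of_eventuallyEq ?_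
      filter_upwards [Iio_mem_nhds h] with z hz
      have hz' : z < ξ := hz
      simp only [rampFn]
      rw [max_eq_left (by linarith)]
    · have h2 : -1 * stepFn ξ y = 0 := by simp [stepFn, h.le]
      rw [h2]
      refine (hasDerivAt_const y (0 : ℂ)).congr_of_eventuallyEq ?_
      filter_upwards [Ioi_mem_nhds h] with z hz
      have hz' : ξ < z := hz
      simp only [rampFn]
      rw [max_eq_right (by linarith), Complex.ofReal_zero]

lemma integral_stepFn_mul {ξ ℓ : ℝ} (h0 : 0 ≤ ξ) (h1 : ξ ≤ ℓ) (f : ℝ → ℂ) :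
    ∫ y in (0 : ℝ)..ℓ, stepFn ξ y * f y = ∫ y in (0 : ℝ)..ξ, f y := by
  have h2 : (fun y => stepFn ξ y * f y) = (Iio ξ).indicator f := by
    funext y
    simp [stepFn, indicator]
  rw [h2, intervalIntegral.integral_of_le (h0.trans h1), intervalIntegral.integral_of_le h0,
    setIntegral_indicator measurableSet_Iio, integral_Ioc_eq_integral_Ioo (y := ξ)]
  congr 2
  ext y
  constructor
  · exact fun h => ⟨h.1.1, h.2⟩
  · exact fun h => ⟨⟨h.1, h.2.le.trans h1⟩, h.2⟩

namespace LTwo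

variable {ℓ : ℝ}

lemma memLp_rampFn (ξ : ℝ) : MemLp (rampFn ξ) 2 (volume.restrict (Ioo 0 ℓ)) :=
  memLp_of_continuousOn (continuous_rampFn ξ).continuousOn

lemma memLp_stepFn (ξ : ℝ) : MemLp (stepFn ξ) 2 (volume.restrict (Ioo 0 ℓ)) :=
  MemLp.of_bound (measurable_stepFn ξ).aestronglyMeasurable 1
    (Eventually.of_forall (norm_stepFn_le ξ))

variable (ℓ) in
/-- `(ξ - y)₊` as an element of `L²(0,ℓ)`. -/
def ramp (ξ : ℝ) : LTwo ℓ := (memLp_rampFn ξ).toLp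

variable (ℓ) in
/-- The indicator function of `(0,ξ)` as an element of `L²(0,ℓ)`. -/
def step (ξ : ℝ) : LTwo ℓ := (memLp_stepFn ξ).toLp

lemma coe_ramp (ξ : ℝ) : ramp ℓ ξ =ᵐ[volume.restrict (Ioo 0 ℓ)] rampFn ξ :=
  (memLp_rampFn ξ).coeFn_toLp

lemma coe_step (ξ : ℝ) : step ℓ ξ =ᵐ[volume.restrict (Ioo 0 ℓ)] stepFn ξ :=
  (memLp_stepFn ξ).coeFn_toLp

lemma inner_step (hℓ : 0 ≤ ℓ) {ξ : ℝ} (h0 : 0 ≤ ξ) (h1 : ξ ≤ ℓ) {p : LTwo ℓ} {F : ℝ → ℂ}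
    (hF : p =ᵐ[volume.restrict (Ioo 0 ℓ)] F) :
    inner ℂ (step ℓ ξ) p = ∫ y in (0 : ℝ)..ξ, F y := by
  rw [inner_eq_of_ae hℓ (coe_step ξ) hF]
  simp only [conj_stepFn]
  exact integral_stepFn_mul h0 h1 F

/-- Integration by parts against the ramp; the boundary terms vanish because the ramp is zero at `ℓ`
and the primitive is zero at `0`. For `p = u_xx` the result is the point value `u(ξ)`. -/
lemma inner_ramp (hℓ : 0 ≤ ℓ) {ξ : ℝ} (h0 : 0 ≤ ξ) (h1 : ξ ≤ ℓ) (p : LTwo ℓ) :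
    inner ℂ (ramp ℓ ξ) p = ∫ y in (0 : ℝ)..ξ, ∫ t in (0 : ℝ)..y, p t := by
  rw [inner_eq_of_ae hℓ (coe_ramp ξ) (ae_eq_refl _)]
  simp only [conj_rampFn]
  have h := (isPrimitive_rampFn ξ 0 ℓ).integral_mul_add (isPrimitive hℓ p) hℓ
  have e : rampFn ξ ℓ = 0 := by
    simp only [rampFn]
    rw [max_eq_right (by linarith), Complex.ofReal_zero]
  rw [e, intervalIntegral.integral_same] at h
  simp only [mul_assoc] at h
  rw [intervalIntegral.integral_const_mul, integral_stepFn_mul h0 h1] at h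
  linear_combination h

/-! ### Weak derivatives with vanishing end values -/

/-- The absolutely continuous representative starts from `0`, so it is the primitive of `g`; its
vanishing at `ℓ` says that `g` is orthogonal to the constants. -/
lemma eq_volterra (hℓ : 0 < ℓ) {f g : LTwo ℓ} (h : HasWeakDeriv (Ioo 0 ℓ) f g)
    (hf : VanishesAtEnds f) : f = volterra hℓ.le g ∧ inner ℂ (step ℓ ℓ) g = 0 := by
  obtain ⟨F, hF, he⟩ := h.exists_isPrimitive hℓ (integrableOn f subset_rfl)
    (integrableOn g subset_rfl)
  have h0 : F 0 = 0 :=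
    tendsto_nhds_unique (hF.hasRightTrace hℓ he (left_mem_Ico.2 hℓ)) hf.1
  have h1 : F ℓ = 0 :=
    tendsto_nhds_unique (hF.hasLeftTrace hℓ he (right_mem_Ioc.2 hℓ)) hf.2
  constructor
  · refine Lp.ext ?_
    filter_upwards [he, coe_volterra hℓ.le g, ae_restrict_mem measurableSet_Ioo] with x e1 e2 hx
    rw [e1, e2, hF.eq_add_integral x (Ioo_subset_Icc_self hx), h0, zero_add]
  · rw [inner_step hℓ.le hℓ.le le_rfl (ae_eq_refl _)]
    have := hF.eq_add_integral ℓ (right_mem_Icc.2 hℓ.le)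
    rwa [h0, h1, zero_add, eq_comm] at this

lemma hasWeakDeriv_volterra (hℓ : 0 ≤ ℓ) (g : LTwo ℓ) :
    HasWeakDeriv (Ioo 0 ℓ) (volterra hℓ g) g :=
  ((isPrimitive hℓ g).hasWeakDeriv hℓ).congr (coe_volterra hℓ g).symm (ae_eq_refl _)

lemma vanishesAtEnds_volterra (hℓ : 0 < ℓ) {g : LTwo ℓ} (hg : inner ℂ (step ℓ ℓ) g = 0) :
    VanishesAtEnds (volterra hℓ.le g) := by
  have h1 := (isPrimitive hℓ.le g).hasRightTrace hℓ (coe_volterra hℓ.le g) (left_mem_Ico.2 hℓ)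
  have h2 := (isPrimitive hℓ.le g).hasLeftTrace hℓ (coe_volterra hℓ.le g) (right_mem_Ioc.2 hℓ)
  rw [inner_step hℓ.le hℓ.le le_rfl (ae_eq_refl _)] at hg
  rw [hg] at h2
  rw [intervalIntegral.integral_same] at h1
  exact ⟨h1, h2⟩

lemma inner_step_volterra (hℓ : 0 ≤ ℓ) {ξ : ℝ} (h0 : 0 ≤ ξ) (h1 : ξ ≤ ℓ) (p : LTwo ℓ) :
    inner ℂ (step ℓ ξ) (volterra hℓ p) = inner ℂ (ramp ℓ ξ) p := by
  rw [inner_step hℓ h0 h1 (coe_volterra hℓ p), inner_ramp hℓ h0 h1]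

/-- Double integration by parts for functions with vanishing end values. -/
lemma inner_volterra_volterra (hℓ : 0 ≤ ℓ) {p : LTwo ℓ} (h1 : inner ℂ (step ℓ ℓ) p = 0)
    (h2 : inner ℂ (ramp ℓ ℓ) p = 0) (h : LTwo ℓ) :
    inner ℂ p (volterra hℓ (volterra hℓ h)) = inner ℂ (volterra hℓ (volterra hℓ p)) h := by
  -- A single integration by parts: the primitives vanish at `0`, and that of `p` also at `ℓ` since
  -- `p` has mean zero. The second use applies to the primitive of `p`, whose mean is zero by `h2`.
  have aux : ∀ p h : LTwo ℓ, inner ℂ (step ℓ ℓ) p = 0 →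
      inner ℂ p (volterra hℓ h) = -inner ℂ (volterra hℓ p) h := by
    intro p h h1
    rw [inner_eq_of_ae hℓ (ae_eq_refl _) (coe_volterra hℓ h),
      inner_eq_of_ae hℓ (coe_volterra hℓ p) (ae_eq_refl _)]
    have := (isPrimitive hℓ p).star.integral_mul_add (isPrimitive hℓ h) hℓ
    rw [inner_step hℓ hℓ le_rfl (ae_eq_refl _)] at h1
    rw [h1, intervalIntegral.integral_same, map_zero, zero_mul, zero_mul, sub_zero] at this
    exact eq_neg_of_add_eq_zero_left this
  rw [aux p _ h1, aux _ h ?_, neg_neg]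
  rw [inner_step_volterra hℓ hℓ le_rfl, h2]

lemma re_inner_mulBdd {m : ℝ → ℝ} {C : ℝ} (hm : Measurable m) (hC : ∀ x, |m x| ≤ C) {c : ℝ}
    (hc : ∀ x, c ≤ m x) (f : LTwo ℓ) :
    c * ‖f‖ ^ 2 ≤ (inner ℂ f (mulBdd m C hm hC f)).re := by
  have hic : ∀ g : LTwo ℓ, Integrable (fun x => conj (f x) * g x) (volume.restrict (Ioo 0 ℓ)) :=
    fun g => (L2.integrable_inner (𝕜 := ℂ) f g).congr
      (Eventually.of_forall fun x => by simp [mul_comm])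
  have e1 : ∀ g : LTwo ℓ, (inner ℂ f g).re = ∫ x in Ioo 0 ℓ, (conj (f x) * g x).re := fun g => by
    rw [inner_eq]
    exact (integral_re (𝕜 := ℂ) (hic g)).symm
  have hi : ∀ g : LTwo ℓ, Integrable (fun x => (conj (f x) * g x).re)
      (volume.restrict (Ioo 0 ℓ)) := fun g => (hic g).re
  have e2 : ‖f‖ ^ 2 = ∫ x in Ioo 0 ℓ, (conj (f x) * f x).re := by
    rw [← e1]
    exact (inner_self_eq_norm_sq (𝕜 := ℂ) f).symm
  rw [e2, e1, ← integral_const_mul]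
  refine integral_mono_ae ((hi f).const_mul c) (hi _) ?_
  filter_upwards [coe_mulBdd m C hm hC f] with x hx
  have e3 : (conj (f x) * f x).re = ‖f x‖ ^ 2 := by
    rw [Complex.conj_mul', ← Complex.ofReal_pow, Complex.ofReal_re]
  rw [hx, mul_left_comm, Complex.re_ofReal_mul, e3]
  exact mul_le_mul_of_nonneg_right (hc x) (sq_nonneg _)

end LTwo

/-! ### Completeness of the phase space -/

namespace Beam

variable {P : Beam}

namespace H20

lemma dx_eq (u : P.H20) : u.dx = LTwo.volterra P.ℓ_pos.le u.dxx :=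
  (LTwo.eq_volterra P.ℓ_pos u.2.2.1 u.2.2.2.2).1

lemma fn_eq (u : P.H20) : u.fn = LTwo.volterra P.ℓ_pos.le (LTwo.volterra P.ℓ_pos.le u.dxx) := by
  rw [← dx_eq]
  exact (LTwo.eq_volterra P.ℓ_pos u.2.1 u.2.2.2.1).1

/-- This and `inner_ramp_dxx` encode the clamped conditions at the right end: `u_xx` is orthogonal
to `1` and to `ℓ - y`, that is, to all affine functions. -/
lemma inner_step_dxx (u : P.H20) : inner ℂ (LTwo.step P.ℓ P.ℓ) u.dxx = 0 :=
  (LTwo.eq_volterra P.ℓ_pos u.2.2.1 u.2.2.2.2).2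

lemma inner_ramp_dxx (u : P.H20) : inner ℂ (LTwo.ramp P.ℓ P.ℓ) u.dxx = 0 := by
  rw [← LTwo.inner_step_volterra P.ℓ_pos.le P.ℓ_pos.le le_rfl, ← dx_eq]
  exact (LTwo.eq_volterra P.ℓ_pos u.2.1 u.2.2.2.1).2

/-- A function orthogonal to the affine functions is the second derivative of an element of
`H₀²(0,ℓ)`. -/
lemma exists_dxx_eq {p : LTwo P.ℓ} (h1 : inner ℂ (LTwo.step P.ℓ P.ℓ) p = 0)
    (h2 : inner ℂ (LTwo.ramp P.ℓ P.ℓ) p = 0) : ∃ u : P.H20, u.dxx = p := by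
  refine ⟨⟨(LTwo.volterra P.ℓ_pos.le (LTwo.volterra P.ℓ_pos.le p), LTwo.volterra P.ℓ_pos.le p, p),
    LTwo.hasWeakDeriv_volterra _ _, LTwo.hasWeakDeriv_volterra _ _,
    LTwo.vanishesAtEnds_volterra P.ℓ_pos ?_, LTwo.vanishesAtEnds_volterra P.ℓ_pos h1⟩, rfl⟩
  rw [LTwo.inner_step_volterra P.ℓ_pos.le P.ℓ_pos.le le_rfl, h2]

end H20

lemma abs_α_le (x : ℝ) : |P.α x| ≤ P.α₁ + P.α₂ := by
  rw [abs_of_pos (α_pos x)]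
  exact α_le x

lemma min_le_α (x : ℝ) : min P.α₁ P.α₂ ≤ P.α x := by
  unfold α
  split_ifs
  exacts [min_le_right _ _, min_le_left _ _]

variable (P) in
/-- Multiplication by the stiffness. -/
def stiffness : LTwo P.ℓ →L[ℂ] LTwo P.ℓ := LTwo.mulBdd P.α (P.α₁ + P.α₂) measurable_α abs_α_le

lemma coe_stiffness (f : LTwo P.ℓ) :
    P.stiffness f =ᵐ[volume.restrict (Ioo 0 P.ℓ)] fun x => (P.α x : ℂ) * f x :=
  LTwo.coe_mulBdd _ _ _ _ _

lemma re_inner_stiffness (f : LTwo P.ℓ) :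
    min P.α₁ P.α₂ * ‖f‖ ^ 2 ≤ (inner ℂ f (P.stiffness f)).re :=
  LTwo.re_inner_mulBdd _ _ min_le_α f

lemma inner_phase (U V : P.Phase) :
    inner ℂ U V = inner ℂ U.vel V.vel + inner ℂ U.disp.dxx (P.stiffness V.disp.dxx) := by
  rw [LTwo.inner_eq, LTwo.inner_eq, ← integral_add (integrable_conj_mul _ _)
    (integrable_conj_mul _ _)]
  change ∫ x in Ioo 0 P.ℓ, (conj (U.vel x) * V.vel x +
    (P.α x : ℂ) * (conj (U.disp.dxx x) * V.disp.dxx x)) = _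
  refine integral_congr_ae ?_
  filter_upwards [coe_stiffness V.disp.dxx] with x hx
  rw [hx]
  ring

lemma norm_sq_phase (U : P.Phase) :
    ‖U‖ ^ 2 = ‖U.vel‖ ^ 2 + (inner ℂ U.disp.dxx (P.stiffness U.disp.dxx)).re := by
  have h1 : ‖U‖ ^ 2 = (inner ℂ U U).re := (inner_self_eq_norm_sq (𝕜 := ℂ) U).symm
  have h2 : ‖U.vel‖ ^ 2 = (inner ℂ U.vel U.vel).re := (inner_self_eq_norm_sq (𝕜 := ℂ) U.vel).symm
  rw [h1, h2, inner_phase, Complex.add_re]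

lemma min_α_pos : 0 < min P.α₁ P.α₂ := lt_min P.α₁_pos P.α₂_pos

variable (P) in
/-- The velocity as a bounded operator on the phase space. -/
def velL : P.Phase →L[ℂ] LTwo P.ℓ :=
  LinearMap.mkContinuous
    { toFun := Phase.vel
      map_add' := Phase.vel_add
      map_smul' := Phase.vel_smul } 1 (fun U => by
    have h1 := norm_sq_phase U
    have h2 := re_inner_stiffness U.disp.dxx
    have h3 : 0 ≤ min P.α₁ P.α₂ * ‖U.disp.dxx‖ ^ 2 := mul_nonneg min_α_pos.le (sq_nonneg _)
    rw [one_mul]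
    refine abs_le_of_sq_le_sq' ?_ (norm_nonneg _) |>.2
    rw [h1]
    exact le_add_of_nonneg_right (h3.trans h2))

variable (P) in
/-- The curvature as a bounded operator on the phase space. -/
def curvL : P.Phase →L[ℂ] LTwo P.ℓ :=
  LinearMap.mkContinuous
    { toFun := fun U => U.disp.dxx
      map_add' := fun _ _ => rfl
      map_smul' := fun _ _ => rfl } (Real.sqrt (min P.α₁ P.α₂))⁻¹ (fun U => by
    have h1 := norm_sq_phase U
    have h2 := re_inner_stiffness U.disp.dxx
    have hs : 0 < Real.sqrt (min P.α₁ P.α₂) := Real.sqrt_pos.2 min_α_pos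
    rw [inv_mul_eq_div, le_div_iff₀' hs]
    refine abs_le_of_sq_le_sq' ?_ (norm_nonneg _) |>.2
    rw [h1, mul_pow, Real.sq_sqrt min_α_pos.le]
    exact h2.trans (le_add_of_nonneg_left (sq_nonneg _)))

/-- Velocities and curvatures of a Cauchy sequence converge in `L²`. Orthogonality to the affine
functions is a closed condition, so the limiting curvature is again the second derivative of an
element of `H₀²(0,ℓ)`. -/
instance completeSpace_phase : CompleteSpace P.Phase := by
  refine Metric.complete_of_cauchySeq_tendsto fun U hU => ?_
  obtain ⟨a, ha⟩ := cauchySeq_tendsto_of_complete (P.velL.uniformContinuous.comp_cauchySeq hU)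
  obtain ⟨p, hp⟩ := cauchySeq_tendsto_of_complete (P.curvL.uniformContinuous.comp_cauchySeq hU)
  have hlim : ∀ e : LTwo P.ℓ, (∀ u : P.H20, inner ℂ e u.dxx = 0) → inner ℂ e p = 0 := by
    intro e he
    have h1 : Tendsto (fun n => inner ℂ e (P.curvL (U n))) atTop (𝓝 (inner ℂ e p)) :=
      Tendsto.inner tendsto_const_nhds hp
    refine tendsto_nhds_unique h1 (tendsto_const_nhds.congr fun n => (he _).symm)
  obtain ⟨u, hu⟩ := H20.exists_dxx_eq (hlim _ H20.inner_step_dxx) (hlim _ H20.inner_ramp_dxx)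
  let V : P.Phase := ((u, a) : P.H20 × LTwo P.ℓ)
  have hV1 : P.velL V = a := rfl
  have hV2 : P.curvL V = p := hu
  refine ⟨V, ?_⟩
  rw [tendsto_iff_norm_sub_tendsto_zero]
  have h1 : Tendsto (fun n => P.velL (U n - V)) atTop (𝓝 0) := by
    have := ha.sub_const a
    simp only [map_sub, hV1]
    simpa using this
  have h2 : Tendsto (fun n => P.curvL (U n - V)) atTop (𝓝 0) := by
    have := hp.sub_const p
    simp only [map_sub, hV2]
    simpa using this
  have h3 : Tendsto (fun n => ‖U n - V‖ ^ 2) atTop (𝓝 0) := by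
    have h4 := (h1.norm.pow 2).add ((Complex.continuous_re.tendsto _).comp
      (Tendsto.inner (𝕜 := ℂ) h2 ((P.stiffness.continuous.tendsto _).comp h2)))
    simp only [norm_zero, map_zero, inner_zero_left, Complex.zero_re, add_zero] at h4
    refine (h4.congr fun n => (norm_sq_phase (U n - V)).symm).trans ?_
    simp
  have h5 := (Real.continuous_sqrt.tendsto _).comp h3
  simpa [Function.comp_def, Real.sqrt_sq (norm_nonneg _)] using h5

end Beam

/-! ### Green's formula and dissipativity -/

/-- Green's formula on an interval, together with the existence of the traces. -/
lemma exists_traces_green {a b : ℝ} (hab : a < b) {m n L w₀ w₁ w₂ : ℝ → ℂ}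
    (hm : HasWeakDeriv (Ioo a b) m n) (hn : HasWeakDeriv (Ioo a b) n L)
    (him : IntegrableOn m (Ioo a b)) (hin : IntegrableOn n (Ioo a b))
    (hiL : IntegrableOn L (Ioo a b)) (hw₀ : IsPrimitive w₀ w₁ a b) (hw₁ : IsPrimitive w₁ w₂ a b) :
    ∃ ma na mb nb, HasRightTrace m a ma ∧ HasRightTrace n a na ∧ HasLeftTrace m b mb ∧
      HasLeftTrace n b nb ∧ (∫ x in a..b, L x * w₀ x) - ∫ x in a..b, m x * w₂ x =
        (nb * w₀ b - mb * w₁ b) - (na * w₀ a - ma * w₁ a) := by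
  obtain ⟨Q, hQ, heQ⟩ := hn.exists_isPrimitive hab hin hiL
  obtain ⟨M, hM, heM⟩ := hm.exists_isPrimitive hab him hin
  -- Replacing `n` by its continuous representative `Q` allows two integrations by parts with
  -- matching middle terms: `(Q w₀ - M w₁)' = L w₀ - M w₂`.
  have hM' := hM.congr_ae hab.le heQ
  refine ⟨M a, Q a, M b, Q b, hM.hasRightTrace hab heM (left_mem_Ico.2 hab),
    hQ.hasRightTrace hab heQ (left_mem_Ico.2 hab), hM.hasLeftTrace hab heM (right_mem_Ioc.2 hab),
    hQ.hasLeftTrace hab heQ (right_mem_Ioc.2 hab), ?_⟩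
  have h1 := hQ.integral_mul_add hw₀ hab.le
  have h2 := hM'.integral_mul_add hw₁ hab.le
  have h3 : ∫ x in a..b, m x * w₂ x = ∫ x in a..b, M x * w₂ x := by
    refine intervalIntegral.integral_congr_ae_restrict ?_
    rw [uIoc_of_le hab.le, ← restrict_Ioo_eq_restrict_Ioc]
    filter_upwards [heM] with x hx
    rw [hx]
  rw [h3]
  linear_combination h1 - h2

lemma HasJump.sub_eq {f : ℝ → ℂ} {x : ℝ} {d l r : ℂ} (h : HasJump f x d)
    (hl : HasLeftTrace f x l) (hr : HasRightTrace f x r) : r - l = d := by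
  obtain ⟨l', r', hl', hr', hd⟩ := h
  rw [tendsto_nhds_unique hl hl', tendsto_nhds_unique hr hr', hd]

instance neBot_nhds_inf_ae {x : ℝ} : (𝓝 x ⊓ ae (volume : Measure ℝ)).NeBot :=
  (neBot_nhdsGT_inf_ae (x := x)).mono (inf_le_inf_right _ nhdsWithin_le_nhds)

namespace Beam

variable {P : Beam}

namespace H20

/-- The continuous representative of `u_x`. -/
def slope (u : P.H20) (x : ℝ) : ℂ := ∫ t in (0 : ℝ)..x, u.dxx t

/-- The continuously differentiable representative of `u`. -/
def value (u : P.H20) (x : ℝ) : ℂ := ∫ t in (0 : ℝ)..x, u.slope t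

lemma isPrimitive_slope (u : P.H20) : IsPrimitive u.slope u.dxx 0 P.ℓ :=
  LTwo.isPrimitive P.ℓ_pos.le u.dxx

lemma isPrimitive_value (u : P.H20) : IsPrimitive u.value u.slope 0 P.ℓ := by
  have h := u.isPrimitive_slope.continuousOn P.ℓ_pos.le
  rw [← uIcc_of_le P.ℓ_pos.le] at h
  exact .integral h.intervalIntegrable

lemma coe_dx (u : P.H20) : u.dx =ᵐ[volume.restrict (Ioo 0 P.ℓ)] u.slope := by
  rw [u.dx_eq]
  exact LTwo.coe_volterra _ _

lemma coe_fn (u : P.H20) : u.fn =ᵐ[volume.restrict (Ioo 0 P.ℓ)] u.value := by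
  have h1 : u.fn = LTwo.volterra P.ℓ_pos.le u.dx := by rw [u.fn_eq, ← u.dx_eq]
  have h2 := (LTwo.isPrimitive P.ℓ_pos.le u.dx).congr_ae P.ℓ_pos.le u.coe_dx
  rw [h1]
  filter_upwards [LTwo.coe_volterra P.ℓ_pos.le u.dx, ae_restrict_mem measurableSet_Ioo]
    with x hx hx'
  rw [hx, h2.eq_add_integral x (Ioo_subset_Icc_self hx'), intervalIntegral.integral_same, zero_add,
    value]

lemma inner_step (u : P.H20) {ξ : ℝ} (h0 : 0 ≤ ξ) (h1 : ξ ≤ P.ℓ) :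
    inner ℂ (LTwo.step P.ℓ ξ) u.dxx = u.slope ξ :=
  LTwo.inner_step P.ℓ_pos.le h0 h1 (ae_eq_refl _)

lemma inner_ramp (u : P.H20) {ξ : ℝ} (h0 : 0 ≤ ξ) (h1 : ξ ≤ P.ℓ) :
    inner ℂ (LTwo.ramp P.ℓ ξ) u.dxx = u.value ξ :=
  LTwo.inner_ramp P.ℓ_pos.le h0 h1 u.dxx

lemma slope_zero (u : P.H20) : u.slope 0 = 0 := intervalIntegral.integral_same

lemma value_zero (u : P.H20) : u.value 0 = 0 := intervalIntegral.integral_same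

lemma slope_ℓ (u : P.H20) : u.slope P.ℓ = 0 := by
  rw [← u.inner_step P.ℓ_pos.le le_rfl, u.inner_step_dxx]

lemma value_ℓ (u : P.H20) : u.value P.ℓ = 0 := by
  rw [← u.inner_ramp P.ℓ_pos.le le_rfl, u.inner_ramp_dxx]

lemma hasPointValue_fn (u : P.H20) {x : ℝ} (hx : x ∈ Ioo 0 P.ℓ) :
    HasPointValue u.fn x (u.value x) :=
  u.isPrimitive_value.hasPointValue P.ℓ_pos u.coe_fn hx

lemma hasPointValue_dx (u : P.H20) {x : ℝ} (hx : x ∈ Ioo 0 P.ℓ) :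
    HasPointValue u.dx x (u.slope x) :=
  u.isPrimitive_slope.hasPointValue P.ℓ_pos u.coe_dx hx

end H20

lemma measurable_κ : Measurable P.κ :=
  Measurable.ite measurableSet_Ioo measurable_const measurable_const

lemma κ_nonneg (x : ℝ) : 0 ≤ P.κ x := by
  unfold κ
  split_ifs
  exacts [P.α₀_pos.le, le_rfl]

lemma abs_κ_le (x : ℝ) : |P.κ x| ≤ P.α₀ := by
  rw [abs_of_nonneg (κ_nonneg x)]
  unfold κ
  split_ifs
  exacts [le_rfl, P.α₀_pos.le]

variable (P) in
/-- Multiplication by the viscosity. -/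
def viscosity : LTwo P.ℓ →L[ℂ] LTwo P.ℓ := LTwo.mulBdd P.κ P.α₀ measurable_κ abs_κ_le

lemma coe_viscosity (f : LTwo P.ℓ) :
    P.viscosity f =ᵐ[volume.restrict (Ioo 0 P.ℓ)] fun x => (P.κ x : ℂ) * f x :=
  LTwo.coe_mulBdd _ _ _ _ _

lemma re_inner_viscosity (f : LTwo P.ℓ) : 0 ≤ (inner ℂ f (P.viscosity f)).re := by
  have := LTwo.re_inner_mulBdd (measurable_κ (P := P)) abs_κ_le κ_nonneg f
  rwa [zero_mul] at this

lemma coe_moment (u v : P.H20) :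
    (P.stiffness u.dxx + P.viscosity v.dxx : LTwo P.ℓ) =ᵐ[volume.restrict (Ioo 0 P.ℓ)]
      moment u v := by
  filter_upwards [LTwo.coe_add (P.stiffness u.dxx) (P.viscosity v.dxx), coe_stiffness u.dxx,
    coe_viscosity v.dxx] with x h1 h2 h3
  rw [h1, h2, h3]
  rfl

lemma ξ₁_mem : P.ξ₁ ∈ Ioo 0 P.ℓ := mem_of_mem_nhds nhds_ξ₁

lemma ℓ₀_mem : P.ℓ₀ ∈ Ioo 0 P.ℓ := mem_of_mem_nhds nhds_ℓ₀

lemma ξ₂_mem : P.ξ₂ ∈ Ioo 0 P.ℓ := mem_of_mem_nhds nhds_ξ₂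

lemma ℓ₁_mem : P.ℓ₁ ∈ Ioo 0 P.ℓ := mem_of_mem_nhds nhds_ℓ₁

lemma integral_eq_sum {f : ℝ → ℂ} (hf : IntervalIntegrable f volume 0 P.ℓ) :
    ∫ x in (0 : ℝ)..P.ℓ, f x = (∫ x in (0 : ℝ)..P.ξ₁, f x) + (∫ x in P.ξ₁..P.ℓ₀, f x) +
      (∫ x in P.ℓ₀..P.ξ₂, f x) + (∫ x in P.ξ₂..P.ℓ₁, f x) + ∫ x in P.ℓ₁..P.ℓ, f x := by
  have hi : ∀ {a b}, a ∈ Icc 0 P.ℓ → b ∈ Icc 0 P.ℓ → IntervalIntegrable f volume a b := by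
    intro a b ha hb
    refine hf.mono_set (uIcc_subset_uIcc ?_ ?_)
    · rwa [uIcc_of_le P.ℓ_pos.le]
    · rwa [uIcc_of_le P.ℓ_pos.le]
  have m0 : (0 : ℝ) ∈ Icc 0 P.ℓ := left_mem_Icc.2 P.ℓ_pos.le
  have m1 := Ioo_subset_Icc_self (ξ₁_mem (P := P))
  have m2 := Ioo_subset_Icc_self (ℓ₀_mem (P := P))
  have m3 := Ioo_subset_Icc_self (ξ₂_mem (P := P))
  have m4 := Ioo_subset_Icc_self (ℓ₁_mem (P := P))
  have m5 : P.ℓ ∈ Icc 0 P.ℓ := right_mem_Icc.2 P.ℓ_pos.le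
  rw [intervalIntegral.integral_add_adjacent_intervals (hi m0 m1) (hi m1 m2),
    intervalIntegral.integral_add_adjacent_intervals (hi m0 m2) (hi m2 m3),
    intervalIntegral.integral_add_adjacent_intervals (hi m0 m3) (hi m3 m4),
    intervalIntegral.integral_add_adjacent_intervals (hi m0 m4) (hi m4 m5)]

/-- To the left of `ℓ₀` the moment is `α₁ u_xx`, so continuity of the curvature at `ξ₁` is
continuity of the moment. -/
lemma InDomain.hasJump_moment_ξ₁ {U : P.Phase} {v : P.H20} {N L : LTwo P.ℓ}
    (h : InDomain U v N L) : HasJump (moment U.disp v) P.ξ₁ 0 := by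
  have h1 := h.curvature_ξ₁.const_mul (P.α₁ : ℂ)
  rw [mul_zero] at h1
  refine h1.congr (Ω := Iio P.ℓ₀) (Iio_mem_nhds P.ξ₁_lt) ?_
  refine (ae_restrict_iff' measurableSet_Iio).2 (Eventually.of_forall fun x hx => ?_)
  have hx' : x ∉ Ioo P.ℓ₀ P.ℓ₁ := fun h => absurd h.1 (not_lt.2 (le_of_lt hx))
  simp [moment, α, κ, hx']

/-- Green's formula on the whole beam. -/
lemma InDomain.green {U : P.Phase} {v : P.H20} {N L : LTwo P.ℓ} (h : InDomain U v N L) :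
    inner ℂ v.fn L = inner ℂ v.dxx (P.stiffness U.disp.dxx + P.viscosity v.dxx) +
      ((P.γ₁ * ‖v.value P.ξ₁‖ ^ 2 + P.γ₂ * ‖v.value P.ξ₂‖ ^ 2 + P.γ₃ * ‖v.slope P.ξ₂‖ ^ 2 : ℝ) :
        ℂ) := by
  set m := moment U.disp v with hmdef
  set w₀ : ℝ → ℂ := fun x => conj (v.value x) with hw₀
  set w₁ : ℝ → ℂ := fun x => conj (v.slope x) with hw₁
  set w₂ : ℝ → ℂ := fun x => conj (v.dxx x) with hw₂
  have p₀ : IsPrimitive w₀ w₁ 0 P.ℓ := v.isPrimitive_value.star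
  have p₁ : IsPrimitive w₁ w₂ 0 P.ℓ := v.isPrimitive_slope.star
  have e1 : inner ℂ v.fn L = ∫ x in (0 : ℝ)..P.ℓ, L x * w₀ x := by
    rw [LTwo.inner_eq_of_ae P.ℓ_pos.le v.coe_fn (ae_eq_refl _)]
    simp only [mul_comm, hw₀]
  have e2 : inner ℂ v.dxx (P.stiffness U.disp.dxx + P.viscosity v.dxx) =
      ∫ x in (0 : ℝ)..P.ℓ, m x * w₂ x := by
    rw [LTwo.inner_eq_of_ae P.ℓ_pos.le (ae_eq_refl _) (coe_moment _ _)]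
    simp only [mul_comm, hw₂, hmdef]
  have i1 : IntervalIntegrable (fun x => L x * w₀ x) volume 0 P.ℓ := by
    have hc := p₀.continuousOn P.ℓ_pos.le
    rw [← uIcc_of_le P.ℓ_pos.le] at hc
    exact (LTwo.intervalIntegrable P.ℓ_pos.le L).mul_continuousOn hc
  have i2 : IntervalIntegrable (fun x => m x * w₂ x) volume 0 P.ℓ := by
    rw [intervalIntegrable_iff_integrableOn_Ioo_of_le P.ℓ_pos.le]
    refine (integrable_conj_mul v.dxx (P.stiffness U.disp.dxx + P.viscosity v.dxx)).congr ?_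
    filter_upwards [coe_moment U.disp v] with x hx
    rw [hx, mul_comm]
  have key : ∀ a b, a < b → 0 ≤ a → b ≤ P.ℓ → Ioo a b ⊆ P.I → _ := fun a b hab ha hb hs =>
    exists_traces_green hab (h.weakDeriv_moment.mono hs) (h.weakDeriv_shear.mono hs)
      ((integrableOn_moment _ _).mono_set hs) (N.integrableOn (hs.trans I_subset))
      (L.integrableOn (hs.trans I_subset)) (p₀.mono ha hab.le hb) (p₁.mono ha hab.le hb)
  obtain ⟨m0, n0, m1, n1, -, -, tm1, tn1, g1⟩ := key 0 P.ξ₁ P.ξ₁_pos le_rfl ξ₁_mem.2.le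
    fun x hx => Or.inl (Or.inl (Or.inl (Or.inl hx)))
  obtain ⟨m1', n1', m2, n2, tm1', tn1', tm2, tn2, g2⟩ := key P.ξ₁ P.ℓ₀ P.ξ₁_lt ξ₁_mem.1.le
    ℓ₀_mem.2.le fun x hx => Or.inl (Or.inl (Or.inl (Or.inr hx)))
  obtain ⟨m2', n2', m3, n3, tm2', tn2', tm3, tn3, g3⟩ := key P.ℓ₀ P.ξ₂ P.ℓ₀_lt ℓ₀_mem.1.le
    ξ₂_mem.2.le fun x hx => Or.inl (Or.inl (Or.inr hx))
  obtain ⟨m3', n3', m4, n4, tm3', tn3', tm4, tn4, g4⟩ := key P.ξ₂ P.ℓ₁ P.ξ₂_lt ξ₂_mem.1.le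
    ℓ₁_mem.2.le fun x hx => Or.inl (Or.inr hx)
  obtain ⟨m4', n4', m5, n5, tm4', tn4', -, -, g5⟩ := key P.ℓ₁ P.ℓ P.ℓ₁_lt ℓ₁_mem.1.le
    le_rfl fun x hx => Or.inr hx
  have jm1 := h.hasJump_moment_ξ₁.sub_eq tm1 tm1'
  have jm2 := h.moment_ℓ₀.sub_eq tm2 tm2'
  have jn2 := h.shear_ℓ₀.sub_eq tn2 tn2'
  have jm4 := h.moment_ℓ₁.sub_eq tm4 tm4'
  have jn4 := h.shear_ℓ₁.sub_eq tn4 tn4'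
  have jn1 : n1' - n1 = -P.γ₁ * v.value P.ξ₁ := by
    obtain ⟨c, hc, hj⟩ := h.shear_ξ₁
    rw [tendsto_nhds_unique (v.hasPointValue_fn ξ₁_mem) hc]
    exact hj.sub_eq tn1 tn1'
  have jn3 : n3' - n3 = -P.γ₂ * v.value P.ξ₂ := by
    obtain ⟨c, hc, hj⟩ := h.shear_ξ₂
    rw [tendsto_nhds_unique (v.hasPointValue_fn ξ₂_mem) hc]
    exact hj.sub_eq tn3 tn3'
  have jm3 : m3' - m3 = P.γ₃ * v.slope P.ξ₂ := by
    obtain ⟨c, hc, hj⟩ := h.moment_ξ₂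
    rw [tendsto_nhds_unique (v.hasPointValue_dx ξ₂_mem) hc]
    exact hj.sub_eq tm3 tm3'
  have z1 : w₀ 0 = 0 := by simp [hw₀, v.value_zero]
  have z2 : w₁ 0 = 0 := by simp [hw₁, v.slope_zero]
  have z3 : w₀ P.ℓ = 0 := by simp [hw₀, v.value_ℓ]
  have z4 : w₁ P.ℓ = 0 := by simp [hw₁, v.slope_ℓ]
  have s1 : v.value P.ξ₁ * w₀ P.ξ₁ = (‖v.value P.ξ₁‖ : ℂ) ^ 2 := Complex.mul_conj' _
  have s2 : v.value P.ξ₂ * w₀ P.ξ₂ = (‖v.value P.ξ₂‖ : ℂ) ^ 2 := Complex.mul_conj' _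
  have s3 : v.slope P.ξ₂ * w₁ P.ξ₂ = (‖v.slope P.ξ₂‖ : ℂ) ^ 2 := Complex.mul_conj' _
  rw [e1, e2, integral_eq_sum i1, integral_eq_sum i2]
  push_cast
  rw [z1, z2] at g1
  rw [z3, z4] at g5
  -- After summation each interface `x` contributes `-⟦M_x⟧ w₀(x) + ⟦M⟧ w₁(x)`; the jump conditions
  -- turn these into zero or `γ` times a squared modulus.
  linear_combination g1 + g2 + g3 + g4 + g5 - w₀ P.ξ₁ * jn1 + w₁ P.ξ₁ * jm1 - w₀ P.ℓ₀ * jn2 +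
    w₁ P.ℓ₀ * jm2 - w₀ P.ξ₂ * jn3 + w₁ P.ξ₂ * jm3 - w₀ P.ℓ₁ * jn4 + w₁ P.ℓ₁ * jm4 +
    P.γ₁ * s1 + P.γ₂ * s2 + P.γ₃ * s3

/-- The operator of the beam is dissipative. -/
lemma operator_dissipative (U F : P.Phase) (h : (U, F) ∈ P.operator.graph) :
    (inner ℂ F U).re ≤ 0 := by
  rw [operator_graph] at h
  obtain ⟨N, L, hd, hL⟩ := h
  simp only at hd hL
  have hg := congrArg Complex.re hd.green
  rw [inner_add_right, Complex.add_re, Complex.add_re, Complex.ofReal_re] at hg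
  -- The last term is the real part of the stiffness term in Green's formula, so the two cancel;
  -- only the viscous and pointwise losses remain.
  have h1 : (inner ℂ F U).re = -(inner ℂ F.disp.fn L).re +
      (inner ℂ F.disp.dxx (P.stiffness U.disp.dxx)).re := by
    rw [inner_phase, hL, ← hd.vel_eq, inner_neg_left, Complex.add_re, Complex.neg_re]
    congr 2
    exact inner_re_symm (𝕜 := ℂ) _ _
  have h2 := re_inner_viscosity F.disp.dxx
  have h3 := mul_nonneg P.γ₁_pos.le (sq_nonneg ‖F.disp.value P.ξ₁‖)
  have h4 := mul_nonneg P.γ₂_pos.le (sq_nonneg ‖F.disp.value P.ξ₂‖)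
  have h5 := mul_nonneg P.γ₃_pos.le (sq_nonneg ‖F.disp.slope P.ξ₂‖)
  rw [h1, hg]
  linarith

end Beam

/-! ### Solvability of the resolvent equation -/

section Coercive

variable {E : Type*} [NormedAddCommGroup E] [InnerProductSpace ℂ E]

/-- The Lax–Milgram argument: coercivity gives `‖x‖ ≤ c⁻¹ ‖T x‖`, so the range is closed, and a
vector `y` orthogonal to it satisfies `⟨y, T y⟩ = 0`, hence `y = 0`. -/
lemma surjective_of_coercive [CompleteSpace E] (T : E →L[ℂ] E) {c : ℝ} (hc : 0 < c)
    (h : ∀ x, c * ‖x‖ ^ 2 ≤ (inner ℂ x (T x)).re) : Function.Surjective T := by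
  have hb : ∀ x, ‖x‖ ≤ ((⟨c⁻¹, (inv_pos.2 hc).le⟩ : ℝ≥0) : ℝ) * ‖T x‖ := by
    intro x
    change ‖x‖ ≤ c⁻¹ * ‖T x‖
    rw [inv_mul_eq_div, le_div_iff₀' hc]
    rcases eq_or_ne x 0 with rfl | hx
    · simp
    have h1 : (inner ℂ x (T x)).re ≤ ‖x‖ * ‖T x‖ := re_inner_le_norm (𝕜 := ℂ) _ _
    refine le_of_mul_le_mul_right ?_ (norm_pos_iff.2 hx)
    nlinarith [h x]
  have hcl : IsClosed (T.range : Set E) := by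
    rw [LinearMap.coe_range]
    exact (T.antilipschitz_of_bound hb).isClosed_range T.uniformContinuous
  have : CompleteSpace T.range := hcl.completeSpace_coe
  have htop : T.range = ⊤ := by
    rw [← Submodule.orthogonal_eq_bot_iff, Submodule.eq_bot_iff]
    intro y hy
    have h1 : inner ℂ (T y) y = 0 := (Submodule.mem_orthogonal _ _).1 hy _ ⟨y, rfl⟩
    have h2 := h y
    rw [inner_eq_zero_symm.1 h1, Complex.zero_re] at h2
    have h3 : ‖y‖ ^ 2 ≤ 0 := by
      by_contra h4
      push Not at h4
      exact absurd h2 (not_le.2 (mul_pos hc h4))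
    exact norm_eq_zero.1 (pow_eq_zero_iff two_ne_zero |>.1 (le_antisymm h3 (sq_nonneg _)))
  exact LinearMap.range_eq_top.1 htop

/-- Solvability of a coercive variational problem on a closed subspace. -/
lemma exists_sub_mem_orthogonal_of_coercive (K : Submodule ℂ E) [CompleteSpace K]
    (T : E →L[ℂ] E) {c : ℝ} (hc : 0 < c)
    (h : ∀ x ∈ K, c * ‖x‖ ^ 2 ≤ (inner ℂ x (T x)).re) (r : E) : ∃ p ∈ K, T p - r ∈ Kᗮ := by
  -- The compression of `T` to `K` has the same quadratic form on `K` and is therefore onto.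
  obtain ⟨p, hp⟩ := surjective_of_coercive
    (K.orthogonalProjectionOnto ∘L T ∘L K.subtypeL) hc (fun x => by
      refine (h x x.2).trans (le_of_eq ?_)
      congr 1
      exact (Submodule.inner_orthogonalProjectionOnto_eq_of_mem_left x (T x)).symm)
    (K.orthogonalProjectionOnto r)
  refine ⟨p, p.2, ?_⟩
  rw [← Submodule.orthogonalProjectionOnto_eq_zero_iff, map_sub, sub_eq_zero]
  exact hp

end Coercive

/-- Pairing with the derivative of a test function gives its value at `ξ`, which is zero as the
support lies in `Ω`. -/
lemma hasWeakDeriv_stepFn {Ω : Set ℝ} {ξ : ℝ} (hξ : ξ ∉ Ω) :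
    HasWeakDeriv Ω (stepFn ξ) (fun _ => 0) := by
  intro φ h1 h2 h3
  have hd : tsupport (deriv φ) ⊆ Ω := (tsupport_deriv_subset (𝕜 := ℝ) (f := φ)).trans h3
  rw [HasWeakDeriv.setIntegral_eq hd]
  have e : (fun x => deriv φ x • stepFn ξ x) =
      (Iio ξ).indicator fun x => ((deriv φ x : ℝ) : ℂ) := by
    funext x
    simp [stepFn, indicator]
  have h4 := h2.integral_Iic_deriv_eq (h1.of_le (by simp)) ξ
  rw [e, integral_indicator measurableSet_Iio, ← integral_Iic_eq_integral_Iio,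
    integral_complex_ofReal, h4, image_eq_zero_of_notMem_tsupport fun h => hξ (h3 h)]
  simp

lemma HasJump.of_continuousAt {f : ℝ → ℂ} {x : ℝ} (h : ContinuousAt f x) : HasJump f x 0 :=
  ⟨f x, f x, h.tendsto.mono_left (inf_le_left.trans nhdsWithin_le_nhds),
    h.tendsto.mono_left (inf_le_left.trans nhdsWithin_le_nhds), sub_self _⟩

lemma hasJump_stepFn_self (ξ : ℝ) : HasJump (stepFn ξ) ξ (-1) := by
  refine ⟨1, 0, ?_, ?_, by norm_num⟩
  · refine tendsto_const_nhds.congr' (mem_inf_of_left ?_)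
    filter_upwards [self_mem_nhdsWithin] with y hy
    exact (if_pos hy).symm
  · refine tendsto_const_nhds.congr' (mem_inf_of_left ?_)
    filter_upwards [self_mem_nhdsWithin] with y hy
    exact (if_neg (not_lt.2 (le_of_lt hy))).symm

lemma hasJump_stepFn_of_ne {ξ x : ℝ} (h : x ≠ ξ) : HasJump (stepFn ξ) x 0 := by
  refine HasJump.of_continuousAt ?_
  rcases lt_or_gt_of_ne h with h | h
  · refine (continuousAt_const (y := (1 : ℂ))).congr ?_
    filter_upwards [Iio_mem_nhds h] with y hy
    exact (if_pos hy).symm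
  · refine (continuousAt_const (y := (0 : ℂ))).congr ?_
    filter_upwards [Ioi_mem_nhds h] with y hy
    exact (if_neg (not_lt.2 (le_of_lt hy))).symm

namespace LTwo

variable {ℓ x : ℝ}

lemma hasJump_add (hx : x ∈ Ioo 0 ℓ) {f g : LTwo ℓ} {d d' : ℂ} (hf : HasJump f x d)
    (hg : HasJump g x d') : HasJump (f + g : LTwo ℓ) x (d + d') :=
  (hf.add hg).congr (Ioo_mem_nhds hx.1 hx.2) (coe_add f g).symm

lemma hasJump_smul (hx : x ∈ Ioo 0 ℓ) {f : LTwo ℓ} {d : ℂ} (k : ℂ) (hf : HasJump f x d) :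
    HasJump (k • f : LTwo ℓ) x (k * d) :=
  (hf.const_mul k).congr (Ioo_mem_nhds hx.1 hx.2) (coe_smul k f).symm

lemma hasJump_ramp (hx : x ∈ Ioo 0 ℓ) (ξ : ℝ) : HasJump (ramp ℓ ξ) x 0 :=
  (HasJump.of_continuousAt (continuous_rampFn ξ).continuousAt).congr (Ioo_mem_nhds hx.1 hx.2)
    (coe_ramp ξ).symm

lemma hasJump_step_self (hx : x ∈ Ioo 0 ℓ) : HasJump (step ℓ x) x (-1) :=
  (hasJump_stepFn_self x).congr (Ioo_mem_nhds hx.1 hx.2) (coe_step x).symm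

lemma hasJump_step_of_ne (hx : x ∈ Ioo 0 ℓ) {ξ : ℝ} (h : x ≠ ξ) : HasJump (step ℓ ξ) x 0 :=
  (hasJump_stepFn_of_ne h).congr (Ioo_mem_nhds hx.1 hx.2) (coe_step ξ).symm

lemma hasJump_volterra (hℓ : 0 ≤ ℓ) (hx : x ∈ Ioo 0 ℓ) (g : LTwo ℓ) :
    HasJump (volterra hℓ g) x 0 :=
  (HasJump.of_continuousAt (((isPrimitive hℓ g).continuousOn hℓ).continuousAt
    (Icc_mem_nhds hx.1 hx.2))).congr (Ioo_mem_nhds hx.1 hx.2) (coe_volterra hℓ g).symm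

lemma hasWeakDeriv_ramp (hℓ : 0 ≤ ℓ) (ξ : ℝ) :
    HasWeakDeriv (Ioo 0 ℓ) (ramp ℓ ξ) ((-1 : ℂ) • step ℓ ξ : LTwo ℓ) := by
  refine ((isPrimitive_rampFn ξ 0 ℓ).hasWeakDeriv hℓ).congr (coe_ramp ξ).symm ?_
  filter_upwards [coe_smul (-1) (step ℓ ξ), coe_step (ℓ := ℓ) ξ] with y h1 h2
  rw [h1, h2]

lemma hasWeakDeriv_step {Ω : Set ℝ} (hΩ : Ω ⊆ Ioo 0 ℓ) {ξ : ℝ} (hξ : ξ ∉ Ω) :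
    HasWeakDeriv Ω (step ℓ ξ) (0 : LTwo ℓ) :=
  (hasWeakDeriv_stepFn hξ).congr (ae_restrict_of_ae_restrict_of_subset hΩ (coe_step ξ).symm)
    (ae_restrict_of_ae_restrict_of_subset hΩ coe_zero.symm)

end LTwo

/-! ### Moments with prescribed jumps -/

namespace Beam

variable {P : Beam}

lemma ξ₁_notMem : P.ξ₁ ∉ P.I := by
  have := P.ξ₁_lt; have := P.ℓ₀_lt; have := P.ξ₂_lt; have := P.ℓ₁_lt
  simp only [I, mem_union, mem_Ioo]
  grind

lemma ξ₂_notMem : P.ξ₂ ∉ P.I := by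
  have := P.ξ₁_lt; have := P.ℓ₀_lt; have := P.ξ₂_lt; have := P.ℓ₁_lt
  simp only [I, mem_union, mem_Ioo]
  grind

lemma ℓ_notMem : P.ℓ ∉ P.I := fun h => lt_irrefl _ (I_subset h).2

/-- The moments whose second derivative on `I` is `h` and whose only jumps are a jump of `M` at
`ξ₂` and jumps of `M_x` at `ξ₁` and `ξ₂`. -/
def momentFamily (h : LTwo P.ℓ) (a b c₁ c₂ c₃ : ℂ) : LTwo P.ℓ :=
  -- On `(0,ℓ)` the ramp and the step at `ℓ` are `ℓ - y` and `1`: they carry the two integration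
  -- constants and create no interior jump.
  LTwo.volterra P.ℓ_pos.le (LTwo.volterra P.ℓ_pos.le h) + a • LTwo.ramp P.ℓ P.ℓ +
    b • LTwo.step P.ℓ P.ℓ + c₁ • LTwo.ramp P.ℓ P.ξ₁ + c₂ • LTwo.ramp P.ℓ P.ξ₂ +
    c₃ • LTwo.step P.ℓ P.ξ₂

/-- The derivatives of the functions in `momentFamily`. -/
def shearFamily (h : LTwo P.ℓ) (a c₁ c₂ : ℂ) : LTwo P.ℓ :=
  LTwo.volterra P.ℓ_pos.le h + (-a) • LTwo.step P.ℓ P.ℓ + (-c₁) • LTwo.step P.ℓ P.ξ₁ +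
    (-c₂) • LTwo.step P.ℓ P.ξ₂

variable (h : LTwo P.ℓ) (a b c₁ c₂ c₃ : ℂ)

lemma hasWeakDeriv_momentFamily :
    HasWeakDeriv P.I (momentFamily h a b c₁ c₂ c₃) (shearFamily h a c₁ c₂) := by
  have hr : ∀ ξ (c : ℂ), HasWeakDeriv P.I (c • LTwo.ramp P.ℓ ξ : LTwo P.ℓ)
      (c • (-1 : ℂ) • LTwo.step P.ℓ ξ : LTwo P.ℓ) := fun ξ c =>
    LTwo.weakDeriv_smul I_subset c ((LTwo.hasWeakDeriv_ramp P.ℓ_pos.le ξ).mono I_subset)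
  have hs : ∀ ξ (c : ℂ), ξ ∉ P.I → HasWeakDeriv P.I (c • LTwo.step P.ℓ ξ : LTwo P.ℓ)
      (c • (0 : LTwo P.ℓ) : LTwo P.ℓ) := fun ξ c hξ =>
    LTwo.weakDeriv_smul I_subset c (LTwo.hasWeakDeriv_step I_subset hξ)
  have key := LTwo.weakDeriv_add I_subset (LTwo.weakDeriv_add I_subset (LTwo.weakDeriv_add I_subset
    (LTwo.weakDeriv_add I_subset (LTwo.weakDeriv_add I_subset
    ((LTwo.hasWeakDeriv_volterra P.ℓ_pos.le (LTwo.volterra P.ℓ_pos.le h)).mono I_subset)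
    (hr P.ℓ a)) (hs P.ℓ b ℓ_notMem)) (hr P.ξ₁ c₁)) (hr P.ξ₂ c₂)) (hs P.ξ₂ c₃ ξ₂_notMem)
  have e : shearFamily h a c₁ c₂ = LTwo.volterra P.ℓ_pos.le h +
      a • (-1 : ℂ) • LTwo.step P.ℓ P.ℓ + b • (0 : LTwo P.ℓ) + c₁ • (-1 : ℂ) • LTwo.step P.ℓ P.ξ₁ +
      c₂ • (-1 : ℂ) • LTwo.step P.ℓ P.ξ₂ + c₃ • (0 : LTwo P.ℓ) := by
    rw [shearFamily]
    module
  rw [e]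
  exact key

lemma hasWeakDeriv_shearFamily : HasWeakDeriv P.I (shearFamily h a c₁ c₂) h := by
  have hs : ∀ ξ (c : ℂ), ξ ∉ P.I → HasWeakDeriv P.I (c • LTwo.step P.ℓ ξ : LTwo P.ℓ)
      (c • (0 : LTwo P.ℓ) : LTwo P.ℓ) := fun ξ c hξ =>
    LTwo.weakDeriv_smul I_subset c (LTwo.hasWeakDeriv_step I_subset hξ)
  have key := LTwo.weakDeriv_add I_subset (LTwo.weakDeriv_add I_subset (LTwo.weakDeriv_add I_subset
    ((LTwo.hasWeakDeriv_volterra P.ℓ_pos.le h).mono I_subset)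
    (hs P.ℓ (-a) ℓ_notMem)) (hs P.ξ₁ (-c₁) ξ₁_notMem)) (hs P.ξ₂ (-c₂) ξ₂_notMem)
  simp only [smul_zero, add_zero] at key
  exact key

lemma hasJump_momentFamily {x : ℝ} (hx : x ∈ Ioo 0 P.ℓ) {d : ℂ}
    (hd : HasJump (LTwo.step P.ℓ P.ξ₂) x d) :
    HasJump (momentFamily h a b c₁ c₂ c₃) x (c₃ * d) := by
  have key := LTwo.hasJump_add hx (LTwo.hasJump_add hx (LTwo.hasJump_add hx (LTwo.hasJump_add hx
    (LTwo.hasJump_add hx (LTwo.hasJump_volterra P.ℓ_pos.le hx (LTwo.volterra P.ℓ_pos.le h))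
    (LTwo.hasJump_smul hx a (LTwo.hasJump_ramp hx P.ℓ)))
    (LTwo.hasJump_smul hx b (LTwo.hasJump_step_of_ne hx hx.2.ne)))
    (LTwo.hasJump_smul hx c₁ (LTwo.hasJump_ramp hx P.ξ₁)))
    (LTwo.hasJump_smul hx c₂ (LTwo.hasJump_ramp hx P.ξ₂)))
    (LTwo.hasJump_smul hx c₃ hd)
  simp only [mul_zero, zero_add, add_zero] at key
  exact key

lemma hasJump_shearFamily {x : ℝ} (hx : x ∈ Ioo 0 P.ℓ) {d₁ d₂ : ℂ}
    (hd₁ : HasJump (LTwo.step P.ℓ P.ξ₁) x d₁) (hd₂ : HasJump (LTwo.step P.ℓ P.ξ₂) x d₂) :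
    HasJump (shearFamily h a c₁ c₂) x (-c₁ * d₁ + -c₂ * d₂) := by
  have key := LTwo.hasJump_add hx (LTwo.hasJump_add hx (LTwo.hasJump_add hx
    (LTwo.hasJump_volterra P.ℓ_pos.le hx h)
    (LTwo.hasJump_smul hx (-a) (LTwo.hasJump_step_of_ne hx hx.2.ne)))
    (LTwo.hasJump_smul hx (-c₁) hd₁)) (LTwo.hasJump_smul hx (-c₂) hd₂)
  simp only [mul_zero, zero_add] at key
  exact key

/-- A state whose moment belongs to `momentFamily` with the right coefficients lies in the domain
of the operator. -/
lemma inDomain_of_moment_eq {U : P.Phase} {v : P.H20} {h : LTwo P.ℓ} {a b : ℂ}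
    (hv : v.fn = U.vel)
    (hM : P.stiffness U.disp.dxx + P.viscosity v.dxx = momentFamily h a b
      (-P.γ₁ * v.value P.ξ₁) (-P.γ₂ * v.value P.ξ₂) (-P.γ₃ * v.slope P.ξ₂)) :
    InDomain U v (shearFamily h a (-P.γ₁ * v.value P.ξ₁) (-P.γ₂ * v.value P.ξ₂)) h := by
  have n1 : P.ξ₁ ≠ P.ξ₂ := (P.ξ₁_lt.trans P.ℓ₀_lt).ne
  have he := coe_moment U.disp v
  rw [hM] at he
  have hjm : ∀ {x : ℝ}, x ∈ Ioo 0 P.ℓ → ∀ {d : ℂ}, HasJump (LTwo.step P.ℓ P.ξ₂) x d →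
      HasJump (moment U.disp v) x (-P.γ₃ * v.slope P.ξ₂ * d) := fun hx d hd =>
    (hasJump_momentFamily _ _ _ _ _ _ hx hd).congr (Ioo_mem_nhds hx.1 hx.2) he
  have hjm0 : ∀ {x : ℝ}, x ∈ Ioo 0 P.ℓ → x ≠ P.ξ₂ → HasJump (moment U.disp v) x 0 := by
    intro x hx hn
    simpa using hjm hx (LTwo.hasJump_step_of_ne hx hn)
  have hjs0 : ∀ {x : ℝ}, x ∈ Ioo 0 P.ℓ → x ≠ P.ξ₁ → x ≠ P.ξ₂ →
      HasJump (shearFamily h a (-P.γ₁ * v.value P.ξ₁) (-P.γ₂ * v.value P.ξ₂)) x 0 := by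
    intro x hx hn hn'
    simpa using hasJump_shearFamily h a _ _ hx (LTwo.hasJump_step_of_ne hx hn)
      (LTwo.hasJump_step_of_ne hx hn')
  refine
    { vel_eq := hv
      weakDeriv_moment := (hasWeakDeriv_momentFamily _ _ _ _ _ _).congr
        (ae_restrict_of_ae_restrict_of_subset I_subset he) (ae_eq_refl _)
      weakDeriv_shear := hasWeakDeriv_shearFamily _ _ _ _
      moment_ℓ₀ := hjm0 ℓ₀_mem P.ℓ₀_lt.ne
      shear_ℓ₀ := hjs0 ℓ₀_mem P.ξ₁_lt.ne' P.ℓ₀_lt.ne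
      moment_ℓ₁ := hjm0 ℓ₁_mem P.ξ₂_lt.ne'
      shear_ℓ₁ := hjs0 ℓ₁_mem ((P.ξ₁_lt.trans P.ℓ₀_lt).trans P.ξ₂_lt).ne' P.ξ₂_lt.ne'
      curvature_ξ₁ := ?_
      shear_ξ₁ := ⟨_, v.hasPointValue_fn ξ₁_mem, ?_⟩
      shear_ξ₂ := ⟨_, v.hasPointValue_fn ξ₂_mem, ?_⟩
      moment_ξ₂ := ⟨_, v.hasPointValue_dx ξ₂_mem, ?_⟩ }
  -- Near `ξ₁` the curvature is the moment divided by `α₁`.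
  · have h1 := (hjm0 ξ₁_mem n1).const_mul ((P.α₁ : ℂ)⁻¹)
    rw [mul_zero] at h1
    refine h1.congr (Ω := Iio P.ℓ₀) (Iio_mem_nhds P.ξ₁_lt) ?_
    refine (ae_restrict_iff' measurableSet_Iio).2 (Eventually.of_forall fun x hx => ?_)
    have hx' : x ∉ Ioo P.ℓ₀ P.ℓ₁ := fun h => absurd h.1 (not_lt.2 (le_of_lt hx))
    have hα : (P.α₁ : ℂ) ≠ 0 := Complex.ofReal_ne_zero.2 P.α₁_pos.ne'
    simp [moment, α, κ, hx', hα]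
  -- A step jumps by `-1` at its own point, so the coefficient `-c₁` in the shear produces the jump
  -- `c₁ = -γ₁ v(ξ₁)`.
  · have := hasJump_shearFamily h a (-P.γ₁ * v.value P.ξ₁) (-P.γ₂ * v.value P.ξ₂) ξ₁_mem
      (LTwo.hasJump_step_self ξ₁_mem) (LTwo.hasJump_step_of_ne ξ₁_mem n1)
    simpa using this
  · have := hasJump_shearFamily h a (-P.γ₁ * v.value P.ξ₁) (-P.γ₂ * v.value P.ξ₂) ξ₂_mem
      (LTwo.hasJump_step_of_ne ξ₂_mem n1.symm) (LTwo.hasJump_step_self ξ₂_mem)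
    simpa using this
  · have := hjm ξ₂_mem (LTwo.hasJump_step_self ξ₂_mem)
    simpa using this

end Beam

/-! ### The variational resolvent equation -/

namespace Beam

variable {P : Beam}

variable (P) in
/-- The functions in `L²(0,ℓ)` orthogonal to the affine functions. -/
def curvatures : Submodule ℂ (LTwo P.ℓ) :=
  (Submodule.span ℂ {LTwo.ramp P.ℓ P.ℓ, LTwo.step P.ℓ P.ℓ})ᗮ

lemma inner_step_of_mem_curvatures {p : LTwo P.ℓ} (hp : p ∈ P.curvatures) :
    inner ℂ (LTwo.step P.ℓ P.ℓ) p = 0 :=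
  (Submodule.mem_orthogonal _ _).1 hp _ (Submodule.subset_span (by simp))

lemma inner_ramp_of_mem_curvatures {p : LTwo P.ℓ} (hp : p ∈ P.curvatures) :
    inner ℂ (LTwo.ramp P.ℓ P.ℓ) p = 0 :=
  (Submodule.mem_orthogonal _ _).1 hp _ (Submodule.subset_span (by simp))

/-- A finite-dimensional subspace is its own double orthogonal complement. The coefficients `a`, `b`
act as Lagrange multipliers of the clamped conditions at `ℓ`. -/
lemma exists_of_mem_orthogonal_curvatures {q : LTwo P.ℓ} (hq : q ∈ P.curvaturesᗮ) :
    ∃ a b : ℂ, a • LTwo.ramp P.ℓ P.ℓ + b • LTwo.step P.ℓ P.ℓ = q := by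
  have : FiniteDimensional ℂ (Submodule.span ℂ {LTwo.ramp P.ℓ P.ℓ, LTwo.step P.ℓ P.ℓ}) :=
    FiniteDimensional.span_of_finite ℂ (toFinite _)
  rw [curvatures, Submodule.orthogonal_orthogonal] at hq
  exact Submodule.mem_span_pair.1 hq

/-- The operator `p ↦ ⟨e, p⟩ e`. -/
def rankOne (e : LTwo P.ℓ) : LTwo P.ℓ →L[ℂ] LTwo P.ℓ := (innerSL ℂ e).smulRight e

lemma rankOne_apply (e p : LTwo P.ℓ) : rankOne e p = (inner ℂ e p : ℂ) • e := rfl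

lemma re_inner_smul_rankOne {γ : ℝ} (hγ : 0 ≤ γ) (e p : LTwo P.ℓ) :
    0 ≤ (inner ℂ p ((γ : ℂ) • rankOne e p)).re := by
  rw [rankOne_apply, inner_smul_right, inner_smul_right, Complex.re_ofReal_mul]
  have h : (inner ℂ e p * inner ℂ p e).re = ‖inner ℂ e p * inner ℂ p e‖ :=
    inner_mul_symm_re_eq_norm (𝕜 := ℂ) e p
  rw [h]
  positivity

variable (P) in
/-- The operator of the variational form of the resolvent equation, acting on `v_xx`. -/
def resolventForm (lam : ℝ) : LTwo P.ℓ →L[ℂ] LTwo P.ℓ :=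
  -- Let `V` denote the Volterra operator, `v = V² p` and `w = V² q` with `q` orthogonal to the
  -- affine functions. Then `⟨w, v⟩ = ⟨q, V⁴ p⟩`, which is the source of the fourfold primitive; the
  -- rank-one terms encode the pointwise damping.
  (lam : ℂ) • (LTwo.volterra P.ℓ_pos.le ∘L LTwo.volterra P.ℓ_pos.le ∘L
      LTwo.volterra P.ℓ_pos.le ∘L LTwo.volterra P.ℓ_pos.le) +
    (lam : ℂ)⁻¹ • P.stiffness + P.viscosity + (P.γ₁ : ℂ) • rankOne (LTwo.ramp P.ℓ P.ξ₁) +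
    (P.γ₂ : ℂ) • rankOne (LTwo.ramp P.ℓ P.ξ₂) + (P.γ₃ : ℂ) • rankOne (LTwo.step P.ℓ P.ξ₂)

lemma resolventForm_apply (lam : ℝ) (p : LTwo P.ℓ) : P.resolventForm lam p =
    (lam : ℂ) • LTwo.volterra P.ℓ_pos.le (LTwo.volterra P.ℓ_pos.le
      (LTwo.volterra P.ℓ_pos.le (LTwo.volterra P.ℓ_pos.le p))) +
    (lam : ℂ)⁻¹ • P.stiffness p + P.viscosity p + (P.γ₁ : ℂ) • rankOne (LTwo.ramp P.ℓ P.ξ₁) p +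
    (P.γ₂ : ℂ) • rankOne (LTwo.ramp P.ℓ P.ξ₂) p + (P.γ₃ : ℂ) • rankOne (LTwo.step P.ℓ P.ξ₂) p :=
  rfl

/-- On `curvatures` the fourfold primitive contributes `lam ‖V² p‖² ≥ 0`, where `V` is the Volterra
operator. The viscous and rank-one terms are nonnegative too, so the stiffness alone provides
coercivity. -/
lemma resolventForm_coercive {lam : ℝ} (hl : 0 < lam) {p : LTwo P.ℓ} (hp : p ∈ P.curvatures) :
    lam⁻¹ * min P.α₁ P.α₂ * ‖p‖ ^ 2 ≤ (inner ℂ p (P.resolventForm lam p)).re := by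
  have h1 : 0 ≤ (inner ℂ p ((lam : ℂ) • LTwo.volterra P.ℓ_pos.le (LTwo.volterra P.ℓ_pos.le
      (LTwo.volterra P.ℓ_pos.le (LTwo.volterra P.ℓ_pos.le p))))).re := by
    rw [inner_smul_right, LTwo.inner_volterra_volterra P.ℓ_pos.le (inner_step_of_mem_curvatures hp)
      (inner_ramp_of_mem_curvatures hp), Complex.re_ofReal_mul]
    exact mul_nonneg hl.le (inner_self_nonneg (𝕜 := ℂ))
  have h2 : lam⁻¹ * min P.α₁ P.α₂ * ‖p‖ ^ 2 ≤ (inner ℂ p ((lam : ℂ)⁻¹ • P.stiffness p)).re := by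
    rw [inner_smul_right, ← Complex.ofReal_inv, Complex.re_ofReal_mul, mul_assoc]
    exact mul_le_mul_of_nonneg_left (re_inner_stiffness p) (inv_nonneg.2 hl.le)
  have h3 := re_inner_viscosity p
  have h4 := re_inner_smul_rankOne P.γ₁_pos.le (LTwo.ramp P.ℓ P.ξ₁) p
  have h5 := re_inner_smul_rankOne P.γ₂_pos.le (LTwo.ramp P.ℓ P.ξ₂) p
  have h6 := re_inner_smul_rankOne P.γ₃_pos.le (LTwo.step P.ℓ P.ξ₂) p
  simp only [resolventForm_apply, inner_add_right, Complex.add_re]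
  linarith

/-- The resolvent equation is solvable. -/
lemma operator_range {lam : ℝ} (hl : 0 < lam) (F : P.Phase) :
    ∃ U Z : P.Phase, (U, Z) ∈ P.operator.graph ∧ (lam : ℂ) • U - Z = F := by
  have hl0 : (lam : ℂ) ≠ 0 := Complex.ofReal_ne_zero.2 hl.ne'
  have hcpos : 0 < lam⁻¹ * min P.α₁ P.α₂ := mul_pos (inv_pos.2 hl) min_α_pos
  have : CompleteSpace P.curvatures := inferInstanceAs (CompleteSpace (Submodule.orthogonal _))
  -- With `F = (f, g)`, eliminating `u = lam⁻¹ (v + f)` and transferring the double primitive from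
  -- the test function to `g` leaves the datum `V² g - lam⁻¹ α f_xx`, where `V` is the Volterra
  -- operator.
  obtain ⟨p, hp, hq⟩ := exists_sub_mem_orthogonal_of_coercive P.curvatures (P.resolventForm lam)
    hcpos (fun p hp => resolventForm_coercive hl hp)
    (LTwo.volterra P.ℓ_pos.le (LTwo.volterra P.ℓ_pos.le F.vel) -
      (lam : ℂ)⁻¹ • P.stiffness F.disp.dxx)
  obtain ⟨a, b, hab⟩ := exists_of_mem_orthogonal_curvatures hq
  obtain ⟨v, rfl⟩ := H20.exists_dxx_eq (inner_step_of_mem_curvatures hp)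
    (inner_ramp_of_mem_curvatures hp)
  let u : P.H20 := (lam : ℂ)⁻¹ • (v + F.disp)
  let U : P.Phase := ((u, v.fn) : P.H20 × LTwo P.ℓ)
  let L : LTwo P.ℓ := F.vel - (lam : ℂ) • v.fn
  let Z : P.Phase := ((v, -L) : P.H20 × LTwo P.ℓ)
  have hu : U.disp.dxx = (lam : ℂ)⁻¹ • (v.dxx + F.disp.dxx) := rfl
  refine ⟨U, Z, ?_, ?_⟩
  · rw [operator_graph]
    refine ⟨_, L, inDomain_of_moment_eq (U := U) (v := v) (h := L) (a := a) (b := b) rfl ?_, rfl⟩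
    rw [resolventForm_apply, rankOne_apply, rankOne_apply, rankOne_apply,
      v.inner_ramp ξ₁_mem.1.le ξ₁_mem.2.le, v.inner_ramp ξ₂_mem.1.le ξ₂_mem.2.le,
      v.inner_step ξ₂_mem.1.le ξ₂_mem.2.le, ← v.fn_eq] at hab
    rw [momentFamily, hu]
    -- The residual identity `hab` is the moment equation rearranged: its affine part gives `a` and
    -- `b`, and the double primitive of `g - lam v` is the bulk term.
    simp only [L, map_smul, map_add, map_sub]
    rw [← sub_eq_zero] at hab ⊢
    rw [← neg_eq_zero, ← hab]
    module
  · refine Phase.ext' ?_ ?_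
    · change (lam : ℂ) • ((lam : ℂ)⁻¹ • (v + F.disp)) - v = F.disp
      rw [smul_inv_smul₀ hl0, add_sub_cancel_left]
    · change (lam : ℂ) • v.fn - -(F.vel - (lam : ℂ) • v.fn) = F.vel
      abel

/-- The operator of the beam is maximal dissipative. -/
lemma operator_maxDissipative : MaxDissipative P.operator :=
  ⟨operator_dissipative, fun _ hl F => operator_range hl F⟩

end Beam

end

theorem mainTheorem2 (P : Beam) :
    CompleteSpace P.Phase ∧
    ∃ S : ContractionSemigroup P.Phase,
      S.IsGenerator P.operator ∧
      ∀ T : EReal, 0 < T →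
        (∀ U₀ : P.Phase,
          IsMildSolution P.operator T U₀ (fun t => S.S t.toNNReal U₀) ∧
          ∀ U : ℝ → P.Phase, IsMildSolution P.operator T U₀ U →
            ∀ t ∈ timeInterval T, U t = S.S t.toNNReal U₀) ∧
        (∀ U₀ ∈ P.operator.domain,
          IsClassicalSolution P.operator T U₀ (fun t => S.S t.toNNReal U₀) ∧
          ∀ U : ℝ → P.Phase, IsClassicalSolution P.operator T U₀ U →
            ∀ t ∈ timeInterval T, U t = S.S t.toNNReal U₀) :=
  ⟨Beam.completeSpace_phase, Beam.operator_maxDissipative.cauchyProblem⟩
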